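/- Let $(\Omega,\mathcal F,\mathbb P)$ be a probability space, $\mathcal F_n\subseteq\mathcal F$ a sequence of $\sigma$-algebras and $\{W_{in}\}_{1\le i\le n,\,n\ge1}$ a triangular array of real random variables such that, for each $n$, the variables $W_{1n},\dots,W_{nn}$ are independent conditionally on $\mathcal F_n$ and $\mathbb E[W_{in}\mid\mathcal F_n]=0$ for all $i$. Conditional probabilities and expectations of $W_{in}$ given $\mathcal F_n$ are taken with respect to a regular conditional distribution. For random variables $X_n$ write $X_n=O_{\mathbb P}(1)$ if for each $\delta>0$ there is $M>0$ with $\limsup_n\mathbb P[|X_n|>M]<\delta$; $X_n=\Omega_{\mathbb P}(1)$ if for each $\delta>0$ there is $\eta>0$ with $\limsup_n\mathbb P[|X_n|<\eta]<\delta$; and $X_n=o_{\mathbb P}(1)$ if $\mathbb P[|X_n|>\eta]\to0$ for all $\eta>0$. Suppose that one of the following holds. (CSE) There are a constant $\beta>0$ and $\mathcal F_n$-measurable, real-valued, almost surely nonnegative $\theta_n=O_{\mathbb P}(1)$ such that for all $i,n$, almost surely, $\mathbb P[|W_{in}|\ge t\mid\mathcal F_n]\le\theta_n e^{-\beta t}$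 for all $t>0$. (CCS) There are $\mathcal F_n$-measurable, real-valued, almost surely nonnegative $\nu_{in}$ such that $W_{in}\in[-\nu_{in},\nu_{in}]$ almost surely for all $i,n$, and $\frac1n\sum_{i=1}^n\nu_{in}^4=O_{\mathbb P}(1)$. Suppose further that $\frac1n\sum_{i=1}^n\mathbb E[W_{in}^2\mid\mathcal F_n]=\Omega_{\mathbb P}(1)$, and let $w_n$ be $\mathcal F_n$-measurable real random variables with $w_n=o_{\mathbb P}(1)$. Let $K_{in}(s)=\log\mathbb E[\exp(sW_{in})\mid\mathcal F_n]$ and $K_n(s)=\frac1n\sum_{i=1}^nK_{in}(s)$. Then there is $\varepsilon>0$ such that, almost surely, $$K_{in}(s)<\infty\quad\text{for all } s\in(-\varepsilon,\varepsilon),\ 1\le i\le n,\ n\ge1, \tag{1}$$ and for every $\varepsilon>0$ with this property the following holds. Put $S_n=\{s\in[-\varepsilon/2,\varepsilon/2]:K_n'(s)=w_n\}$. Let $\hat s_n$ be the single element of $S_n$ if $|S_n|=1$, and $\hat s_n=\frac\varepsilon2\operatorname{sgn}(w_n)$ otherwise. Put $\lambda_n=\hat s_n\sqrt{nK_n''(\hat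 s_n)}$; put $r_n=\operatorname{sgn}(\hat s_n)\sqrt{2n(\hat s_nw_n-K_n(\hat s_n))}$ if $\hat s_nw_n-K_n(\hat s_n)\ge0$, and $r_n=\operatorname{sgn}(\hat s_n)$ otherwise. Let $$\hat p_n=1-\Phi(r_n)+\phi(r_n)\Big\{\frac1{\lambda_n}-\frac1{r_n}\Big\},$$ where $\Phi,\phi$ are the standard normal distribution function and density and $\frac10-\frac10=0$ by convention. Then the saddlepoint equation has a unique solution in $[-\varepsilon/2,\varepsilon/2]$ with probability approaching one, $$\lim_{n\to\infty}\mathbb P[|S_n|=1]=1,$$ and the approximation $\hat p_n$ has vanishing relative error, $$\mathbb P\Big[\frac1n\sum_{i=1}^nW_{in}\ge w_n\ \Big|\ \mathcal F_n\Big]=\hat p_n\,(1+o_{\mathbb P}(1)),$$ that is, for every $\eta>0$ the probability that the two sides $p_n$ (left) and $\hat p_n$ satisfy $|p_n-\hat p_n|>\eta|\hat p_n|$ tends to $0$. -/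

import Mathlib

open MeasureTheory ProbabilityTheory Filter Topology

namespace CondSPA

noncomputable section

/-! ### Stochastic orders -/

/-- `X n = O_P(1)`: for each `δ > 0` there is `M > 0` with `limsup P[|X n| > M] < δ`. -/
def IsBigOP {Ω : Type*} [MeasurableSpace Ω] (μ : Measure Ω) (X : ℕ → Ω → ℝ) : Prop :=
  ∀ δ : ℝ, 0 < δ → ∃ M : ℝ, 0 < M ∧
    limsup (fun n => μ {ω | M < |X n ω|}) atTop < ENNReal.ofReal δ

/-- `X n = Ω_P(1)`: for each `δ > 0` there is `η > 0` with `limsup P[|X n| < η] < δ`. -/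
def IsBigOmegaP {Ω : Type*} [MeasurableSpace Ω] (μ : Measure Ω) (X : ℕ → Ω → ℝ) : Prop :=
  ∀ δ : ℝ, 0 < δ → ∃ η : ℝ, 0 < η ∧
    limsup (fun n => μ {ω | |X n ω| < η}) atTop < ENNReal.ofReal δ

/-- `X n = o_P(1)`: `P[|X n| > η] → 0` for all `η > 0`. -/
def IsLittleOP {Ω : Type*} [MeasurableSpace Ω] (μ : Measure Ω) (X : ℕ → Ω → ℝ) : Prop :=
  ∀ η : ℝ, 0 < η → Tendsto (fun n => μ {ω | η < |X n ω|}) atTop (𝓝 0)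

/-- The events `E n` have probability tending to `1`. The second conjunct makes this meaningful
for the outer measure without a separate measurability claim. -/
def TendsToProbOne {Ω : Type*} [MeasurableSpace Ω] (μ : Measure Ω) (E : ℕ → Set Ω) : Prop :=
  Tendsto (fun n => μ (E n)) atTop (𝓝 1) ∧ Tendsto (fun n => μ (E n)ᶜ) atTop (𝓝 0)

/-- `p n = q n * (1 + o_P(1))`: the relative error `p n / q n - 1` is `o_P(1)`, where `0 / 0 = 1`
and where `x / 0` with `x ≠ 0` counts as an infinite ratio. -/
def VanishingRelError {Ω : Type*} [MeasurableSpace Ω] (μ : Measure Ω) (p q : ℕ → Ω → ℝ) : Prop :=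
  ∀ η : ℝ, 0 < η → Tendsto (fun n => μ {ω | η * |q n ω| < |p n ω - q n ω|}) atTop (𝓝 0)

/-! ### Conditional laws -/

/-- Regular conditional distribution `κ(ω, ·)` of the real random variable `Y` given the
sub-σ-algebra `m`: the conditional distribution of `Y` given the identity map
`(Ω, mΩ) → (Ω, m)`. -/
def condLaw {Ω : Type*} (m : MeasurableSpace Ω) [mΩ : MeasurableSpace Ω] (μ : Measure Ω)
    [IsFiniteMeasure μ] (Y : Ω → ℝ) (ω : Ω) : Measure ℝ :=
  (@condDistrib Ω Ω ℝ _ _ _ mΩ m Y id μ _) ω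

/-- `E[Y | m] = 0`, the conditional mean being taken with respect to the regular conditional
distribution (so that `Y` need not be unconditionally integrable). -/
def CondMeanZero {Ω : Type*} (m : MeasurableSpace Ω) [MeasurableSpace Ω] (μ : Measure Ω)
    [IsFiniteMeasure μ] (Y : Ω → ℝ) : Prop :=
  ∀ᵐ ω ∂μ, Integrable (fun x : ℝ => x) (condLaw m μ Y ω) ∧ ∫ x, x ∂(condLaw m μ Y ω) = 0

/-- The finitely many random variables `Y i` are independent conditionally on `m`. (Taking some
of the `B i` to be the whole line gives the product formula for subfamilies.) -/
def CondIndependent {Ω : Type*} (m : MeasurableSpace Ω) [MeasurableSpace Ω] (μ : Measure Ω)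
    {n : ℕ} (Y : Fin n → Ω → ℝ) : Prop :=
  ∀ B : Fin n → Set ℝ, (∀ i, MeasurableSet (B i)) →
    μ⟦⋂ i, Y i ⁻¹' B i | m⟧ =ᵐ[μ] fun ω => ∏ i, (μ⟦Y i ⁻¹' B i | m⟧) ω

/-- `Y | m` is conditionally sub-exponential with parameters `(θ, β)`. -/
def IsCSE {Ω : Type*} (m : MeasurableSpace Ω) [MeasurableSpace Ω] (μ : Measure Ω)
    [IsFiniteMeasure μ] (Y : Ω → ℝ) (θ : Ω → ℝ) (β : ℝ) : Prop :=
  ∀ᵐ ω ∂μ, ∀ t : ℝ, 0 < t →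
    (condLaw m μ Y ω).real {x | t ≤ |x|} ≤ θ ω * Real.exp (-β * t)

/-- `Y | m` is conditionally compactly supported on `[-ν, ν]`. -/
def IsCCS {Ω : Type*} [MeasurableSpace Ω] (μ : Measure Ω) (Y : Ω → ℝ) (ν : Ω → ℝ) : Prop :=
  ∀ᵐ ω ∂μ, Y ω ∈ Set.Icc (-ν ω) (ν ω)

/-- CSE condition on a triangular array: for `F n`-measurable `θ n ≥ 0` with `θ n = O_P(1)` and a
constant `β > 0`, all `W n i` are conditionally sub-exponential with parameters `(θ n, β)`. -/
def CSECondition {Ω : Type*} [MeasurableSpace Ω] (μ : Measure Ω) [IsFiniteMeasure μ]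
    (F : ℕ → MeasurableSpace Ω) (W : (n : ℕ) → Fin n → Ω → ℝ) : Prop :=
  ∃ (θ : ℕ → Ω → ℝ) (β : ℝ), 0 < β ∧ (∀ n, Measurable[F n] (θ n)) ∧
    (∀ n, ∀ᵐ ω ∂μ, 0 ≤ θ n ω) ∧
    (∀ n i, IsCSE (F n) μ (W n i) (θ n) β) ∧ IsBigOP μ θ

/-- CCS condition on a triangular array: for `F n`-measurable `ν n i ≥ 0` with
`(1/n) ∑ i, (ν n i)^4 = O_P(1)`, each `W n i` is conditionally supported on `[-ν n i, ν n i]`. -/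
def CCSCondition {Ω : Type*} [MeasurableSpace Ω] (μ : Measure Ω)
    (F : ℕ → MeasurableSpace Ω) (W : (n : ℕ) → Fin n → Ω → ℝ) : Prop :=
  ∃ ν : (n : ℕ) → Fin n → Ω → ℝ, (∀ n i, Measurable[F n] (ν n i)) ∧
    (∀ n i, ∀ᵐ ω ∂μ, 0 ≤ ν n i ω) ∧
    (∀ n i, IsCCS μ (W n i) (ν n i)) ∧
    IsBigOP μ (fun n ω => (1 / (n : ℝ)) * ∑ i, ν n i ω ^ 4)

/-- Average conditional second moment `(1/n) ∑ i, E[(Y i)^2 | m]`. -/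
def avgCondVar {Ω : Type*} (m : MeasurableSpace Ω) [MeasurableSpace Ω] (μ : Measure Ω)
    [IsFiniteMeasure μ] {n : ℕ} (Y : Fin n → Ω → ℝ) (ω : Ω) : ℝ :=
  (1 / (n : ℝ)) * ∑ i, ∫ x, x ^ 2 ∂(condLaw m μ (Y i) ω)

/-! ### The saddlepoint approximation -/

/-- Averaged conditional cumulant generating function
`K(s) = (1/n) ∑ i, log E[exp (s * Y i) | m]`. -/
def avgCGF {Ω : Type*} (m : MeasurableSpace Ω) [MeasurableSpace Ω] (μ : Measure Ω)
    [IsFiniteMeasure μ] {n : ℕ} (Y : Fin n → Ω → ℝ) (ω : Ω) (s : ℝ) : ℝ :=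
  (1 / (n : ℝ)) * ∑ i, cgf (fun x : ℝ => x) (condLaw m μ (Y i) ω) s

/-- `ε > 0` is such that, almost surely, all the conditional cumulant generating functions of the
array are finite on `(-ε, ε)` (hence infinitely differentiable there). -/
def FiniteCGFOn {Ω : Type*} [MeasurableSpace Ω] (μ : Measure Ω) [IsFiniteMeasure μ]
    (F : ℕ → MeasurableSpace Ω) (W : (n : ℕ) → Fin n → Ω → ℝ) (ε : ℝ) : Prop :=
  0 < ε ∧ ∀ᵐ ω ∂μ, ∀ (n : ℕ) (i : Fin n), ∀ s ∈ Set.Ioo (-ε) ε,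
    Integrable (fun x : ℝ => Real.exp (s * x)) (condLaw (F n) μ (W n i) ω)

/-- Solutions in `[-ε/2, ε/2]` of the saddlepoint equation `K'(s) = w`. -/
def saddleSet (K : ℝ → ℝ) (w ε : ℝ) : Set ℝ :=
  {s | s ∈ Set.Icc (-(ε / 2)) (ε / 2) ∧ deriv K s = w}

open Classical in
/-- The saddlepoint: the single element of the solution set if there is exactly one solution, and
`(ε/2) sgn w` otherwise. -/
def saddlepoint (K : ℝ → ℝ) (w ε : ℝ) : ℝ :=
  if h : (saddleSet K w ε).encard = 1 then (Set.encard_eq_one.mp h).choose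
  else ε / 2 * Real.sign w

/-- `λ = ŝ √(n K''(ŝ))`. -/
def lam (n : ℕ) (K : ℝ → ℝ) (w ε : ℝ) : ℝ :=
  saddlepoint K w ε * √(n * iteratedDeriv 2 K (saddlepoint K w ε))

open Classical in
/-- `r = sgn(ŝ) √(2n(ŝ w - K(ŝ)))` if `ŝ w - K(ŝ) ≥ 0`, and `r = sgn(ŝ)` otherwise. -/
def rstat (n : ℕ) (K : ℝ → ℝ) (w ε : ℝ) : ℝ :=
  if 0 ≤ saddlepoint K w ε * w - K (saddlepoint K w ε) then
    Real.sign (saddlepoint K w ε) *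
      √(2 * n * (saddlepoint K w ε * w - K (saddlepoint K w ε)))
  else Real.sign (saddlepoint K w ε)

/-- Lugannani–Rice formula `1 - Φ(r) + φ(r) (1/λ - 1/r)`, with `Φ` and `φ` the standard normal
distribution function and density. For `λ = r = 0` it uses `1/0 - 1/0 = 0`. -/
def lugannaniRice (n : ℕ) (K : ℝ → ℝ) (w ε : ℝ) : ℝ :=
  1 - cdf (gaussianReal 0 1) (rstat n K w ε) +
    gaussianPDFReal 0 1 (rstat n K w ε) * (1 / lam n K w ε - 1 / rstat n K w ε)

end

end CondSPA

namespace CondSPA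

/-! ### A compactly supported probability measure with nonnegative integrable Fourier transform -/

/-! Almost surely the conditional joint law of `W n 1, …, W n n` given `F n` is the product of the
regular conditional laws (`condDistrib_pi_ae_eq`), so the conditional tail probability at `ω` is a
tail probability for independent variables with fixed laws and a fixed threshold. It therefore
suffices to bound the relative error deterministically, uniformly over all families of centred laws
whose average variance is at least `η` and whose tilted third absolute moments are at most `B` on
average (`exists_uniform_lugannaniRice`). The tail conditions and stochastic orders place `ω` in
that regime outside an event of small probability (`exists_tilted_third_moment_bound`,
`eventually_exists_small_exceptional_set`).

For the deterministic estimate, put `σ = √(n K''(s))` at the saddlepoint `s`, so that `λ = s σ`.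
Tilting by `s` moves the mean of the sum to `n w`. With `ν` the law of the standardized tilted sum
and `s ≥ 0`, the tail probability equals `exp(n (K(s) - s w)) ∫_{z ≥ 0} exp(-λ z) dν(z)`, and the
prefactor is exactly `exp(-r² / 2)`. A Berry–Esseen bound for `ν`, applied to the superlevel sets of
the integrand, which are intervals, replaces the integral by its Gaussian value `mills λ` with error
`O(1 / σ)`. As `mills λ` is of order `1 / (1 + λ)`, this is a relative error `O((1 + λ) / σ) = O(1 /
σ + |s|)`, which is small because `|s| ≤ 2 |w| / η`.

The same factor `exp(-r² / 2)` splits off the Lugannani–Rice formula, leaving `mills r + (2π)^(-1/2)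
(1/λ - 1/r)`. A Taylor estimate of the Legendre transform gives `r = ρ λ` with `ρ - 1 = O(|s|)`
(`saddlepoint_spec`). Hence this remainder differs from `mills λ` by `O(|s| / (1 + λ) + 1 / σ)`,
again relatively small. For `s < 0` the argument is applied to the complementary event; the
approximation is then bounded below and an absolute error suffices.

The Berry–Esseen bound (`exists_berryEsseen_const`) comes from Fourier smoothing with the kernel
`sinc(x / 4)^4`, which is nonnegative, decays fast and has a compactly supported Fourier transform.
-/

lemma ae_abs_le_conv {μ ν : Measure ℝ} [IsProbabilityMeasure μ] [IsProbabilityMeasure ν] {a b : ℝ}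
    (hμ : ∀ᵐ x ∂μ, |x| ≤ a) (hν : ∀ᵐ x ∂ν, |x| ≤ b) : ∀ᵐ x ∂(μ ∗ ν), |x| ≤ a + b := by
  rw [Measure.conv, ae_map_iff (by fun_prop) (measurableSet_le (by fun_prop) (by fun_prop))]
  have h1 : ∀ᵐ p ∂(μ.prod ν), |p.1| ≤ a := Measure.quasiMeasurePreserving_fst.ae hμ
  have h2 : ∀ᵐ p ∂(μ.prod ν), |p.2| ≤ b := Measure.quasiMeasurePreserving_snd.ae hν
  filter_upwards [h1, h2] with p h1 h2
  exact (abs_add_le _ _).trans (add_le_add h1 h2)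

/-- A convolution with `ν` is a `ν`-average of translates of `μ`, and Lebesgue measure is
translation invariant. -/
lemma conv_le_smul_volume {μ ν : Measure ℝ} [IsProbabilityMeasure μ] [IsProbabilityMeasure ν]
    {c : ENNReal} (hμ : μ ≤ c • volume) : μ ∗ ν ≤ c • volume := by
  refine Measure.le_iff.2 fun s hs => ?_
  rw [Measure.conv_comm, Measure.conv, Measure.map_apply (by fun_prop) hs,
    Measure.prod_apply (hs.preimage (by fun_prop))]
  calc ∫⁻ y, μ (Prod.mk y ⁻¹' ((fun p : ℝ × ℝ => p.1 + p.2) ⁻¹' s)) ∂ν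
      ≤ ∫⁻ _, c * volume s ∂ν := by
        refine lintegral_mono fun y => (hμ _).trans ?_
        have : Prod.mk y ⁻¹' ((fun p : ℝ × ℝ => p.1 + p.2) ⁻¹' s) = (fun x => y + x) ⁻¹' s := rfl
        rw [this, Measure.smul_apply, measure_preimage_add, smul_eq_mul]
    _ = (c • volume) s := by simp

/-- The uniform distribution on `[-1/4, 1/4]`. -/
noncomputable def unifQuarter : Measure ℝ :=
  (2 : ENNReal) • volume.restrict (Set.Icc (-(1 / 4)) (1 / 4))

instance : IsProbabilityMeasure unifQuarter := by
  constructor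
  rw [unifQuarter, Measure.smul_apply, Measure.restrict_apply_univ, Real.volume_Icc, smul_eq_mul,
    show (2 : ENNReal) = ENNReal.ofReal 2 by simp, ← ENNReal.ofReal_mul (by norm_num)]
  norm_num

lemma unifQuarter_le : unifQuarter ≤ (2 : ENNReal) • volume := by
  unfold unifQuarter
  gcongr
  exact Measure.restrict_le_self

lemma ae_abs_le_unifQuarter : ∀ᵐ x ∂unifQuarter, |x| ≤ 1 / 4 := by
  refine Measure.ae_smul_measure ?_ _
  filter_upwards [ae_restrict_mem measurableSet_Icc] with x hx
  exact abs_le.2 hx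

lemma charFun_unifQuarter (x : ℝ) : charFun unifQuarter x = (Real.sinc (x / 4) : ℝ) := by
  rw [charFun_apply_real, unifQuarter, integral_smul_measure, integral_Icc_eq_integral_Ioc,
    ← intervalIntegral.integral_of_le (by norm_num)]
  rcases eq_or_ne x 0 with rfl | hx
  · simp
    norm_num
  · have h : ∀ y : ℝ, Complex.exp (x * y * Complex.I) = Complex.exp ((x * Complex.I) * y) := by
      intro y; ring_nf
    simp_rw [h]
    have hx' : (x : ℂ) * Complex.I ≠ 0 := by simp [hx]
    rw [integral_exp_mul_complex hx', Real.sinc_of_ne_zero (by positivity)]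
    have hs : Complex.sin (x / 4) =
      (Complex.exp (-(x / 4) * Complex.I) - Complex.exp (x / 4 * Complex.I)) * Complex.I / 2 := rfl
    push_cast
    rw [hs]
    have hxc : (x : ℂ) ≠ 0 := by exact_mod_cast hx
    rw [show (x : ℂ) * Complex.I * (1 / 4) = x / 4 * Complex.I by ring,
      show (x : ℂ) * Complex.I * (-(1 / 4)) = -(x / 4) * Complex.I by ring]
    simp only [ENNReal.toReal_ofNat, Complex.real_smul, Complex.ofReal_ofNat]
    generalize Complex.exp (-(x / 4) * Complex.I) = A
    generalize Complex.exp (x / 4 * Complex.I) = B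
    field_simp
    linear_combination 4 * (B - A) * Complex.I_sq

/-- The fourfold convolution power of the uniform distribution on `[-1/4, 1/4]`. -/
noncomputable def smoothingMeasure : Measure ℝ :=
  (unifQuarter ∗ unifQuarter) ∗ (unifQuarter ∗ unifQuarter)

instance : IsProbabilityMeasure smoothingMeasure := by
  unfold smoothingMeasure; infer_instance

/-- The Fourier transform of `smoothingMeasure`. -/
noncomputable def smoothingKernel (x : ℝ) : ℝ := Real.sinc (x / 4) ^ 4

lemma charFun_smoothingMeasure (x : ℝ) : charFun smoothingMeasure x = (smoothingKernel x : ℝ) := by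
  simp only [smoothingMeasure, charFun_conv, charFun_unifQuarter, smoothingKernel]
  push_cast
  ring

lemma smoothingMeasure_le : smoothingMeasure ≤ (2 : ENNReal) • volume :=
  conv_le_smul_volume (conv_le_smul_volume unifQuarter_le)

lemma ae_abs_le_smoothingMeasure : ∀ᵐ x ∂smoothingMeasure, |x| ≤ 1 := by
  have h := ae_abs_le_conv ae_abs_le_unifQuarter ae_abs_le_unifQuarter
  filter_upwards [ae_abs_le_conv h h] with x hx
  linarith

lemma smoothingMeasure_le_restrict :
    smoothingMeasure ≤ (2 : ENNReal) • volume.restrict (Set.Icc (-1) 1) := by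
  have h : smoothingMeasure = smoothingMeasure.restrict (Set.Icc (-1) 1) := by
    refine (Measure.restrict_eq_self_of_ae_mem ?_).symm
    filter_upwards [ae_abs_le_smoothingMeasure] with x hx using abs_le.1 hx
  rw [h, ← Measure.restrict_smul]
  exact Measure.restrict_mono le_rfl smoothingMeasure_le

lemma smoothingKernel_nonneg (x : ℝ) : 0 ≤ smoothingKernel x := by
  unfold smoothingKernel; positivity

@[fun_prop]
lemma continuous_smoothingKernel : Continuous smoothingKernel := by
  unfold smoothingKernel
  exact (Real.continuous_sinc.comp (by fun_prop)).pow 4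

/-- Jordan's inequality `sin y ≥ 2 y / π` bounds the kernel below near the origin, so a multiple of
it dominates the indicator of `[-1, 1]`; this gives the concentration bound. -/
lemma smoothingKernel_ge {x : ℝ} (hx : |x| ≤ 1) : 1 / 16 ≤ smoothingKernel x := by
  have key : ∀ y : ℝ, 0 ≤ y → y ≤ 1 → 1 / 2 ≤ Real.sinc (y / 4) := by
    intro y hy hy1
    rcases hy.eq_or_lt with rfl | hy
    · norm_num
    rw [Real.sinc_of_ne_zero (by positivity), le_div_iff₀ (by positivity)]
    have h := Real.mul_le_sin (x := y / 4) (by positivity) (by linarith [Real.pi_gt_three])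
    have h2 : 1 / 2 ≤ 2 / Real.pi := by
      rw [div_le_div_iff₀ (by norm_num) Real.pi_pos]; linarith [Real.pi_le_four]
    nlinarith
  have h : 1 / 2 ≤ Real.sinc (x / 4) := by
    rcases le_total 0 x with h0 | h0
    · exact key x h0 (le_of_abs_le hx)
    · have := key (-x) (by linarith) (by linarith [neg_le_of_abs_le hx])
      rwa [neg_div, Real.sinc_neg] at this
  unfold smoothingKernel
  calc (1 : ℝ) / 16 = (1 / 2) ^ 4 := by norm_num
    _ ≤ _ := by gcongr

/-- The fourth power of `sinc` decays like `|x|^(-4)`, so the kernel stays integrable against the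
weight `1 + |x|`. With a square the weighted integral would diverge. -/
lemma one_add_abs_mul_smoothingKernel_le (x : ℝ) :
    (1 + |x|) * smoothingKernel x ≤ 1024 * (1 + x ^ 2)⁻¹ := by
  have h0 := smoothingKernel_nonneg x
  rw [← div_eq_mul_inv, le_div_iff₀ (by positivity)]
  have h1 : smoothingKernel x ≤ 1 := by
    unfold smoothingKernel
    have h : |Real.sinc (x / 4)| ^ 4 ≤ 1 := pow_le_one₀ (abs_nonneg _) (Real.abs_sinc_le_one _)
    rwa [Even.pow_abs (by decide)] at h
  rcases le_or_gt |x| 1 with hx | hx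
  · have hx2 : x ^ 2 ≤ 1 := by rw [← sq_abs]; exact pow_le_one₀ (abs_nonneg _) hx
    have : (1 + |x|) * (1 + x ^ 2) ≤ 2 * 2 := by gcongr <;> linarith
    nlinarith
  · have hx0 : x ≠ 0 := by rintro rfl; norm_num at hx
    have h2 : smoothingKernel x * |x| ^ 4 ≤ 256 := by
      unfold smoothingKernel
      rw [Real.sinc_of_ne_zero (by positivity), Even.pow_abs (by decide)]
      have hs : Real.sin (x / 4) ^ 4 ≤ 1 := by
        rw [← Even.pow_abs (by decide)]
        exact pow_le_one₀ (abs_nonneg _) (Real.abs_sin_le_one _)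
      have : (Real.sin (x / 4) / (x / 4)) ^ 4 * x ^ 4 = 256 * Real.sin (x / 4) ^ 4 := by
        field_simp; ring
      rw [this]; linarith
    have h3 : (1 + |x|) * (1 + x ^ 2) ≤ 4 * |x| ^ 4 := by
      have e1 : 1 + |x| ≤ 2 * |x| := by linarith
      have e2 : 1 + x ^ 2 ≤ 2 * |x| ^ 2 := by rw [sq_abs]; nlinarith [sq_abs x]
      calc (1 + |x|) * (1 + x ^ 2) ≤ (2 * |x|) * (2 * |x| ^ 2) := by gcongr
        _ = 4 * |x| ^ 3 := by ring
        _ ≤ 4 * |x| ^ 4 := by gcongr <;> first | exact hx.le | norm_num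
    nlinarith

lemma integrable_one_add_abs_mul_smoothingKernel :
    Integrable fun x => (1 + |x|) * smoothingKernel x := by
  refine (integrable_inv_one_add_sq.const_mul 1024).mono'
    (by fun_prop) (Eventually.of_forall fun x => ?_)
  rw [Real.norm_of_nonneg (mul_nonneg (by positivity) (smoothingKernel_nonneg x))]
  exact one_add_abs_mul_smoothingKernel_le x

lemma integrable_smoothingKernel : Integrable smoothingKernel := by
  refine integrable_one_add_abs_mul_smoothingKernel.mono'
    (by fun_prop) (Eventually.of_forall fun x => ?_)
  have := smoothingKernel_nonneg x
  rw [Real.norm_of_nonneg this]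
  nlinarith [abs_nonneg x]

lemma integral_smoothingKernel_pos : 0 < ∫ x, smoothingKernel x := by
  rw [integral_pos_iff_support_of_nonneg smoothingKernel_nonneg integrable_smoothingKernel]
  refine lt_of_lt_of_le ?_ (measure_mono (s := Set.Icc (-1) 1) fun x hx => ?_)
  · rw [Real.volume_Icc]; norm_num
  · have := smoothingKernel_ge (abs_le.2 hx)
    exact (lt_of_lt_of_le (by norm_num) this).ne'

/-! ### Smoothing inequality for the distance between two laws on intervals -/

lemma ofReal_smoothingKernel (x : ℝ) :
    (smoothingKernel x : ℂ) = ∫ t, Complex.exp (x * t * Complex.I) ∂smoothingMeasure := by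
  rw [← charFun_smoothingMeasure, charFun_apply_real]

/-- Parseval: the kernel is the Fourier transform of `smoothingMeasure`, and Fubini moves the
transform onto `ν`. Only frequencies up to `T` enter, by the compact support. -/
lemma integral_smoothingKernel_eq (ν : Measure ℝ) [IsProbabilityMeasure ν] (T y : ℝ) :
    ((∫ x, smoothingKernel (T * (x - y)) ∂ν : ℝ) : ℂ) =
      ∫ t, Complex.exp (((-(T * t) * y : ℝ) : ℂ) * Complex.I) * charFun ν (T * t)
        ∂smoothingMeasure := by
  rw [← integral_complex_ofReal]
  simp_rw [ofReal_smoothingKernel]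
  rw [integral_integral_swap]
  · refine integral_congr_ae (Eventually.of_forall fun t => ?_)
    simp only [charFun_apply_real]
    rw [← integral_const_mul]
    refine integral_congr_ae (Eventually.of_forall fun x => ?_)
    simp only
    rw [← Complex.exp_add]
    congr 1
    push_cast
    ring
  · refine (integrable_const (1 : ℝ)).mono' ?_ (Eventually.of_forall fun p => ?_)
    · exact Continuous.aestronglyMeasurable (by simp only [Function.uncurry_def]; fun_prop)
    · simp only [Function.uncurry_def]
      rw [← Complex.ofReal_mul, Complex.norm_exp_ofReal_mul_I]

/-- `smoothingMeasure` has density at most `2` on `[-1, 1]`; rescaling by `T` does the rest. -/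
lemma integral_smoothingMeasure_le {f : ℝ → ℝ} (hf : Continuous f) (h0 : ∀ x, 0 ≤ f x)
    {T : ℝ} (hT : 0 < T) :
    ∫ t, f (T * t) ∂smoothingMeasure ≤ 2 / T * ∫ t in Set.Icc (-T) T, f t := by
  have hint : Integrable (fun t => f (T * t)) ((2 : ENNReal) • volume.restrict (Set.Icc (-1) 1)) := by
    refine Integrable.smul_measure ?_ (by simp)
    exact (Continuous.continuousOn (by fun_prop)).integrableOn_compact isCompact_Icc
  refine (integral_mono_measure smoothingMeasure_le_restrict
    (Eventually.of_forall fun t => h0 _) hint).trans_eq ?_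
  rw [integral_smul_measure, integral_Icc_eq_integral_Ioc, integral_Icc_eq_integral_Ioc,
    ← intervalIntegral.integral_of_le (by norm_num), ← intervalIntegral.integral_of_le (by linarith),
    intervalIntegral.integral_comp_mul_left _ hT.ne']
  simp
  ring

lemma setIntegral_symm_mono {f : ℝ → ℝ} (hf : Continuous f) (h0 : ∀ x, 0 ≤ f x) {S T : ℝ}
    (hST : S ≤ T) : ∫ t in Set.Icc (-S) S, f t ≤ ∫ t in Set.Icc (-T) T, f t :=
  setIntegral_mono_set (hf.continuousOn.integrableOn_compact isCompact_Icc)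
    (Eventually.of_forall fun x => h0 x)
    (Set.Icc_subset_Icc (by linarith) hST).eventuallyLE

/-- Concentration bound in terms of the characteristic function. -/
lemma measureReal_abs_sub_le (ν : Measure ℝ) [IsProbabilityMeasure ν] {T B : ℝ} (hT : 0 < T)
    (hB : ∫ t in Set.Icc (-T) T, ‖charFun ν t‖ ≤ B) (a : ℝ) :
    ν.real {x | |x - a| ≤ 1 / T} ≤ 32 * B / T := by
  have hint : Integrable (fun x => smoothingKernel (T * (x - a))) ν := by
    refine (integrable_const (1 : ℝ)).mono' (Continuous.aestronglyMeasurable (by fun_prop))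
      (Eventually.of_forall fun x => ?_)
    rw [← Complex.norm_real, ← charFun_smoothingMeasure]
    exact norm_charFun_le_one _
  have hm : MeasurableSet {x : ℝ | |x - a| ≤ 1 / T} :=
    measurableSet_le (by fun_prop) (by fun_prop)
  have h1 : ν.real {x | |x - a| ≤ 1 / T} * (1 / 16) ≤ ∫ x, smoothingKernel (T * (x - a)) ∂ν := by
    rw [← smul_eq_mul, ← setIntegral_const]
    refine (setIntegral_mono_on (integrable_const _).integrableOn hint.integrableOn hm ?_).trans
      (setIntegral_le_integral hint (Eventually.of_forall fun x => smoothingKernel_nonneg _))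
    intro x hx
    apply smoothingKernel_ge
    rw [abs_mul, abs_of_pos hT]
    have : |x - a| ≤ 1 / T := hx
    rwa [le_div_iff₀ hT, mul_comm] at this
  have h2 : ∫ x, smoothingKernel (T * (x - a)) ∂ν ≤ 2 / T * B := by
    refine le_trans ?_ (le_trans (integral_smoothingMeasure_le (f := fun t => ‖charFun ν t‖)
      (continuous_charFun.norm) (fun _ => norm_nonneg _) hT) (by gcongr))
    rw [← Real.norm_of_nonneg (integral_nonneg fun x => smoothingKernel_nonneg (T * (x - a))),
      ← Complex.norm_real, integral_smoothingKernel_eq]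
    refine (norm_integral_le_integral_norm _).trans_eq (integral_congr_ae
      (Eventually.of_forall fun t => ?_))
    simp only
    rw [norm_mul, Complex.norm_exp_ofReal_mul_I, one_mul]
  have : 32 * B / T = 16 * (2 / T * B) := by ring
  linarith

/-- Concentration bound in terms of the characteristic function, at larger scales. -/
lemma measureReal_abs_sub_le_div (ν : Measure ℝ) [IsProbabilityMeasure ν] {T B : ℝ} (hT : 0 < T)
    (hB : ∫ t in Set.Icc (-T) T, ‖charFun ν t‖ ≤ B) (a : ℝ) {r : ℝ} (hr : 0 ≤ r) :
    ν.real {x | |x - a| ≤ r / T} ≤ 32 * B / T * (1 + r) := by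
  have hB0 : 0 ≤ B := (integral_nonneg fun _ => norm_nonneg _).trans hB
  rcases le_total r 1 with h | h
  · calc ν.real {x | |x - a| ≤ r / T} ≤ ν.real {x | |x - a| ≤ 1 / T} := by
          refine measureReal_mono fun x (hx : |x - a| ≤ r / T) => ?_
          exact hx.trans (by gcongr)
      _ ≤ 32 * B / T * 1 := by rw [mul_one]; exact measureReal_abs_sub_le ν hT hB a
      _ ≤ _ := by gcongr; linarith
  -- The half-width `r / T` is the reciprocal of `T / r ≤ T`, so the previous bound applies at the
  -- lower frequency `T / r`, where the Fourier integral is still at most `B`.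
  · have hr0 : 0 < r := by linarith
    have h1 := measureReal_abs_sub_le ν (T := T / r) (B := B) (by positivity)
      ((setIntegral_symm_mono continuous_charFun.norm (fun _ => norm_nonneg _)
        (div_le_self hT.le h)).trans hB) a
    rw [one_div_div] at h1
    refine h1.trans ?_
    rw [div_div_eq_mul_div, mul_div_right_comm]
    gcongr
    linarith

lemma integral_smoothed_eq (ν : Measure ℝ) [IsProbabilityMeasure ν] {T a b : ℝ} :
    ((∫ y in a..b, ∫ x, smoothingKernel (T * (x - y)) ∂ν : ℝ) : ℂ) =
      ∫ t, (∫ y in a..b, Complex.exp (((-(T * t) * y : ℝ) : ℂ) * Complex.I)) * charFun ν (T * t)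
        ∂smoothingMeasure := by
  rw [← intervalIntegral.integral_ofReal]
  simp_rw [integral_smoothingKernel_eq, ← intervalIntegral.integral_mul_const]
  rw [intervalIntegral_integral_swap]
  have : IsFiniteMeasure (volume.restrict (Set.uIoc a b)) := by
    unfold Set.uIoc; infer_instance
  refine (integrable_const (1 : ℝ)).mono' ?_ (Eventually.of_forall fun p => ?_)
  · refine Continuous.aestronglyMeasurable ?_
    have := continuous_charFun (μ := ν)
    simp only [Function.uncurry_def]
    fun_prop
  · simp only [Function.uncurry_def]
    rw [norm_mul, Complex.norm_exp_ofReal_mul_I, one_mul]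
    exact norm_charFun_le_one _

lemma norm_integral_exp_mul_I_le {c a b : ℝ} (hc : c ≠ 0) :
    ‖∫ y in a..b, Complex.exp (((c * y : ℝ) : ℂ) * Complex.I)‖ ≤ 2 / |c| := by
  have h : ∀ y : ℝ, Complex.exp (((c * y : ℝ) : ℂ) * Complex.I) =
      Complex.exp ((c * Complex.I) * y) := by
    intro y; push_cast; ring_nf
  simp_rw [h]
  rw [integral_exp_mul_complex (by simp [hc]), norm_div]
  have h1 : ‖(c : ℂ) * Complex.I‖ = |c| := by simp
  rw [h1]
  gcongr
  refine (norm_sub_le _ _).trans ?_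
  rw [show (c : ℂ) * Complex.I * b = ((c * b : ℝ) : ℂ) * Complex.I by push_cast; ring,
    show (c : ℂ) * Complex.I * a = ((c * a : ℝ) : ℂ) * Complex.I by push_cast; ring,
    Complex.norm_exp_ofReal_mul_I, Complex.norm_exp_ofReal_mul_I]
  norm_num

/-- The product form covers `c = 0`, and its factor `|c|` is matched with the factor `|t|` in the
assumed bound on the difference of characteristic functions. -/
lemma norm_integral_exp_mul_I_le' {c a b : ℝ} :
    ‖∫ y in a..b, Complex.exp (((c * y : ℝ) : ℂ) * Complex.I)‖ * |c| ≤ 2 := by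
  rcases eq_or_ne c 0 with rfl | hc
  · simp
  · have := norm_integral_exp_mul_I_le (a := a) (b := b) hc
    rwa [le_div_iff₀ (by positivity)] at this

/-- Integrating the phase over `[a, b]` gains `2 / |T t|`, which cancels the factor `|T t|` in the
difference of characteristic functions. The bound is therefore independent of the length of the
interval. -/
lemma abs_integral_smoothed_sub_le (ν γ : Measure ℝ) [IsProbabilityMeasure ν]
    [IsProbabilityMeasure γ] {T J : ℝ} (hT : 0 < T) {H : ℝ → ℝ} (hH : Continuous H)
    (hH0 : ∀ t, 0 ≤ H t)
    (hHle : ∀ t, |t| ≤ T → ‖charFun ν t - charFun γ t‖ ≤ |t| * H t)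
    (hJ : ∫ t in Set.Icc (-T) T, H t ≤ J) (a b : ℝ) :
    |(∫ y in a..b, ∫ x, smoothingKernel (T * (x - y)) ∂ν) -
      ∫ y in a..b, ∫ x, smoothingKernel (T * (x - y)) ∂γ| ≤ 4 * J / T := by
  have hint : ∀ ν : Measure ℝ, IsProbabilityMeasure ν → Integrable (fun t =>
      (∫ y in a..b, Complex.exp (((-(T * t) * y : ℝ) : ℂ) * Complex.I)) * charFun ν (T * t))
      smoothingMeasure := by
    intro ν _
    refine (integrable_const (|b - a|)).mono' ?_ (Eventually.of_forall fun t => ?_)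
    · refine Continuous.aestronglyMeasurable (Continuous.mul ?_
        (continuous_charFun.comp (by fun_prop)))
      exact intervalIntegral.continuous_parametric_intervalIntegral_of_continuous'
        (by simp only [Function.uncurry_def]; fun_prop) a b
    · rw [norm_mul]
      have h1 := intervalIntegral.norm_integral_le_of_norm_le_const (a := a) (b := b) (C := 1)
        (f := fun y => Complex.exp (((-(T * t) * y : ℝ) : ℂ) * Complex.I))
        (fun y _ => (Complex.norm_exp_ofReal_mul_I _).le)
      rw [one_mul] at h1
      calc _ ≤ |b - a| * 1 := by
            gcongr
            exact norm_charFun_le_one _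
        _ = _ := mul_one _
  rw [← Real.norm_eq_abs, ← Complex.norm_real, Complex.ofReal_sub, integral_smoothed_eq,
    integral_smoothed_eq, ← integral_sub (hint ν inferInstance) (hint γ inferInstance)]
  calc ‖∫ t, ((∫ y in a..b, Complex.exp (((-(T * t) * y : ℝ) : ℂ) * Complex.I)) *
          charFun ν (T * t) -
        (∫ y in a..b, Complex.exp (((-(T * t) * y : ℝ) : ℂ) * Complex.I)) * charFun γ (T * t))
          ∂smoothingMeasure‖
      ≤ ∫ t, 2 * H (T * t) ∂smoothingMeasure := by
        refine norm_integral_le_of_norm_le ?_ ?_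
        · refine Integrable.mono_measure ?_ smoothingMeasure_le_restrict
          refine Integrable.smul_measure ?_ (by simp)
          exact (Continuous.continuousOn (by fun_prop)).integrableOn_compact isCompact_Icc
        · filter_upwards [ae_abs_le_smoothingMeasure] with t ht
          rw [← mul_sub, norm_mul]
          have h2 : |T * t| ≤ T := by
            rw [abs_mul, abs_of_pos hT]; nlinarith
          have h3 := norm_integral_exp_mul_I_le' (c := -(T * t)) (a := a) (b := b)
          rw [abs_neg] at h3
          calc _ ≤ ‖∫ y in a..b, Complex.exp (((-(T * t) * y : ℝ) : ℂ) * Complex.I)‖ *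
                (|T * t| * H (T * t)) := by
                gcongr
                exact hHle _ h2
            _ = ‖∫ y in a..b, Complex.exp (((-(T * t) * y : ℝ) : ℂ) * Complex.I)‖ *
                |T * t| * H (T * t) := by ring
            _ ≤ 2 * H (T * t) := by
                gcongr
                exact hH0 _
    _ ≤ 2 / T * ∫ t in Set.Icc (-T) T, 2 * H t :=
        integral_smoothingMeasure_le (f := fun t => 2 * H t) (by fun_prop)
          (fun t => by have := hH0 t; positivity) hT
    _ ≤ 4 * J / T := by
        rw [integral_const_mul]
        have : 2 / T * (2 * ∫ t in Set.Icc (-T) T, H t) ≤ 2 / T * (2 * J) := by gcongr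
        refine this.trans_eq (by ring)

/-- Replacing the indicator function of an interval by its smoothed version. -/
lemma abs_measureReal_sub_smoothed_le (ν : Measure ℝ) [IsProbabilityMeasure ν] {T B : ℝ}
    (hT : 0 < T) (hB : ∫ t in Set.Icc (-T) T, ‖charFun ν t‖ ≤ B) {a b : ℝ} (hab : a ≤ b) :
    |ν.real (Set.Icc a b) * (∫ x, smoothingKernel x) -
      T * ∫ y in a..b, ∫ x, smoothingKernel (T * (x - y)) ∂ν| ≤
      64 * B / T * ∫ z, (1 + |z|) * smoothingKernel z := by
  set g : ℝ → ℝ := (Set.Icc a b).indicator 1 with hg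
  have hgm : Measurable g := measurable_one.indicator measurableSet_Icc
  have hg1 : ∀ x, |g x| ≤ 1 := by
    intro x
    by_cases hx : x ∈ Set.Icc a b <;> simp [hg, hx]
  have hk0 := smoothingKernel_nonneg
  have hI1 : Integrable (fun p : ℝ × ℝ => g p.1 * smoothingKernel p.2) (ν.prod volume) := by
    refine (integrable_smoothingKernel.comp_snd ν).mono'
      (Measurable.aestronglyMeasurable (by fun_prop)) (Eventually.of_forall fun p => ?_)
    rw [norm_mul, Real.norm_eq_abs, Real.norm_of_nonneg (hk0 _)]
    exact mul_le_of_le_one_left (hk0 _) (hg1 _)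
  have hI2 : Integrable (fun p : ℝ × ℝ => g (p.1 - p.2 / T) * smoothingKernel p.2)
      (ν.prod volume) := by
    refine (integrable_smoothingKernel.comp_snd ν).mono'
      (Measurable.aestronglyMeasurable (by fun_prop)) (Eventually.of_forall fun p => ?_)
    rw [norm_mul, Real.norm_eq_abs, Real.norm_of_nonneg (hk0 _)]
    exact mul_le_of_le_one_left (hk0 _) (hg1 _)
  have e1 : ν.real (Set.Icc a b) * (∫ x, smoothingKernel x) =
      ∫ p, g p.1 * smoothingKernel p.2 ∂(ν.prod volume) := by
    rw [integral_prod_mul g smoothingKernel, hg, integral_indicator_one measurableSet_Icc]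
  have e2 : T * ∫ y in a..b, ∫ x, smoothingKernel (T * (x - y)) ∂ν =
      ∫ p, g (p.1 - p.2 / T) * smoothingKernel p.2 ∂(ν.prod volume) := by
    rw [integral_prod _ hI2, intervalIntegral_integral_swap, ← integral_const_mul]
    · refine integral_congr_ae (Eventually.of_forall fun x => ?_)
      simp only
      have h1 : ∫ y in a..b, smoothingKernel (T * (x - y)) =
          ∫ y, g y * smoothingKernel (T * (x - y)) := by
        rw [intervalIntegral.integral_of_le hab, ← integral_Icc_eq_integral_Ioc,
          ← integral_indicator measurableSet_Icc]
        refine integral_congr_ae (Eventually.of_forall fun y => ?_)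
        by_cases hy : y ∈ Set.Icc a b <;> simp [hg, hy]
      -- Substitution `y = x - z / T`; the Jacobian is absorbed by the factor `T` in front.
      rw [h1, ← integral_sub_left_eq_self _ volume x]
      have h2 := Measure.integral_comp_div
        (fun y => g (x - y) * smoothingKernel (T * (x - (x - y)))) T
      rw [abs_of_pos hT, smul_eq_mul] at h2
      rw [← h2]
      refine integral_congr_ae (Eventually.of_forall fun z => ?_)
      simp only
      rw [sub_sub_cancel, mul_div_cancel₀ _ hT.ne']
    · have : IsFiniteMeasure (volume.restrict (Set.uIoc a b)) := by
        unfold Set.uIoc; infer_instance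
      refine (integrable_const (1 : ℝ)).mono' ?_ (Eventually.of_forall fun p => ?_)
      · exact Continuous.aestronglyMeasurable (by simp only [Function.uncurry_def]; fun_prop)
      · simp only [Function.uncurry_def]
        rw [← Complex.norm_real, ← charFun_smoothingMeasure]
        exact norm_charFun_le_one _
  rw [e1, e2, ← integral_sub hI1 hI2, integral_prod_symm (fun p : ℝ × ℝ => g p.1 * smoothingKernel p.2 -
      g (p.1 - p.2 / T) * smoothingKernel p.2) (hI1.sub hI2), ← integral_const_mul,
    ← Real.norm_eq_abs]
  refine norm_integral_le_of_norm_le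
    (integrable_one_add_abs_mul_smoothingKernel.const_mul _) (Eventually.of_forall fun z => ?_)
  have hm : ∀ c, MeasurableSet {x : ℝ | |x - c| ≤ |z| / T} := fun c =>
    measurableSet_le (by fun_prop) (by fun_prop)
  -- Shifting the argument by `z / T` changes the indicator of `[a, b]` only within distance `|z| /
  -- T` of an endpoint, and the concentration bound controls the mass there.
  have hpt : ∀ x, ‖g x * smoothingKernel z - g (x - z / T) * smoothingKernel z‖ ≤
      smoothingKernel z * ({x : ℝ | |x - a| ≤ |z| / T}.indicator 1 x +
        {x : ℝ | |x - b| ≤ |z| / T}.indicator 1 x) := by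
    intro x
    rw [← sub_mul, norm_mul, Real.norm_of_nonneg (hk0 z), mul_comm]
    refine mul_le_mul_of_nonneg_left ?_ (hk0 z)
    have hz : |z / T| = |z| / T := by rw [abs_div, abs_of_pos hT]
    rw [← hz]
    simp only [hg, Set.indicator_apply, Set.mem_Icc, Pi.one_apply, Set.mem_ofPred_eq]
    generalize z / T = u
    rcases abs_cases u with ⟨hu, hu'⟩ | ⟨hu, hu'⟩ <;> rw [hu] <;>
    split_ifs with h1 h2 h3 h4 h3 h4 h2 h3 h4 h3 h4 <;> norm_num <;> exfalso <;>
    simp only [abs_le, not_and_or, not_le] at * <;> grind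
  have hIa : Integrable ({x : ℝ | |x - a| ≤ |z| / T}.indicator (1 : ℝ → ℝ)) ν :=
    (integrable_const (1 : ℝ)).indicator (hm a)
  have hIb : Integrable ({x : ℝ | |x - b| ≤ |z| / T}.indicator (1 : ℝ → ℝ)) ν :=
    (integrable_const (1 : ℝ)).indicator (hm b)
  refine (norm_integral_le_of_norm_le ((hIa.add hIb).const_mul _)
    (Eventually.of_forall hpt)).trans ?_
  rw [integral_const_mul]
  simp only [Pi.add_apply]
  rw [integral_add hIa hIb, integral_indicator_one (hm a), integral_indicator_one (hm b)]
  have ha := measureReal_abs_sub_le_div ν hT hB a (abs_nonneg z)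
  have hb := measureReal_abs_sub_le_div ν hT hB b (abs_nonneg z)
  calc smoothingKernel z * (ν.real {x | |x - a| ≤ |z| / T} + ν.real {x | |x - b| ≤ |z| / T})
      ≤ smoothingKernel z * (32 * B / T * (1 + |z|) + 32 * B / T * (1 + |z|)) := by
        have := hk0 z
        gcongr
    _ = _ := by ring

/-- Esseen-type smoothing inequality. -/
theorem exists_smoothing_const : ∃ C : ℝ, 0 < C ∧
    ∀ (ν γ : Measure ℝ) [IsProbabilityMeasure ν] [IsProbabilityMeasure γ] (T B J : ℝ)
      (H : ℝ → ℝ), 0 < T → Continuous H → (∀ t, 0 ≤ H t) →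
      (∀ t, |t| ≤ T → ‖charFun ν t - charFun γ t‖ ≤ |t| * H t) →
      (∫ t in Set.Icc (-T) T, H t ≤ J) →
      (∫ t in Set.Icc (-T) T, ‖charFun ν t‖ ≤ B) → (∫ t in Set.Icc (-T) T, ‖charFun γ t‖ ≤ B) →
      ∀ a b, a ≤ b → |ν.real (Set.Icc a b) - γ.real (Set.Icc a b)| ≤ C * (J + B / T) := by
  set c := ∫ x, smoothingKernel x with hc
  have hc0 : 0 < c := integral_smoothingKernel_pos
  set d := ∫ z, (1 + |z|) * smoothingKernel z with hd
  have hd0 : 0 ≤ d := integral_nonneg fun z => mul_nonneg (by positivity) (smoothingKernel_nonneg z)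
  refine ⟨(4 + 128 * d) / c, by positivity, ?_⟩
  intro ν γ _ _ T B J H hT hH hH0 hHle hJ hB hB' a b hab
  have hJ0 : 0 ≤ J := (integral_nonneg fun _ => hH0 _).trans hJ
  have hB0 : 0 ≤ B := (integral_nonneg fun _ => norm_nonneg _).trans hB
  have h1 := abs_measureReal_sub_smoothed_le ν hT hB hab
  have h2 := abs_measureReal_sub_smoothed_le γ hT hB' hab
  have h3 := abs_integral_smoothed_sub_le ν γ hT hH hH0 hHle hJ a b
  rw [← hc, ← hd] at h1 h2
  set p := ∫ y in a..b, ∫ x, smoothingKernel (T * (x - y)) ∂ν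
  set q := ∫ y in a..b, ∫ x, smoothingKernel (T * (x - y)) ∂γ
  have h4 : |T * p - T * q| ≤ 4 * J := by
    rw [← mul_sub, abs_mul, abs_of_pos hT]
    rw [le_div_iff₀ hT] at h3
    linarith
  -- Triangle inequality: one smoothing error for each law, and the difference of the two smoothed
  -- integrals.
  have h5 : |ν.real (Set.Icc a b) - γ.real (Set.Icc a b)| * c ≤ 4 * J + 128 * d * (B / T) := by
    nth_rw 1 [← abs_of_pos hc0]
    rw [← abs_mul, sub_mul]
    have e : 128 * d * (B / T) = 64 * B / T * d + 64 * B / T * d := by ring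
    rw [e]
    rw [abs_le] at *
    constructor <;> linarith
  rw [div_mul_eq_mul_div, le_div_iff₀ hc0]
  refine h5.trans ?_
  have : 0 ≤ B / T := by positivity
  nlinarith [mul_nonneg hd0 hJ0]

/-! ### A Berry–Esseen bound -/

lemma norm_exp_mul_I_sub_quadratic_le (u : ℝ) :
    ‖Complex.exp (u * Complex.I) - (1 + u * Complex.I - u ^ 2 / 2)‖ ≤ 4 * |u| ^ 3 := by
  rcases le_or_gt |u| 1 with h | h
  · have hn : ‖(u : ℂ) * Complex.I‖ = |u| := by simp
    have h1 := Complex.exp_bound (x := u * Complex.I) (by rw [hn]; exact h) (n := 3) (by norm_num)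
    rw [hn] at h1
    simp only [Finset.sum_range_succ, Finset.sum_range_zero] at h1
    have e : (1 + u * Complex.I - u ^ 2 / 2 : ℂ) = 0 + (u * Complex.I) ^ 0 / (Nat.factorial 0 : ℕ) +
        (u * Complex.I) ^ 1 / (Nat.factorial 1 : ℕ) + (u * Complex.I) ^ 2 / (Nat.factorial 2 : ℕ) := by
      simp only [mul_pow, Complex.I_sq, Nat.factorial]
      push_cast
      ring
    rw [e]
    refine h1.trans ?_
    rw [mul_comm]
    gcongr
    norm_num [Nat.factorial]
  · have h1 : ‖Complex.exp (u * Complex.I)‖ = 1 := Complex.norm_exp_ofReal_mul_I u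
    have h2 : ‖(1 + u * Complex.I - u ^ 2 / 2 : ℂ)‖ ≤ 1 + |u| + |u| ^ 2 / 2 := by
      refine (norm_sub_le _ _).trans (add_le_add ((norm_add_le _ _).trans ?_) ?_) <;> simp
    refine (norm_sub_le _ _).trans ?_
    rw [h1]
    nlinarith [sq_nonneg (|u| - 1), mul_pos (sub_pos.2 h) (sub_pos.2 h),
      mul_pos (mul_pos (sub_pos.2 h) (sub_pos.2 h)) (sub_pos.2 h)]

/-- Follows from `exp v ≥ 1 + v + v² / 2`, since `(1 - v + v²/2) (1 + v + v²/2) = 1 + v⁴/4 ≥ 1`. -/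
lemma exp_neg_le_quadratic {v : ℝ} (hv : 0 ≤ v) : Real.exp (-v) ≤ 1 - v + v ^ 2 / 2 := by
  have h := Real.quadratic_le_exp_of_nonneg hv
  rw [Real.exp_neg, inv_le_iff_one_le_mul₀ (Real.exp_pos v)]
  have h2 : 0 ≤ 1 - v + v ^ 2 / 2 := by nlinarith [sq_nonneg (v - 1)]
  calc 1 ≤ (1 - v + v ^ 2 / 2) * (1 + v + v ^ 2 / 2) := by nlinarith [sq_nonneg (v ^ 2)]
    _ ≤ _ := by gcongr

lemma integrable_pow_of_integrable_abs_pow_three {Q : Measure ℝ} [IsProbabilityMeasure Q]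
    (h : Integrable (fun x => |x| ^ 3) Q) {k : ℕ} (hk : k ≤ 3) : Integrable (fun x => x ^ k) Q := by
  have h1 : Integrable (fun x => 1 + |x| ^ 3) Q := (integrable_const 1).add h
  refine h1.mono' (by fun_prop) (Eventually.of_forall fun x => ?_)
  rw [norm_pow, Real.norm_eq_abs]
  rcases le_total |x| 1 with hx | hx
  · have := pow_le_one₀ (n := k) (abs_nonneg x) hx
    have h3 : 0 ≤ |x| ^ 3 := by positivity
    linarith
  · have := pow_le_pow_right₀ hx hk
    linarith

/-- Lyapunov's inequality between second and third absolute moments. -/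
lemma pow_three_le_integral_abs_pow_three {Q : Measure ℝ} [IsProbabilityMeasure Q]
    (h : Integrable (fun x => |x| ^ 3) Q) : √(∫ x, x ^ 2 ∂Q) ^ 3 ≤ ∫ x, |x| ^ 3 ∂Q := by
  set s := √(∫ x, x ^ 2 ∂Q) with hs
  have hs0 : 0 ≤ s := Real.sqrt_nonneg _
  have hs2 : s ^ 2 = ∫ x, x ^ 2 ∂Q := Real.sq_sqrt (integral_nonneg fun x => sq_nonneg x)
  have h2 := integrable_pow_of_integrable_abs_pow_three h (k := 2) (by norm_num)
  -- The integrand on the left is the tangent line of the convex function `y ↦ y^(3/2)` at `y = s²`,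
  -- evaluated at `y = x²`.
  have h3 : ∫ x, (3 / 2 * s * x ^ 2 - s ^ 3 / 2) ∂Q ≤ ∫ x, |x| ^ 3 ∂Q := by
    refine integral_mono ((h2.const_mul _).sub (integrable_const _)) h fun x => ?_
    simp only
    rw [← sq_abs]
    nlinarith [mul_nonneg (sq_nonneg (|x| - s)) (by positivity : 0 ≤ 2 * |x| + s)]
  rw [integral_sub (h2.const_mul _) (integrable_const _), integral_const_mul, ← hs2] at h3
  simp at h3
  nlinarith

section CharFun

variable {Q : Measure ℝ} [IsProbabilityMeasure Q]

lemma norm_charFun_sub_quadratic_le (h : Integrable (fun x => |x| ^ 3) Q) (hm : ∫ x, x ∂Q = 0)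
    (t : ℝ) : ‖charFun Q t - ((1 - (∫ x, x ^ 2 ∂Q) * t ^ 2 / 2 : ℝ) : ℂ)‖ ≤
      4 * (∫ x, |x| ^ 3 ∂Q) * |t| ^ 3 := by
  have h1 : Integrable (fun x : ℝ => x) Q := by
    simpa using integrable_pow_of_integrable_abs_pow_three h (k := 1) (by norm_num)
  have h2 := integrable_pow_of_integrable_abs_pow_three h (k := 2) (by norm_num)
  have hi1 : Integrable (fun x : ℝ => (x : ℂ)) Q := h1.ofReal
  have hi2 : Integrable (fun x : ℝ => ((x ^ 2 : ℝ) : ℂ)) Q := h2.ofReal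
  have he : Integrable (fun x : ℝ => Complex.exp (t * x * Complex.I)) Q := by
    refine (integrable_const (1 : ℝ)).mono' (Continuous.aestronglyMeasurable (by fun_prop))
      (Eventually.of_forall fun x => ?_)
    rw [← Complex.ofReal_mul, Complex.norm_exp_ofReal_mul_I]
  have hi3 : Integrable (fun x : ℝ => 1 + (t * Complex.I) * x) Q :=
    (integrable_const _).add (hi1.const_mul _)
  have hi4 : Integrable (fun x : ℝ =>
      1 + (t * Complex.I) * x - (t ^ 2 / 2) * ((x ^ 2 : ℝ) : ℂ)) Q := hi3.sub (hi2.const_mul _)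
  have e : (((1 - (∫ x, x ^ 2 ∂Q) * t ^ 2 / 2 : ℝ)) : ℂ) =
      ∫ x : ℝ, (1 + (t * Complex.I) * x - (t ^ 2 / 2) * ((x ^ 2 : ℝ) : ℂ)) ∂Q := by
    rw [integral_sub hi3 (hi2.const_mul _),
      integral_add (integrable_const _) (hi1.const_mul _), integral_const_mul, integral_const_mul,
      integral_complex_ofReal, integral_complex_ofReal, hm]
    simp
    ring
  rw [charFun_apply_real, e, ← integral_sub he hi4]
  have e3 : 4 * (∫ x, |x| ^ 3 ∂Q) * |t| ^ 3 = ∫ x, (4 * |t| ^ 3) * |x| ^ 3 ∂Q := by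
    rw [integral_const_mul]; ring
  rw [e3]
  refine norm_integral_le_of_norm_le (h.const_mul _) (Eventually.of_forall fun x => ?_)
  have := norm_exp_mul_I_sub_quadratic_le (t * x)
  rw [abs_mul, mul_pow, ← mul_assoc] at this
  refine le_of_eq_of_le ?_ this
  congr 1
  push_cast
  ring

/-- With `x = s |t|`, the error of `1 - x²/2` against `exp(-x²/2)` is at most `x³`, which Lyapunov's
inequality absorbs into the third-moment term. -/
lemma norm_charFun_sub_exp_le (h : Integrable (fun x => |x| ^ 3) Q) (hm : ∫ x, x ∂Q = 0)
    (t : ℝ) : ‖charFun Q t - (Real.exp (-((∫ x, x ^ 2 ∂Q) * t ^ 2 / 2)) : ℝ)‖ ≤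
      5 * (∫ x, |x| ^ 3 ∂Q) * |t| ^ 3 := by
  have h1 := norm_charFun_sub_quadratic_le h hm t
  have h2 := pow_three_le_integral_abs_pow_three h
  set s := √(∫ x, x ^ 2 ∂Q) with hs
  have hs0 : 0 ≤ s := Real.sqrt_nonneg _
  have hs2 : ∫ x, x ^ 2 ∂Q = s ^ 2 := (Real.sq_sqrt (integral_nonneg fun x => sq_nonneg x)).symm
  rw [hs2] at h1 ⊢
  have h3 : |(1 - s ^ 2 * t ^ 2 / 2) - Real.exp (-(s ^ 2 * t ^ 2 / 2))| ≤ s ^ 3 * |t| ^ 3 := by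
    rw [← sq_abs t, ← mul_pow, ← mul_pow]
    have hx : 0 ≤ s * |t| := by positivity
    generalize s * |t| = x at hx
    have hl := Real.add_one_le_exp (-(x ^ 2 / 2))
    rw [abs_le]
    refine ⟨?_, by nlinarith [pow_nonneg hx 3]⟩
    rcases le_total x 1 with h1 | h1
    · have := exp_neg_le_quadratic (v := x ^ 2 / 2) (by positivity)
      have h4 : x ^ 4 ≤ x ^ 3 := pow_le_pow_of_le_one hx h1 (by norm_num)
      nlinarith [pow_nonneg hx 3]
    · have : Real.exp (-(x ^ 2 / 2)) ≤ 1 := Real.exp_le_one_iff.2 (by nlinarith)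
      have h4 : x ^ 2 ≤ x ^ 3 := pow_le_pow_right₀ h1 (by norm_num)
      nlinarith [pow_nonneg hx 3]
  have h4 : ‖((1 - s ^ 2 * t ^ 2 / 2 : ℝ) : ℂ) - (Real.exp (-(s ^ 2 * t ^ 2 / 2)) : ℝ)‖ ≤
      s ^ 3 * |t| ^ 3 := by
    rw [← Complex.ofReal_sub, Complex.norm_real]; exact h3
  refine (norm_sub_le_norm_sub_add_norm_sub _ _ _).trans ((add_le_add h1 h4).trans ?_)
  have : s ^ 3 * |t| ^ 3 ≤ (∫ x, |x| ^ 3 ∂Q) * |t| ^ 3 := by gcongr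
  linarith

/-- The exponential form can be multiplied over the summands and is valid for every `t`: once `s² t²
/ 2 ≥ 1`, the cubic term makes the exponent nonnegative and the bound is trivial. -/
lemma norm_charFun_le_exp (h : Integrable (fun x => |x| ^ 3) Q) (hm : ∫ x, x ∂Q = 0)
    (t : ℝ) : ‖charFun Q t‖ ≤
      Real.exp (-((∫ x, x ^ 2 ∂Q) * t ^ 2 / 2) + 4 * (∫ x, |x| ^ 3 ∂Q) * |t| ^ 3) := by
  have h1 := norm_charFun_sub_quadratic_le h hm t
  have h2 := pow_three_le_integral_abs_pow_three h
  set s := √(∫ x, x ^ 2 ∂Q) with hs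
  have hs0 : 0 ≤ s := Real.sqrt_nonneg _
  have hs2 : ∫ x, x ^ 2 ∂Q = s ^ 2 := (Real.sq_sqrt (integral_nonneg fun x => sq_nonneg x)).symm
  rw [hs2] at h1 ⊢
  set ρ := ∫ x, |x| ^ 3 ∂Q
  have h3 : s ^ 3 * |t| ^ 3 ≤ ρ * |t| ^ 3 := by gcongr
  rcases le_total (s ^ 2 * t ^ 2 / 2) 1 with hv | hv
  · refine le_trans ?_ (Real.add_one_le_exp _)
    have h4 : ‖((1 - s ^ 2 * t ^ 2 / 2 : ℝ) : ℂ)‖ = 1 - s ^ 2 * t ^ 2 / 2 := by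
      rw [Complex.norm_real, Real.norm_of_nonneg (by linarith)]
    have := norm_le_norm_sub_add (charFun Q t) ((1 - s ^ 2 * t ^ 2 / 2 : ℝ) : ℂ)
    linarith
  · refine (norm_charFun_le_one _).trans (Real.one_le_exp ?_)
    rw [← mul_pow] at h3
    rw [← sq_abs t, ← mul_pow] at hv ⊢
    have hx : 0 ≤ s * |t| := by positivity
    generalize s * |t| = x at *
    have hx1 : 1 ≤ x := by nlinarith
    have h4 : x ^ 2 ≤ x ^ 3 := pow_le_pow_right₀ hx1 (by norm_num)
    nlinarith

end CharFun

/-- Telescoping: the factors are exchanged one at a time, and each remaining factor of either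
product is bounded by the common majorant `e`. -/
lemma norm_prod_sub_prod_le {ι : Type*} [DecidableEq ι] (s : Finset ι) (f g : ι → ℂ) (e : ι → ℝ)
    (hf : ∀ i, ‖f i‖ ≤ e i) (hg : ∀ i, ‖g i‖ ≤ e i) :
    ‖∏ i ∈ s, f i - ∏ i ∈ s, g i‖ ≤ ∑ i ∈ s, ‖f i - g i‖ * ∏ j ∈ s.erase i, e j := by
  have he : ∀ i, 0 ≤ e i := fun i => (norm_nonneg _).trans (hf i)
  induction s using Finset.induction_on with
  | empty => simp
  | insert a s ha ih =>
    rw [Finset.prod_insert ha, Finset.prod_insert ha, Finset.sum_insert ha,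
      Finset.erase_insert ha]
    have e1 : f a * ∏ i ∈ s, f i - g a * ∏ i ∈ s, g i =
        (f a - g a) * ∏ i ∈ s, f i + g a * (∏ i ∈ s, f i - ∏ i ∈ s, g i) := by ring
    rw [e1]
    refine (norm_add_le _ _).trans (add_le_add ?_ ?_)
    · rw [norm_mul, norm_prod]
      gcongr
      exact hf _
    · rw [norm_mul]
      calc ‖g a‖ * ‖∏ i ∈ s, f i - ∏ i ∈ s, g i‖
          ≤ e a * ∑ i ∈ s, ‖f i - g i‖ * ∏ j ∈ s.erase i, e j := by
            gcongr
            · exact he a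
            · exact hg a
        _ = ∑ i ∈ s, ‖f i - g i‖ * ∏ j ∈ (insert a s).erase i, e j := by
            rw [Finset.mul_sum]
            refine Finset.sum_congr rfl fun i hi => ?_
            have hia : i ≠ a := fun h => ha (h ▸ hi)
            rw [Finset.erase_insert_of_ne hia.symm, Finset.prod_insert (by simp [ha])]
            ring

section Product

variable {n : ℕ} {Q : Fin n → Measure ℝ} [∀ i, IsProbabilityMeasure (Q i)]

/-- In this range of `t` the total cubic term is at most `t² / 8`, which leaves the exponent `-3 t²
/ 8`. -/
lemma norm_prod_charFun_le (h : ∀ i, Integrable (fun x => |x| ^ 3) (Q i))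
    (hm : ∀ i, ∫ x, x ∂(Q i) = 0) (hv : ∑ i, ∫ x, x ^ 2 ∂(Q i) = 1) {L : ℝ}
    (hL : ∑ i, ∫ x, |x| ^ 3 ∂(Q i) ≤ L) {t : ℝ} (ht : 32 * L * |t| ≤ 1) :
    ‖∏ i, charFun (Q i) t‖ ≤ Real.exp (-(1 / 4) * t ^ 2) := by
  rw [norm_prod]
  refine (Finset.prod_le_prod (fun _ _ => norm_nonneg _)
    (fun i _ => norm_charFun_le_exp (h i) (hm i) t)).trans ?_
  rw [← Real.exp_sum, Real.exp_le_exp, Finset.sum_add_distrib, Finset.sum_neg_distrib,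
    ← Finset.sum_div, ← Finset.sum_mul, hv, ← Finset.sum_mul, ← Finset.mul_sum]
  have h1 : (∑ i, ∫ x, |x| ^ 3 ∂(Q i)) * |t| ^ 3 ≤ L * |t| ^ 3 := by gcongr
  have h2 : 32 * L * |t| * t ^ 2 ≤ 1 * t ^ 2 := by gcongr
  have h3 : L * |t| ^ 3 = L * |t| * t ^ 2 := by rw [← sq_abs t]; ring
  nlinarith [sq_nonneg t]

/-- The Gaussian characteristic function is factored with the same variances, and the products are
compared by telescoping. Each term lacks one factor, but `L ≤ 1/8` forces every single variance to
be at most `1/4`, so the others supply the exponent `-3 t² / 8 + t² / 8`. One `|t|` is split off to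
fit the smoothing inequality. -/
lemma norm_prod_charFun_sub_le (h : ∀ i, Integrable (fun x => |x| ^ 3) (Q i))
    (hm : ∀ i, ∫ x, x ∂(Q i) = 0) (hv : ∑ i, ∫ x, x ^ 2 ∂(Q i) = 1) {L : ℝ}
    (hL : ∑ i, ∫ x, |x| ^ 3 ∂(Q i) ≤ L) (hL8 : L ≤ 1 / 8) {t : ℝ} (ht : 32 * L * |t| ≤ 1) :
    ‖∏ i, charFun (Q i) t - charFun (gaussianReal 0 1) t‖ ≤
      |t| * (5 * L * (t ^ 2 * Real.exp (-(1 / 4) * t ^ 2))) := by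
  set v : Fin n → ℝ := fun i => ∫ x, x ^ 2 ∂(Q i) with hvdef
  set ρ : Fin n → ℝ := fun i => ∫ x, |x| ^ 3 ∂(Q i) with hρdef
  have hv0 : ∀ i, 0 ≤ v i := fun i => integral_nonneg fun x => sq_nonneg x
  have hρ0 : ∀ i, 0 ≤ ρ i := fun i => integral_nonneg fun x => by positivity
  have hρL : ∀ i, ρ i ≤ L := fun i =>
    (Finset.single_le_sum (fun j _ => hρ0 j) (Finset.mem_univ i)).trans hL
  have hv4 : ∀ i, v i ≤ 1 / 4 := by
    intro i
    have h1 := (pow_three_le_integral_abs_pow_three (h i)).trans ((hρL i).trans hL8)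
    have h2 : √(v i) ≤ 1 / 2 := by
      refine le_of_pow_le_pow_left₀ (n := 3) (by norm_num) (by norm_num) (h1.trans ?_)
      norm_num
    rw [Real.sqrt_le_left (by norm_num)] at h2
    norm_num at h2 ⊢
    exact h2
  have hg : charFun (gaussianReal 0 1) t = ∏ i, ((Real.exp (-(v i * t ^ 2 / 2)) : ℝ) : ℂ) := by
    rw [← Complex.ofReal_prod, ← Real.exp_sum, Finset.sum_neg_distrib, ← Finset.sum_div,
      ← Finset.sum_mul, hv, charFun_gaussianReal]
    push_cast
    congr 1
    simp
  rw [hg]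
  have hE : ∀ i, Real.exp (-(v i * t ^ 2 / 2)) ≤
      Real.exp (-(v i * t ^ 2 / 2) + 4 * ρ i * |t| ^ 3) := by
    intro i
    have := hρ0 i
    exact Real.exp_le_exp.2 (le_add_of_nonneg_right (by positivity))
  refine (norm_prod_sub_prod_le Finset.univ _ _
    (fun i => Real.exp (-(v i * t ^ 2 / 2) + 4 * ρ i * |t| ^ 3))
    (fun i => norm_charFun_le_exp (h i) (hm i) t) (fun i => ?_)).trans ?_
  · rw [Complex.norm_real, Real.norm_of_nonneg (Real.exp_pos _).le]
    exact hE i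
  have h1 : L * |t| ^ 3 ≤ 1 / 32 * t ^ 2 := by
    have h2 : 32 * L * |t| * t ^ 2 ≤ 1 * t ^ 2 := by gcongr
    have h3 : L * |t| ^ 3 = L * |t| * t ^ 2 := by rw [← sq_abs t]; ring
    linarith
  have hprod : ∀ i, ∏ j ∈ Finset.univ.erase i, Real.exp (-(v j * t ^ 2 / 2) + 4 * ρ j * |t| ^ 3) ≤
      Real.exp (-(1 / 4) * t ^ 2) := by
    intro i
    rw [← Real.exp_sum, Real.exp_le_exp, Finset.sum_add_distrib, Finset.sum_neg_distrib,
      ← Finset.sum_div, ← Finset.sum_mul, ← Finset.sum_mul, ← Finset.mul_sum]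
    have e1 := Finset.sum_erase_add Finset.univ v (Finset.mem_univ i)
    have e2 := Finset.sum_erase_add Finset.univ ρ (Finset.mem_univ i)
    have e3 : ∑ j ∈ Finset.univ.erase i, ρ j ≤ L := by
      have := hρ0 i
      linarith
    have e4 : (∑ j ∈ Finset.univ.erase i, ρ j) * |t| ^ 3 ≤ L * |t| ^ 3 := by gcongr
    have e5 : 3 / 4 ≤ ∑ j ∈ Finset.univ.erase i, v j := by
      have := hv4 i
      have := hv
      linarith
    nlinarith [sq_nonneg t]
  calc ∑ i, ‖charFun (Q i) t - (Real.exp (-(v i * t ^ 2 / 2)) : ℝ)‖ *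
        ∏ j ∈ Finset.univ.erase i, Real.exp (-(v j * t ^ 2 / 2) + 4 * ρ j * |t| ^ 3)
      ≤ ∑ i, (5 * ρ i * |t| ^ 3) * Real.exp (-(1 / 4) * t ^ 2) := by
        refine Finset.sum_le_sum fun i _ => mul_le_mul (norm_charFun_sub_exp_le (h i) (hm i) t)
          (hprod i) (Finset.prod_nonneg fun _ _ => (Real.exp_pos _).le) ?_
        have := hρ0 i
        positivity
    _ = (∑ i, ρ i) * (5 * |t| ^ 3 * Real.exp (-(1 / 4) * t ^ 2)) := by
        rw [Finset.sum_mul]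
        exact Finset.sum_congr rfl fun i _ => by ring
    _ ≤ L * (5 * |t| ^ 3 * Real.exp (-(1 / 4) * t ^ 2)) := by gcongr
    _ = _ := by rw [← sq_abs t]; ring

end Product

/-- **Berry–Esseen theorem** for intervals. -/
theorem exists_berryEsseen_const : ∃ C : ℝ, 0 < C ∧
    ∀ (n : ℕ) (Q : Fin n → Measure ℝ) [∀ i, IsProbabilityMeasure (Q i)]
      (ν : Measure ℝ) [IsProbabilityMeasure ν] (L : ℝ), 0 < L →
      (∀ i, Integrable (fun x => |x| ^ 3) (Q i)) → (∀ i, ∫ x, x ∂(Q i) = 0) →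
      (∑ i, ∫ x, x ^ 2 ∂(Q i) = 1) → (∑ i, ∫ x, |x| ^ 3 ∂(Q i) ≤ L) →
      (∀ t, charFun ν t = ∏ i, charFun (Q i) t) →
      ∀ a b, a ≤ b → |ν.real (Set.Icc a b) - (gaussianReal 0 1).real (Set.Icc a b)| ≤ C * L := by
  obtain ⟨C, hC, hsm⟩ := exists_smoothing_const
  have hI0 : Integrable fun t : ℝ => Real.exp (-(1 / 4) * t ^ 2) :=
    integrable_exp_neg_mul_sq (by norm_num)
  have hI2 : Integrable fun t : ℝ => t ^ 2 * Real.exp (-(1 / 4) * t ^ 2) := by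
    have := integrable_rpow_mul_exp_neg_mul_sq (b := 1 / 4) (by norm_num) (s := 2) (by norm_num)
    simpa using this
  set B := ∫ t : ℝ, Real.exp (-(1 / 4) * t ^ 2) with hB
  set M := ∫ t : ℝ, t ^ 2 * Real.exp (-(1 / 4) * t ^ 2) with hM
  have hB0 : 0 ≤ B := integral_nonneg fun _ => (Real.exp_pos _).le
  have hM0 : 0 ≤ M := integral_nonneg fun _ => by positivity
  -- The `8` settles `L > 1/8`, where the difference of two probabilities is trivially at most `1 ≤
  -- 8 L`. Otherwise the cutoff frequency is `1 / (32 L)`.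
  refine ⟨max 8 (C * (5 * M + 32 * B)), lt_max_of_lt_left (by norm_num), ?_⟩
  intro n Q _ ν _ L hL hint hm hv hL3 hch a b hab
  rcases le_or_gt L (1 / 8) with hL8 | hL8
  · have hTL : ∀ t, |t| ≤ 1 / (32 * L) → 32 * L * |t| ≤ 1 := by
      intro t ht
      rwa [le_div_iff₀ (by positivity), mul_comm] at ht
    have hle : ∀ f : ℝ → ℝ, Continuous f → (∀ t, |t| ≤ 1 / (32 * L) →
        f t ≤ Real.exp (-(1 / 4) * t ^ 2)) → ∫ t in Set.Icc (-(1 / (32 * L))) (1 / (32 * L)), f t ≤ B := by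
      intro f hf hfle
      refine le_trans (setIntegral_mono_on (hf.continuousOn.integrableOn_compact isCompact_Icc)
        hI0.integrableOn measurableSet_Icc fun t ht => hfle t (abs_le.2 ht))
        (setIntegral_le_integral hI0 (Eventually.of_forall fun _ => (Real.exp_pos _).le))
    have := hsm ν (gaussianReal 0 1) (1 / (32 * L)) B (5 * L * M)
      (fun t => 5 * L * (t ^ 2 * Real.exp (-(1 / 4) * t ^ 2))) (by positivity) (by fun_prop)
      (fun t => by positivity)
      (fun t ht => by
        rw [hch]
        exact norm_prod_charFun_sub_le hint hm hv hL3 hL8 (hTL t ht))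
      (by
        rw [integral_const_mul]
        gcongr
        exact setIntegral_le_integral hI2 (Eventually.of_forall fun _ => by positivity))
      (hle _ continuous_charFun.norm fun t ht => by
        rw [hch]
        exact norm_prod_charFun_le hint hm hv hL3 (hTL t ht))
      (hle _ continuous_charFun.norm fun t ht => by
        rw [charFun_gaussianReal, Complex.norm_exp]
        refine Real.exp_le_exp.2 ?_
        simp [← Complex.ofReal_pow]
        nlinarith [sq_nonneg t])
      a b hab
    refine this.trans ?_
    calc C * (5 * L * M + B / (1 / (32 * L))) = C * (5 * M + 32 * B) * L := by
          field_simp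
      _ ≤ _ := by gcongr; exact le_max_right _ _
  · calc |ν.real (Set.Icc a b) - (gaussianReal 0 1).real (Set.Icc a b)| ≤ 1 := by
          have h1 : ν.real (Set.Icc a b) ≤ 1 := measureReal_le_one
          have h2 : (gaussianReal 0 1).real (Set.Icc a b) ≤ 1 := measureReal_le_one
          have h3 : 0 ≤ ν.real (Set.Icc a b) := measureReal_nonneg
          have h4 : 0 ≤ (gaussianReal 0 1).real (Set.Icc a b) := measureReal_nonneg
          rw [abs_le]; constructor <;> linarith
      _ ≤ 8 * L := by linarith
      _ ≤ _ := by gcongr; exact le_max_left _ _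

/-! ### Laplace transforms of half-line restrictions and the Mills ratio -/

/-- The Mills ratio of the standard normal distribution (times `1 / √(2π)`), written as a Laplace
transform. -/
noncomputable def mills (x : ℝ) : ℝ := ∫ z in Set.Ici 0, Real.exp (-(x * z)) ∂(gaussianReal 0 1)

instance : NullSingletonClass (gaussianReal 0 1) := nullSingletonClass_gaussianReal (by norm_num)

lemma setIntegral_gaussianReal {s : Set ℝ} (hs : MeasurableSet s) (f : ℝ → ℝ) :
    ∫ z in s, f z ∂(gaussianReal 0 1) = ∫ z in s, gaussianPDFReal 0 1 z * f z := by
  rw [← integral_indicator hs, integral_gaussianReal_eq_integral_smul (by norm_num),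
    ← integral_indicator hs]
  refine integral_congr_ae (Eventually.of_forall fun z => ?_)
  by_cases hz : z ∈ s <;> simp [hz]

lemma gaussianPDFReal_eq (z : ℝ) :
    gaussianPDFReal 0 1 z = (√(2 * Real.pi))⁻¹ * Real.exp (-(z ^ 2 / 2)) := by
  simp [gaussianPDFReal]
  left
  ring

lemma inv_sqrt_two_pi_le_one : (√(2 * Real.pi))⁻¹ ≤ 1 := by
  refine inv_le_one_of_one_le₀ ?_
  rw [Real.one_le_sqrt]
  linarith [Real.pi_gt_three]

lemma inv_sqrt_two_pi_ge : 1 / 3 ≤ (√(2 * Real.pi))⁻¹ := by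
  rw [one_div]
  refine inv_anti₀ (by positivity) ?_
  rw [Real.sqrt_le_left (by norm_num)]
  linarith [Real.pi_le_four]

lemma gaussianPDFReal_le_one (z : ℝ) : gaussianPDFReal 0 1 z ≤ 1 := by
  rw [gaussianPDFReal_eq]
  exact mul_le_one₀ inv_sqrt_two_pi_le_one (Real.exp_pos _).le
    (Real.exp_le_one_iff.2 (by nlinarith [sq_nonneg z]))

/-- Translate the half-line to `0` and complete the square. -/
lemma one_sub_cdf_gaussianReal (r : ℝ) :
    1 - cdf (gaussianReal 0 1) r = Real.exp (-(r ^ 2 / 2)) * mills r := by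
  have h1 : 1 - cdf (gaussianReal 0 1) r = (gaussianReal 0 1).real (Set.Ici r) := by
    rw [cdf_eq_real, ← probReal_compl_eq_one_sub measurableSet_Iic, Set.compl_Iic]
    exact measureReal_congr Ioi_ae_eq_Ici
  rw [h1, mills, setIntegral_gaussianReal measurableSet_Ici, ← integral_const_mul,
    ← integral_indicator measurableSet_Ici, ← integral_indicator_one measurableSet_Ici,
    integral_gaussianReal_eq_integral_smul (by norm_num),
    ← integral_add_right_eq_self _ r]
  refine integral_congr_ae (Eventually.of_forall fun z => ?_)
  by_cases hz : z ∈ Set.Ici (0 : ℝ)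
  · have hz' : z + r ∈ Set.Ici r := by simpa using hz
    simp only [hz, hz', Set.indicator_of_mem, gaussianPDFReal_eq, smul_eq_mul, Pi.one_apply,
      mul_one]
    rw [mul_assoc, mul_left_comm, ← Real.exp_add, ← Real.exp_add]
    congr 2
    ring
  · have hz' : z + r ∉ Set.Ici r := by simpa using hz
    simp only [hz, hz', not_false_eq_true, Set.indicator_of_notMem, smul_zero]

lemma integrableOn_exp_neg_mul_Ici (ν : Measure ℝ) [IsFiniteMeasure ν] {x : ℝ} (hx : 0 ≤ x) :
    IntegrableOn (fun z => Real.exp (-(x * z))) (Set.Ici 0) ν := by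
  refine Integrable.mono' (g := fun _ => (1 : ℝ)) (integrable_const (1 : ℝ)) (by fun_prop) ?_
  filter_upwards [ae_restrict_mem measurableSet_Ici] with z hz
  rw [Real.norm_of_nonneg (Real.exp_pos _).le]
  have hz' : 0 ≤ z := hz
  exact Real.exp_le_one_iff.2 (by nlinarith [mul_nonneg hx hz'])

lemma mills_le_one {x : ℝ} (hx : 0 ≤ x) : mills x ≤ 1 := by
  calc mills x ≤ ∫ z in Set.Ici 0, (1 : ℝ) ∂(gaussianReal 0 1) := by
        refine setIntegral_mono_on (integrableOn_exp_neg_mul_Ici _ hx)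
          (integrable_const _) measurableSet_Ici fun z hz => ?_
        have hz' : 0 ≤ z := hz
        exact Real.exp_le_one_iff.2 (by nlinarith [mul_nonneg hx hz'])
    _ ≤ 1 := by
        rw [setIntegral_const, smul_eq_mul, mul_one]
        exact measureReal_le_one

lemma mul_mills_le_one {x : ℝ} (hx : 0 < x) : x * mills x ≤ 1 := by
  have hi : IntegrableOn (fun z => Real.exp (-(x * z))) (Set.Ioi 0) := by
    simpa using exp_neg_integrableOn_Ioi 0 hx
  have h1 : mills x ≤ ∫ z in Set.Ioi 0, Real.exp (-(x * z)) := by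
    rw [mills, setIntegral_gaussianReal measurableSet_Ici, integral_Ici_eq_integral_Ioi]
    refine integral_mono_of_nonneg (Eventually.of_forall fun z => mul_nonneg
      (gaussianPDFReal_nonneg _ _ _) (Real.exp_pos _).le) hi (Eventually.of_forall fun z => ?_)
    exact mul_le_of_le_one_left (Real.exp_pos _).le (gaussianPDFReal_le_one z)
  have h2 : ∫ z in Set.Ioi 0, Real.exp (-(x * z)) = 1 / x := by
    have := integral_exp_mul_Ioi (a := -x) (by linarith) 0
    simp only [neg_mul, mul_zero, Real.exp_zero] at this
    rw [this]; field_simp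
  rw [h2, le_div_iff₀ hx] at h1
  linarith

lemma mills_le {x : ℝ} (hx : 0 ≤ x) : mills x ≤ 2 / (1 + x) := by
  rw [le_div_iff₀ (by positivity)]
  rcases hx.eq_or_lt with rfl | hx'
  · linarith [mills_le_one le_rfl]
  · linarith [mills_le_one hx, mul_mills_le_one hx']

/-- On `[0, 1 / (1 + x)]` the two exponents add up to at least `-3/2`, so the integrand is at least
`1/3 · 1/6`. This lower bound is what converts absolute errors into relative ones. -/
lemma le_mills {x : ℝ} (hx : 0 ≤ x) : 1 / 18 / (1 + x) ≤ mills x := by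
  have hs : Set.Icc 0 (1 / (1 + x)) ⊆ Set.Ici (0 : ℝ) := Set.Icc_subset_Ici_self
  rw [mills, setIntegral_gaussianReal measurableSet_Ici]
  have hint : IntegrableOn (fun z => gaussianPDFReal 0 1 z * Real.exp (-(x * z))) (Set.Ici 0) := by
    refine Integrable.mono' (g := gaussianPDFReal 0 1) (integrable_gaussianPDFReal 0 1).integrableOn
      ?_ ?_
    · exact (measurable_gaussianPDFReal 0 1).aestronglyMeasurable.mul (by fun_prop)
    · filter_upwards [ae_restrict_mem measurableSet_Ici] with z hz
      have hz' : 0 ≤ z := hz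
      rw [Real.norm_of_nonneg (mul_nonneg (gaussianPDFReal_nonneg _ _ _) (Real.exp_pos _).le)]
      exact mul_le_of_le_one_right (gaussianPDFReal_nonneg _ _ _)
        (Real.exp_le_one_iff.2 (by nlinarith [mul_nonneg hx hz']))
  calc 1 / 18 / (1 + x) = ∫ z in Set.Icc 0 (1 / (1 + x)), (1 / 18 : ℝ) := by
        rw [setIntegral_const, measureReal_def, Real.volume_Icc, sub_zero, ENNReal.toReal_ofReal (by positivity), smul_eq_mul]
        ring
    _ ≤ ∫ z in Set.Icc 0 (1 / (1 + x)), gaussianPDFReal 0 1 z * Real.exp (-(x * z)) := by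
        refine setIntegral_mono_on (by simp) (hint.mono_set hs) measurableSet_Icc fun z hz => ?_
        rw [gaussianPDFReal_eq, mul_assoc, ← Real.exp_add]
        have hz1 : z * (1 + x) ≤ 1 := by
          have := hz.2; rwa [le_div_iff₀ (by positivity)] at this
        have hxz : 0 ≤ z * x := mul_nonneg hz.1 hx
        have hzle : z ≤ 1 := by linarith
        have hexp : Real.exp (-(3 / 2)) ≤ Real.exp (-(z ^ 2 / 2) + -(x * z)) :=
          Real.exp_le_exp.2 (by nlinarith [hz.1])
        have h32 : 1 / 6 ≤ Real.exp (-(3 / 2)) := by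
          have h1 : Real.exp 1 < 2.7182818286 := Real.exp_one_lt_d9
          have h2 : Real.exp (3 / 2) ^ 2 = Real.exp 1 ^ 3 := by
            rw [← Real.exp_nat_mul, ← Real.exp_nat_mul]; norm_num
          have h3 : Real.exp (3 / 2) ≤ 6 := by
            refine le_of_pow_le_pow_left₀ (n := 2) (by norm_num) (by norm_num) ?_
            rw [h2]
            calc Real.exp 1 ^ 3 ≤ 3 ^ 3 := by gcongr; linarith
              _ ≤ _ := by norm_num
          rw [Real.exp_neg, one_div]
          exact inv_anti₀ (Real.exp_pos _) h3
        calc (1 / 18 : ℝ) = 1 / 3 * (1 / 6) := by norm_num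
          _ ≤ _ := mul_le_mul inv_sqrt_two_pi_ge (h32.trans hexp) (by norm_num) (by positivity)
    _ ≤ _ := setIntegral_mono_set hint (Eventually.of_forall fun z => mul_nonneg
        (gaussianPDFReal_nonneg _ _ _) (Real.exp_pos _).le) hs.eventuallyLE

/-- The mean value inequality gives `|ρ - 1| u exp(-u / 2)`; the factor `u` is paid for with half of
the exponential decay, so a Laplace transform in `u` remains. -/
lemma abs_exp_neg_mul_sub_le {ρ u : ℝ} (hρ : |ρ - 1| ≤ 1 / 2) (hu : 0 ≤ u) :
    |Real.exp (-(ρ * u)) - Real.exp (-u)| ≤ 4 * |ρ - 1| * Real.exp (-(u / 4)) := by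
  have key : ∀ a b : ℝ, a ≤ b → Real.exp (-a) - Real.exp (-b) ≤ (b - a) * Real.exp (-a) := by
    intro a b _
    have h1 := Real.add_one_le_exp (a - b)
    have h2 : Real.exp (-b) = Real.exp (-a) * Real.exp (a - b) := by
      rw [← Real.exp_add]; ring_nf
    rw [h2]
    nlinarith [Real.exp_pos (-a)]
  have h4 : u * Real.exp (-(u / 2)) ≤ 4 * Real.exp (-(u / 4)) := by
    have h1 := Real.add_one_le_exp (u / 4)
    have h2 : Real.exp (-(u / 4)) = Real.exp (-(u / 2)) * Real.exp (u / 4) := by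
      rw [← Real.exp_add]; ring_nf
    rw [h2]
    nlinarith [Real.exp_pos (-(u / 2))]
  obtain ⟨hl, hr⟩ := abs_le.1 hρ
  have hmain : |Real.exp (-(ρ * u)) - Real.exp (-u)| ≤ |ρ - 1| * u * Real.exp (-(u / 2)) := by
    rcases le_total ρ 1 with h | h
    · have h5 : ρ * u ≤ u := mul_le_of_le_one_left hu h
      rw [abs_of_nonneg (sub_nonneg.2 (Real.exp_le_exp.2 (by linarith))),
        abs_of_nonpos (by linarith)]
      refine (key _ _ h5).trans ?_
      have : u - ρ * u = -(ρ - 1) * u := by ring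
      rw [this]
      have h6 : 0 ≤ -(ρ - 1) * u := mul_nonneg (by linarith) hu
      gcongr
      nlinarith
    · have h5 : u ≤ ρ * u := le_mul_of_one_le_left hu h
      rw [abs_sub_comm, abs_of_nonneg (sub_nonneg.2 (Real.exp_le_exp.2 (by linarith))),
        abs_of_nonneg (by linarith)]
      refine (key _ _ h5).trans ?_
      have : ρ * u - u = (ρ - 1) * u := by ring
      rw [this]
      have h6 : 0 ≤ (ρ - 1) * u := mul_nonneg (by linarith) hu
      gcongr
      linarith
  refine hmain.trans ?_
  have := mul_le_mul_of_nonneg_left h4 (abs_nonneg (ρ - 1))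
  linarith

lemma abs_mills_sub_le {ρ x : ℝ} (hρ : |ρ - 1| ≤ 1 / 2) (hx : 0 ≤ x) :
    |mills (ρ * x) - mills x| ≤ 32 * |ρ - 1| / (1 + x) := by
  have hρ0 : 0 ≤ ρ := by linarith [(abs_le.1 hρ).1]
  have h1 : |mills (ρ * x) - mills x| ≤ 4 * |ρ - 1| * mills (x / 4) := by
    rw [mills, mills, mills, ← integral_sub (integrableOn_exp_neg_mul_Ici _ (mul_nonneg hρ0 hx))
      (integrableOn_exp_neg_mul_Ici _ hx), ← integral_const_mul, ← Real.norm_eq_abs]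
    refine norm_integral_le_of_norm_le
      ((integrableOn_exp_neg_mul_Ici _ (by positivity)).const_mul _) ?_
    filter_upwards [ae_restrict_mem measurableSet_Ici] with z hz
    have := abs_exp_neg_mul_sub_le hρ (mul_nonneg hx hz)
    rw [Real.norm_eq_abs, mul_assoc ρ x z, div_mul_eq_mul_div]
    exact this
  refine h1.trans ?_
  have h2 := mills_le (x := x / 4) (by positivity)
  have h3 : 2 / (1 + x / 4) ≤ 8 / (1 + x) := by
    rw [div_le_div_iff₀ (by positivity) (by positivity)]; linarith
  calc 4 * |ρ - 1| * mills (x / 4) ≤ 4 * |ρ - 1| * (8 / (1 + x)) := by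
        gcongr; exact h2.trans h3
    _ = _ := by ring

/-- Comparing integrals of a `[0, 1]`-valued function through its superlevel sets. -/
lemma abs_integral_sub_integral_le {ν γ : Measure ℝ} [IsProbabilityMeasure ν]
    [IsProbabilityMeasure γ] {f : ℝ → ℝ} (hf : Measurable f) (h0 : ∀ z, 0 ≤ f z)
    (h1 : ∀ z, f z ≤ 1) {δ : ℝ}
    (h : ∀ t ∈ Set.Ioc (0 : ℝ) 1, |ν.real {z | t ≤ f z} - γ.real {z | t ≤ f z}| ≤ δ) :
    |∫ z, f z ∂ν - ∫ z, f z ∂γ| ≤ δ := by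
  have hint : ∀ μ : Measure ℝ, IsProbabilityMeasure μ → Integrable f μ := fun μ _ =>
    (integrable_const (1 : ℝ)).mono' hf.aestronglyMeasurable (Eventually.of_forall fun z => by
      rw [Real.norm_of_nonneg (h0 z)]; exact h1 z)
  have hm : ∀ μ : Measure ℝ, IsProbabilityMeasure μ →
      IntegrableOn (fun t => μ.real {z | t ≤ f z}) (Set.Ioc 0 1) := by
    intro μ _
    refine Integrable.mono' (g := fun _ => (1 : ℝ)) (integrable_const _) ?_
      (Eventually.of_forall fun t => ?_)
    · refine (Antitone.measurable fun s t hst => ?_).aestronglyMeasurable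
      exact measureReal_mono fun z (hz : t ≤ f z) => (hst.trans hz : s ≤ f z)
    · rw [Real.norm_of_nonneg measureReal_nonneg]
      exact measureReal_le_one
  rw [(hint ν inferInstance).integral_eq_integral_Ioc_meas_le (M := 1)
      (Eventually.of_forall h0) (Eventually.of_forall h1),
    (hint γ inferInstance).integral_eq_integral_Ioc_meas_le (M := 1)
      (Eventually.of_forall h0) (Eventually.of_forall h1),
    ← integral_sub (hm ν inferInstance) (hm γ inferInstance), ← Real.norm_eq_abs]
  refine (norm_setIntegral_le_of_norm_le_const (C := δ) (by simp) h).trans_eq ?_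
  simp

section Laplace

variable {ν : Measure ℝ} [IsProbabilityMeasure ν] {δ : ℝ}

/-- The superlevel sets of `z ↦ exp(-x z)` on the half-line are the intervals `[0, -log t / x]`, so
the interval distance carries over with no loss in `x`. For `x = 0` they are `[0, ∞)`, reached as a
limit of `[0, n]`. -/
lemma abs_setIntegral_exp_sub_mills_le
    (h : ∀ a b, a ≤ b → |ν.real (Set.Icc a b) - (gaussianReal 0 1).real (Set.Icc a b)| ≤ δ)
    {x : ℝ} (hx : 0 ≤ x) :
    |∫ z in Set.Ici 0, Real.exp (-(x * z)) ∂ν - mills x| ≤ δ := by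
  rw [mills, ← integral_indicator measurableSet_Ici, ← integral_indicator measurableSet_Ici]
  refine abs_integral_sub_integral_le
    (Measurable.indicator (by fun_prop) measurableSet_Ici)
    (fun z => Set.indicator_nonneg (fun _ _ => (Real.exp_pos _).le) z) (fun z => ?_) ?_
  · by_cases hz : z ∈ Set.Ici (0 : ℝ)
    · rw [Set.indicator_of_mem hz]
      exact Real.exp_le_one_iff.2 (by nlinarith [mul_nonneg hx hz])
    · rw [Set.indicator_of_notMem hz]; norm_num
  · rintro t ⟨ht0, ht1⟩
    rcases hx.eq_or_lt with rfl | hx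
    · have e : {z : ℝ | t ≤ (Set.Ici (0 : ℝ)).indicator (fun z => Real.exp (-(0 * z))) z} =
          Set.Ici 0 := by
        ext z
        by_cases hz : 0 ≤ z <;> simp [Set.indicator_apply, hz, ht1, ht0]
      rw [e]
      have hlim : ∀ μ : Measure ℝ, IsProbabilityMeasure μ →
          Tendsto (fun n : ℕ => μ.real (Set.Icc 0 (n : ℝ))) atTop (𝓝 (μ.real (Set.Ici 0))) := by
        intro μ _
        have hU : Set.Ici (0 : ℝ) = ⋃ n : ℕ, Set.Icc 0 (n : ℝ) := by
          ext z
          simp only [Set.mem_Ici, Set.mem_iUnion, Set.mem_Icc]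
          exact ⟨fun hz => (exists_nat_ge z).imp fun n hn => ⟨hz, hn⟩, fun ⟨n, hn⟩ => hn.1⟩
        rw [hU]
        refine (ENNReal.tendsto_toReal (measure_ne_top _ _)).comp
          (tendsto_measure_iUnion_atTop fun m n hmn => Set.Icc_subset_Icc le_rfl (by exact_mod_cast hmn))
      exact le_of_tendsto ((hlim ν inferInstance).sub (hlim _ inferInstance)).abs
        (Eventually.of_forall fun n => h _ _ (by positivity))
    · have e : {z : ℝ | t ≤ (Set.Ici (0 : ℝ)).indicator (fun z => Real.exp (-(x * z))) z} =
          Set.Icc 0 (-Real.log t / x) := by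
        ext z
        by_cases hz : 0 ≤ z
        · simp only [Set.mem_ofPred_eq, Set.indicator_apply, Set.mem_Ici, hz, if_true, Set.mem_Icc,
            true_and]
          rw [← Real.log_le_iff_le_exp ht0, le_div_iff₀ hx]
          constructor <;> intro h <;> linarith
        · simp [Set.indicator_apply, hz, ht0]
      rw [e]
      exact h _ _ (div_nonneg (by linarith [Real.log_nonpos ht0.le ht1]) hx.le)

lemma setIntegral_Iio_gaussianReal (x : ℝ) :
    ∫ z in Set.Iio 0, Real.exp (x * z) ∂(gaussianReal 0 1) = mills x := by
  have h1 : (gaussianReal 0 1).map (fun z => -z) = gaussianReal 0 1 := by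
    rw [gaussianReal_map_neg, neg_zero]
  rw [mills, setIntegral_congr_set Ioi_ae_eq_Ici.symm, ← integral_indicator measurableSet_Ioi,
    ← integral_indicator measurableSet_Iio]
  nth_rw 2 [← h1]
  rw [integral_map (by fun_prop)
    (Measurable.indicator (by fun_prop) measurableSet_Ioi).aestronglyMeasurable]
  refine integral_congr_ae (Eventually.of_forall fun z => ?_)
  by_cases hz : z < 0 <;> simp [hz]

/-- Here the superlevel sets are half-open, `[log t / x, 0)`. Each is a closed interval minus the
point `0`, and two applications of the hypothesis give `2 * δ`. -/
lemma abs_setIntegral_Iio_exp_sub_mills_le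
    (h : ∀ a b, a ≤ b → |ν.real (Set.Icc a b) - (gaussianReal 0 1).real (Set.Icc a b)| ≤ δ)
    {x : ℝ} (hx : 0 < x) :
    |∫ z in Set.Iio 0, Real.exp (x * z) ∂ν - mills x| ≤ 2 * δ := by
  rw [← setIntegral_Iio_gaussianReal, ← integral_indicator measurableSet_Iio,
    ← integral_indicator measurableSet_Iio]
  refine abs_integral_sub_integral_le
    (Measurable.indicator (by fun_prop) measurableSet_Iio)
    (fun z => Set.indicator_nonneg (fun _ _ => (Real.exp_pos _).le) z) (fun z => ?_) ?_
  · by_cases hz : z < 0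
    · rw [Set.indicator_of_mem (Set.mem_Iio.2 hz)]
      exact Real.exp_le_one_iff.2 (by nlinarith [mul_pos hx (neg_pos.2 hz)])
    · rw [Set.indicator_of_notMem (by simpa using hz)]; norm_num
  · rintro t ⟨ht0, ht1⟩
    have e : {z : ℝ | t ≤ (Set.Iio (0 : ℝ)).indicator (fun z => Real.exp (x * z)) z} =
        Set.Ico (Real.log t / x) 0 := by
      ext z
      by_cases hz : z < 0
      · simp only [Set.mem_ofPred_eq, Set.indicator_apply, Set.mem_Iio, hz, if_true, Set.mem_Ico,
          and_true]
        rw [← Real.log_le_iff_le_exp ht0, div_le_iff₀ hx, mul_comm]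
      · simp [Set.indicator_apply, hz, ht0]
    have ha : Real.log t / x ≤ 0 := div_nonpos_of_nonpos_of_nonneg (Real.log_nonpos ht0.le ht1) hx.le
    have hsplit : ∀ μ : Measure ℝ, IsProbabilityMeasure μ → μ.real (Set.Ico (Real.log t / x) 0) =
        μ.real (Set.Icc (Real.log t / x) 0) - μ.real (Set.Icc 0 0) := by
      intro μ _
      rw [Set.Icc_self, ← Set.Icc_sdiff_right, measureReal_sdiff (by simpa using ha) (by simp)]
    rw [e, hsplit ν inferInstance, hsplit _ inferInstance]
    have h1 := abs_le.1 (h _ _ ha)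
    have h2 := abs_le.1 (h 0 0 le_rfl)
    rw [abs_le]
    constructor <;> linarith

end Laplace

/-! ### Exponential tilting of the law of a sum -/

/-- The law `P`, exponentially tilted by `s`, centred at `m` and scaled by `σ`. -/
noncomputable def tiltedStd (P : Measure ℝ) (s m σ : ℝ) : Measure ℝ :=
  (P.tilted (fun x => s * x)).map (fun x => (x - m) / σ)

section Tilt

variable {P : Measure ℝ} {s m σ : ℝ}

lemma isProbabilityMeasure_tiltedStd [NeZero P] (h : Integrable (fun x => Real.exp (s * x)) P) :
    IsProbabilityMeasure (tiltedStd P s m σ) := by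
  have := isProbabilityMeasure_tilted h
  exact Measure.isProbabilityMeasure_map (by fun_prop)

lemma integral_tiltedStd {E : Type*} [NormedAddCommGroup E] [NormedSpace ℝ E]
    {f : ℝ → E} (hf : StronglyMeasurable f) :
    ∫ z, f z ∂(tiltedStd P s m σ) = ∫ x, f ((x - m) / σ) ∂(P.tilted (fun x => s * x)) :=
  integral_map (by fun_prop) hf.aestronglyMeasurable

lemma charFun_tiltedStd (t : ℝ) : charFun (tiltedStd P s m σ) t =
    Complex.exp (-(t * m / σ : ℝ) * Complex.I) *
      ((∫ x : ℝ, Complex.exp ((s + (t / σ : ℝ) * Complex.I) * x) ∂P) /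
        ((∫ x, Real.exp (s * x) ∂P : ℝ) : ℂ)) := by
  rw [charFun_apply_real, integral_tiltedStd (Continuous.stronglyMeasurable (by fun_prop)),
    integral_tilted, ← integral_div, ← integral_const_mul]
  refine integral_congr_ae (Eventually.of_forall fun x => ?_)
  simp only [Complex.real_smul]
  push_cast
  rw [div_mul_eq_mul_div, ← Complex.exp_add, mul_div_assoc' (Complex.exp _), ← Complex.exp_add]
  congr 2
  ring

/-- A probability in terms of the tilted law. -/
lemma measureReal_eq_setIntegral_tiltedStd [IsProbabilityMeasure P]
    (h : Integrable (fun x => Real.exp (s * x)) P) (hσ : 0 < σ) {S : Set ℝ}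
    (hS : MeasurableSet S) :
    P.real {x | (x - m) / σ ∈ S} = (∫ x, Real.exp (s * x) ∂P) * Real.exp (-(s * m)) *
      ∫ z in S, Real.exp (-(s * σ * z)) ∂(tiltedStd P s m σ) := by
  have hpos : 0 < ∫ x, Real.exp (s * x) ∂P := integral_exp_pos h
  have hS' : MeasurableSet {x : ℝ | (x - m) / σ ∈ S} :=
    hS.preimage (f := fun x : ℝ => (x - m) / σ) (by fun_prop)
  rw [← integral_indicator hS, integral_tiltedStd
    (Measurable.indicator (by fun_prop) hS).stronglyMeasurable, integral_tilted,
    ← integral_const_mul, ← integral_indicator_one hS']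
  refine integral_congr_ae (Eventually.of_forall fun x => ?_)
  by_cases hx : (x - m) / σ ∈ S
  · have hx' : x ∈ {x : ℝ | (x - m) / σ ∈ S} := hx
    simp only [hx, hx', Set.indicator_of_mem, smul_eq_mul, Pi.one_apply]
    have e : s * σ * ((x - m) / σ) = s * x - s * m := by field_simp
    rw [e, neg_sub, Real.exp_sub, Real.exp_neg]
    field_simp
  · have hx' : x ∉ {x : ℝ | (x - m) / σ ∈ S} := hx
    simp only [hx, hx', not_false_eq_true, Set.indicator_of_notMem, smul_zero, mul_zero]

end Tilt

section Sum

variable {n : ℕ} {P : Fin n → Measure ℝ} [∀ i, IsProbabilityMeasure (P i)]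

/-- The law of the sum of independent variables with laws `P i`. -/
noncomputable def sumLaw (P : Fin n → Measure ℝ) : Measure ℝ :=
  (Measure.pi P).map (fun x => ∑ i, x i)

instance isProbabilityMeasure_sumLaw : IsProbabilityMeasure (sumLaw P) :=
  Measure.isProbabilityMeasure_map (Measurable.aemeasurable (by fun_prop))

lemma integral_exp_sumLaw (s : ℝ) :
    ∫ x, Real.exp (s * x) ∂(sumLaw P) = ∏ i, ∫ x, Real.exp (s * x) ∂(P i) := by
  rw [sumLaw, integral_map (Measurable.aemeasurable (by fun_prop))
    (Measurable.aestronglyMeasurable (by fun_prop)), ← integral_fintype_prod_eq_prod]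
  refine integral_congr_ae (Eventually.of_forall fun x => ?_)
  simp only
  rw [Finset.mul_sum, Real.exp_sum]

lemma integral_cexp_sumLaw (z : ℂ) :
    ∫ x : ℝ, Complex.exp (z * x) ∂(sumLaw P) = ∏ i, ∫ x : ℝ, Complex.exp (z * x) ∂(P i) := by
  rw [sumLaw, integral_map (Measurable.aemeasurable (by fun_prop))
    (Measurable.aestronglyMeasurable (by fun_prop)), ← integral_fintype_prod_eq_prod]
  refine integral_congr_ae (Eventually.of_forall fun x => ?_)
  simp only
  rw [Complex.ofReal_sum, Finset.mul_sum, Complex.exp_sum]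

lemma integrable_exp_sumLaw {s : ℝ} (h : ∀ i, Integrable (fun x => Real.exp (s * x)) (P i)) :
    Integrable (fun x => Real.exp (s * x)) (sumLaw P) := by
  rw [sumLaw, integrable_map_measure (Measurable.aestronglyMeasurable (by fun_prop))
    (Measurable.aemeasurable (by fun_prop))]
  have := Integrable.fintype_prod (μ := P) h
  refine this.congr (Eventually.of_forall fun x => ?_)
  simp only [Function.comp]
  rw [Finset.mul_sum, Real.exp_sum]

/-- Tilting commutes with convolution because `exp (s * x)` is multiplicative. The factorization of
the characteristic function is all that the Berry–Esseen bound requires. -/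
lemma charFun_tiltedStd_sumLaw {s σ : ℝ} {m : Fin n → ℝ} (t : ℝ) :
    charFun (tiltedStd (sumLaw P) s (∑ i, m i) σ) t =
      ∏ i, charFun (tiltedStd (P i) s (m i) σ) t := by
  simp only [charFun_tiltedStd, integral_exp_sumLaw, integral_cexp_sumLaw]
  rw [Finset.prod_mul_distrib, ← Complex.exp_sum, Finset.prod_div_distrib]
  push_cast
  congr 2
  rw [← Finset.sum_mul, Finset.sum_neg_distrib, Finset.mul_sum, Finset.sum_div]

end Sum

lemma pi_real_mean_ge {n : ℕ} (P : Fin n → Measure ℝ) (hn : 0 < n) (w : ℝ) :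
    (Measure.pi P).real {x | w ≤ (1 / (n : ℝ)) * ∑ i, x i} = (sumLaw P).real (Set.Ici (n * w)) := by
  rw [sumLaw, map_measureReal_apply (by fun_prop) measurableSet_Ici]
  congr 1
  ext x
  have hn' : (0 : ℝ) < n := by exact_mod_cast hn
  simp only [Set.mem_ofPred_eq, Set.mem_preimage, Set.mem_Ici]
  rw [one_div, inv_mul_eq_div, le_div_iff₀ hn', mul_comm]

/-! ### Third moments -/

lemma integrable_abs_sub_pow_three {Q : Measure ℝ} [IsProbabilityMeasure Q]
    (h : Integrable (fun x => |x| ^ 3) Q) (m : ℝ) : Integrable (fun x => |x - m| ^ 3) Q := by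
  have h1 : Integrable (fun x => 4 * (|x| ^ 3 + |m| ^ 3)) Q :=
    (h.add (integrable_const _)).const_mul 4
  refine h1.mono' (by fun_prop) (Eventually.of_forall fun x => ?_)
  rw [Real.norm_of_nonneg (by positivity)]
  have h2 : |x - m| ≤ |x| + |m| := abs_sub _ _
  calc |x - m| ^ 3 ≤ (|x| + |m|) ^ 3 := by gcongr
    _ ≤ _ := by nlinarith [mul_nonneg (sq_nonneg (|x| - |m|)) (by positivity : 0 ≤ |x| + |m|)]

lemma integral_abs_sub_mean_pow_three_le {Q : Measure ℝ} [IsProbabilityMeasure Q]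
    (h : Integrable (fun x => |x| ^ 3) Q) :
    ∫ x, |x - ∫ y, y ∂Q| ^ 3 ∂Q ≤ 8 * ∫ x, |x| ^ 3 ∂Q := by
  set m := ∫ y, y ∂Q
  have h1 : Integrable (fun x : ℝ => x) Q := by
    simpa using integrable_pow_of_integrable_abs_pow_three h (k := 1) (by norm_num)
  have hm : |m| ≤ ∫ x, |x| ∂Q := abs_integral_le_integral_abs
  have hj : |m| ^ 3 ≤ ∫ x, |x| ^ 3 ∂Q := by
    -- Jensen's inequality through the tangent line of `y ↦ y³` at `y = |m|`.
    have h2 : ∫ x, (3 * |m| ^ 2 * |x| - 2 * |m| ^ 3) ∂Q ≤ ∫ x, |x| ^ 3 ∂Q := by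
      refine integral_mono ((h1.abs.const_mul _).sub (integrable_const _)) h fun x => ?_
      simp only
      nlinarith [mul_nonneg (sq_nonneg (|x| - |m|)) (by positivity : 0 ≤ |x| + 2 * |m|)]
    rw [integral_sub (h1.abs.const_mul _) (integrable_const _), integral_const_mul] at h2
    simp at h2
    have h3 : 3 * |m| ^ 2 * |m| ≤ 3 * |m| ^ 2 * ∫ x, |x| ∂Q := by gcongr
    rw [sq_abs] at h3
    have h4 : |m| ^ 3 = m ^ 2 * |m| := by rw [← sq_abs m]; ring
    linarith
  have h2 : ∫ x, |x - m| ^ 3 ∂Q ≤ ∫ x, (4 * |x| ^ 3 + 4 * |m| ^ 3) ∂Q := by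
    refine integral_mono (integrable_abs_sub_pow_three h m)
      ((h.const_mul 4).add (integrable_const _)) fun x => ?_
    simp only
    have h2 : |x - m| ≤ |x| + |m| := abs_sub _ _
    calc |x - m| ^ 3 ≤ (|x| + |m|) ^ 3 := by gcongr
      _ ≤ _ := by nlinarith [mul_nonneg (sq_nonneg (|x| - |m|)) (by positivity : 0 ≤ |x| + |m|)]
  rw [integral_add (h.const_mul 4) (integrable_const _), integral_const_mul] at h2
  simp at h2
  linarith

/-! ### Comparison with the Lugannani–Rice formula -/

lemma cdf_gaussianReal_neg (r : ℝ) :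
    cdf (gaussianReal 0 1) (-r) = 1 - cdf (gaussianReal 0 1) r := by
  have h1 : (gaussianReal 0 1).map (fun z => -z) = gaussianReal 0 1 := by
    rw [gaussianReal_map_neg, neg_zero]
  rw [cdf_eq_real, cdf_eq_real, ← probReal_compl_eq_one_sub measurableSet_Iic, Set.compl_Iic]
  conv_lhs => rw [← h1]
  rw [map_measureReal_apply (by fun_prop) measurableSet_Iic,
    measureReal_congr (Ioi_ae_eq_Ici (a := r))]
  congr 1
  ext z
  simp

lemma abs_inv_sub_inv_mul_le {ρ x : ℝ} (hρ : |ρ - 1| ≤ 1 / 2) :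
    |1 / x - 1 / (ρ * x)| ≤ 2 * |ρ - 1| / |x| := by
  rcases eq_or_ne x 0 with rfl | hx
  · simp
  have hρ0 : 1 / 2 ≤ ρ := by linarith [(abs_le.1 hρ).1]
  have e : 1 / x - 1 / (ρ * x) = (ρ - 1) / (ρ * x) := by field_simp
  rw [e, abs_div, abs_mul, abs_of_pos (by linarith : 0 < ρ), div_le_div_iff₀ (by positivity)
    (by positivity)]
  have : 0 ≤ |ρ - 1| * |x| := by positivity
  nlinarith

/-- Both quantities carry the factor `exp(-r² / 2)`, which may be tiny and cancels from the relative
error. What is left are `A` and `D`, each close to `mills lam`, hence the error must be small even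
after multiplication by `1 + lam`. At `lam = 0` the quotients by zero vanish. -/
lemma lugannaniRice_rel_error_of_nonneg {p A lam ρ δ τ : ℝ} (hlam : 0 ≤ lam)
    (hρ : |ρ - 1| ≤ 1 / 2) (hp : p = Real.exp (-((ρ * lam) ^ 2 / 2)) * A)
    (hA : |A - mills lam| ≤ δ) (hτ1 : τ ≤ 1)
    (hκ : (δ + 32 * |ρ - 1| / (1 + lam) + 2 * |ρ - 1| / lam) * (1 + lam) ≤ τ / 36) :
    |p - (1 - cdf (gaussianReal 0 1) (ρ * lam) +
        gaussianPDFReal 0 1 (ρ * lam) * (1 / lam - 1 / (ρ * lam)))| ≤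
      τ * |1 - cdf (gaussianReal 0 1) (ρ * lam) +
        gaussianPDFReal 0 1 (ρ * lam) * (1 / lam - 1 / (ρ * lam))| := by
  set κ := δ + 32 * |ρ - 1| / (1 + lam) + 2 * |ρ - 1| / lam with hκdef
  set E := Real.exp (-((ρ * lam) ^ 2 / 2)) with hE
  have hE0 : 0 < E := Real.exp_pos _
  set D := mills (ρ * lam) + (√(2 * Real.pi))⁻¹ * (1 / lam - 1 / (ρ * lam)) with hD
  have hq : 1 - cdf (gaussianReal 0 1) (ρ * lam) +
      gaussianPDFReal 0 1 (ρ * lam) * (1 / lam - 1 / (ρ * lam)) = E * D := by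
    rw [one_sub_cdf_gaussianReal, gaussianPDFReal_eq, hD, hE]
    ring
  have h1 := abs_mills_sub_le hρ hlam
  have h2 : |(√(2 * Real.pi))⁻¹ * (1 / lam - 1 / (ρ * lam))| ≤ 2 * |ρ - 1| / lam := by
    have h3 := abs_inv_sub_inv_mul_le (x := lam) hρ
    rw [abs_of_nonneg hlam] at h3
    rw [abs_mul, abs_of_nonneg (by positivity)]
    exact (mul_le_of_le_one_left (abs_nonneg _) inv_sqrt_two_pi_le_one).trans h3
  have hDM : |D - mills lam| ≤ 32 * |ρ - 1| / (1 + lam) + 2 * |ρ - 1| / lam := by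
    have : D - mills lam = (mills (ρ * lam) - mills lam) +
      (√(2 * Real.pi))⁻¹ * (1 / lam - 1 / (ρ * lam)) := by rw [hD]; ring
    rw [this]
    exact (abs_add_le _ _).trans (add_le_add h1 h2)
  have hAD : |A - D| ≤ κ := by
    have : A - D = (A - mills lam) - (D - mills lam) := by ring
    rw [this]
    refine (abs_sub _ _).trans ?_
    linarith
  have hκ' : κ ≤ τ / 36 / (1 + lam) := by rwa [le_div_iff₀ (by positivity)]
  have hM := le_mills hlam
  have hδ0 : 0 ≤ δ := (abs_nonneg _).trans hA
  have hκ0 : 0 ≤ κ := (abs_nonneg _).trans hAD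
  -- Half of the lower bound `1 / 18 / (1 + lam)` for `mills lam` survives the perturbation.
  have hDlow : 1 / 36 / (1 + lam) ≤ D := by
    have h5 := (abs_le.1 hDM).1
    have h6 : κ ≤ 1 / 36 / (1 + lam) := hκ'.trans (by gcongr)
    have h7 : 1 / 18 / (1 + lam) = 1 / 36 / (1 + lam) + 1 / 36 / (1 + lam) := by ring
    linarith
  have hτ0 : 0 ≤ τ := by
    have : 0 ≤ κ * (1 + lam) := by positivity
    linarith
  have hD0 : 0 ≤ D := le_trans (by positivity) hDlow
  rw [hq, hp, ← mul_sub, abs_mul, abs_of_pos hE0, abs_mul, abs_of_pos hE0, abs_of_nonneg hD0]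
  calc E * |A - D| ≤ E * (τ * (1 / 36 / (1 + lam))) := by
        gcongr
        refine hAD.trans (hκ'.trans_eq (by ring))
    _ ≤ E * (τ * D) := by gcongr
    _ = _ := by ring

/-- For a negative argument the normal distribution function is at most `1/2`, so the approximation
is bounded below by a constant. An absolute error is enough, and `hκ` needs no weight `1 - lam`. -/
lemma lugannaniRice_rel_error_of_neg {p A lam ρ δ τ : ℝ} (hlam : lam < 0)
    (hρ : |ρ - 1| ≤ 1 / 2) (hp : 1 - p = Real.exp (-((ρ * lam) ^ 2 / 2)) * A)
    (hA : |A - mills (-lam)| ≤ δ) (hτ1 : τ ≤ 1)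
    (hκ : δ + 32 * |ρ - 1| / (1 + -lam) + 2 * |ρ - 1| / -lam ≤ τ / 36) :
    |p - (1 - cdf (gaussianReal 0 1) (ρ * lam) +
        gaussianPDFReal 0 1 (ρ * lam) * (1 / lam - 1 / (ρ * lam)))| ≤
      τ * |1 - cdf (gaussianReal 0 1) (ρ * lam) +
        gaussianPDFReal 0 1 (ρ * lam) * (1 / lam - 1 / (ρ * lam))| := by
  set κ := δ + 32 * |ρ - 1| / (1 + -lam) + 2 * |ρ - 1| / -lam with hκdef
  set E := Real.exp (-((ρ * lam) ^ 2 / 2)) with hE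
  have hE0 : 0 < E := Real.exp_pos _
  have hE1 : E ≤ 1 := Real.exp_le_one_iff.2 (by nlinarith [sq_nonneg (ρ * lam)])
  have hρ0 : 1 / 2 ≤ ρ := by linarith [(abs_le.1 hρ).1]
  have hcdf : cdf (gaussianReal 0 1) (ρ * lam) = E * mills (ρ * -lam) := by
    have h1 := one_sub_cdf_gaussianReal (ρ * -lam)
    rw [← cdf_gaussianReal_neg, ← mul_neg, neg_neg] at h1
    rw [h1, hE]
    congr 3
    ring
  have h1 := abs_mills_sub_le hρ (x := -lam) (by linarith)
  have h2 : |gaussianPDFReal 0 1 (ρ * lam) * (1 / lam - 1 / (ρ * lam))| ≤ 2 * |ρ - 1| / -lam := by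
    have h3 := abs_inv_sub_inv_mul_le (x := lam) hρ
    rw [abs_of_neg hlam] at h3
    rw [abs_mul, abs_of_nonneg (gaussianPDFReal_nonneg _ _ _)]
    exact (mul_le_of_le_one_left (abs_nonneg _) (gaussianPDFReal_le_one _)).trans h3
  have hhalf : cdf (gaussianReal 0 1) (ρ * lam) ≤ 1 / 2 := by
    have h3 : cdf (gaussianReal 0 1) 0 = 1 / 2 := by
      have := cdf_gaussianReal_neg 0
      rw [neg_zero] at this
      linarith
    rw [← h3]
    exact monotone_cdf _ (by nlinarith)
  have hEA : |E * A - cdf (gaussianReal 0 1) (ρ * lam)| ≤ δ + 32 * |ρ - 1| / (1 + -lam) := by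
    rw [hcdf, ← mul_sub, abs_mul, abs_of_pos hE0]
    refine (mul_le_of_le_one_left (abs_nonneg _) hE1).trans ?_
    have : A - mills (ρ * -lam) = (A - mills (-lam)) - (mills (ρ * -lam) - mills (-lam)) := by ring
    rw [this]
    exact (abs_sub _ _).trans (add_le_add hA h1)
  generalize gaussianPDFReal 0 1 (ρ * lam) * (1 / lam - 1 / (ρ * lam)) = c at h2 ⊢
  generalize cdf (gaussianReal 0 1) (ρ * lam) = d at *
  have hp' : p = 1 - E * A := by linarith
  have hpq : |p - (1 - d + c)| ≤ κ := by
    have : p - (1 - d + c) = -(E * A - d) - c := by rw [hp']; ring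
    rw [this]
    refine (abs_sub _ _).trans ?_
    rw [abs_neg]
    linarith
  have hκ0 : 0 ≤ κ := (abs_nonneg _).trans hpq
  have hnn : 0 ≤ 32 * |ρ - 1| / (1 + -lam) := by
    have : 0 < 1 + -lam := by linarith
    positivity
  have hδ0 : 0 ≤ δ := (abs_nonneg _).trans hA
  have hlow : 1 / 36 ≤ |1 - d + c| := by
    have h5 := (abs_le.1 h2).1
    refine le_trans ?_ (le_abs_self _)
    linarith
  calc |p - (1 - d + c)| ≤ τ * (1 / 36) := by linarith
    _ ≤ _ := by
      have : 0 ≤ τ := by linarith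
      gcongr

/-! ### The saddlepoint equation -/

section Saddle

variable {K K1 K2 K3 : ℝ → ℝ} {ε s0 η D : ℝ}

lemma half_le_second_deriv (h3 : ∀ s ∈ Set.Ioo (-ε) ε, HasDerivAt K2 (K3 s) s)
    (hs0 : s0 ≤ ε / 2) (hε : 0 < ε) (hη : η ≤ K2 0) (hD : ∀ s, |s| ≤ s0 → |K3 s| ≤ D)
    {s : ℝ} (hs : |s| ≤ s0) (hsD : D * |s| ≤ η / 2) : η / 2 ≤ K2 s := by
  have hmem : ∀ x ∈ Set.Icc (-s0) s0, x ∈ Set.Ioo (-ε) ε := fun x hx =>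
    ⟨by linarith [hx.1], by linarith [hx.2]⟩
  have h := (convex_Icc (-s0) s0).norm_image_sub_le_of_norm_hasDerivWithin_le (f := K2) (f' := K3)
    (C := D) (x := 0) (y := s) (fun x hx => (h3 x (hmem x hx)).hasDerivWithinAt)
    (fun x hx => hD x (abs_le.2 hx)) (abs_le.1 (by simpa using (abs_nonneg s).trans hs))
    (abs_le.1 hs)
  rw [sub_zero, Real.norm_eq_abs, Real.norm_eq_abs] at h
  have := (abs_le.1 (h.trans hsD)).1
  linarith

lemma mul_sub_le_first_deriv_sub (h2 : ∀ s ∈ Set.Ioo (-ε) ε, HasDerivAt K1 (K2 s) s)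
    {a b c : ℝ} (hab : a ≤ b) (ha : -ε < a) (hb : b < ε) (hc : ∀ s ∈ Set.Icc a b, c ≤ K2 s) :
    c * (b - a) ≤ K1 b - K1 a := by
  have hmem : ∀ x ∈ Set.Icc a b, x ∈ Set.Ioo (-ε) ε := fun x hx =>
    ⟨by linarith [hx.1], by linarith [hx.2]⟩
  refine (convex_Icc a b).mul_sub_le_image_sub_of_le_deriv
    (fun x hx => (h2 x (hmem x hx)).continuousAt.continuousWithinAt)
    (fun x hx => (h2 x (hmem x (interior_subset hx))).differentiableAt.differentiableWithinAt)
    (fun x hx => ?_) a (Set.left_mem_Icc.2 hab) b (Set.right_mem_Icc.2 hab) hab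
  rw [(h2 x (hmem x (interior_subset hx))).deriv]
  exact hc x (interior_subset hx)

lemma strictMonoOn_first_deriv (h2 : ∀ s ∈ Set.Ioo (-ε) ε, HasDerivAt K1 (K2 s) s)
    (hpos : ∀ s ∈ Set.Ioo (-ε) ε, 0 < K2 s) : StrictMonoOn K1 (Set.Ioo (-ε) ε) := by
  refine strictMonoOn_of_deriv_pos (convex_Ioo _ _)
    (fun x hx => (h2 x hx).continuousAt.continuousWithinAt) fun x hx => ?_
  rw [interior_Ioo] at hx
  rw [(h2 x hx).deriv]
  exact hpos x hx

/-- The difference vanishes at `0` and has derivative `-s² K'''(s)`. It compares `r² / n` with `λ² /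
n`. -/
lemma abs_two_mul_legendre_sub_le (h1 : ∀ s ∈ Set.Ioo (-ε) ε, HasDerivAt K (K1 s) s)
    (h2 : ∀ s ∈ Set.Ioo (-ε) ε, HasDerivAt K1 (K2 s) s)
    (h3 : ∀ s ∈ Set.Ioo (-ε) ε, HasDerivAt K2 (K3 s) s)
    (hs0 : s0 ≤ ε / 2) (hε : 0 < ε) (hK0 : K 0 = 0) (hD : ∀ s, |s| ≤ s0 → |K3 s| ≤ D)
    {s : ℝ} (hs : |s| ≤ s0) :
    |2 * (s * K1 s - K s) - s ^ 2 * K2 s| ≤ D * |s| ^ 3 := by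
  have hmem : ∀ x ∈ Set.Icc (-|s|) |s|, x ∈ Set.Ioo (-ε) ε := fun x hx =>
    ⟨by linarith [hx.1], by linarith [hx.2]⟩
  have hder : ∀ x ∈ Set.Icc (-|s|) |s|, HasDerivWithinAt
      (fun s => 2 * (s * K1 s - K s) - s ^ 2 * K2 s) (-(x ^ 2 * K3 x)) (Set.Icc (-|s|) |s|) x := by
    intro x hx
    have hx' := hmem x hx
    have := ((((hasDerivAt_id x).mul (h2 x hx')).sub (h1 x hx')).const_mul 2).sub
      (((hasDerivAt_id x).pow 2).mul (h3 x hx'))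
    refine (this.congr_deriv ?_).hasDerivWithinAt
    simp
    ring
  have h := (convex_Icc (-|s|) |s|).norm_image_sub_le_of_norm_hasDerivWithin_le
    (C := |s| ^ 2 * D) (x := 0) (y := s) hder (fun x hx => ?_)
    (abs_le.1 (by simp)) (abs_le.1 le_rfl)
  · simp only [Real.norm_eq_abs, hK0, sub_zero] at h
    norm_num at h
    refine h.trans_eq ?_
    rw [← sq_abs s]
    ring
  · have hx' : |x| ≤ |s| := abs_le.2 hx
    have := hD x (hx'.trans hs)
    rw [norm_neg, norm_mul, norm_pow, Real.norm_eq_abs, Real.norm_eq_abs]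
    gcongr

lemma abs_sqrt_one_add_sub_one_le {ξ : ℝ} (hξ : |ξ| ≤ 1 / 2) : |√(1 + ξ) - 1| ≤ |ξ| := by
  have h0 : 0 ≤ 1 + ξ := by linarith [(abs_le.1 hξ).1]
  have h1 := Real.sqrt_nonneg (1 + ξ)
  have h2 := Real.sq_sqrt h0
  have e : ξ = (√(1 + ξ) - 1) * (√(1 + ξ) + 1) := by ring_nf; rw [h2]; ring
  conv_rhs => rw [e, abs_mul, abs_of_nonneg (by linarith : 0 ≤ √(1 + ξ) + 1)]
  exact le_mul_of_one_le_right (abs_nonneg _) (by linarith)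

/-- Near `0` one has `K'' ≥ η / 2`, so `K'` grows at least linearly and attains `w` at a point with
`|s| ≤ 2 |w| / η`. Uniqueness on all of `[-ε/2, ε/2]` needs only `K'' > 0` there. The Legendre
estimate reads `r² = λ² (1 + ξ)` with `|ξ| ≤ 2 D |s| / η`, and `ρ = √(1 + ξ)`. -/
theorem saddlepoint_spec (h1 : ∀ s ∈ Set.Ioo (-ε) ε, HasDerivAt K (K1 s) s)
    (h2 : ∀ s ∈ Set.Ioo (-ε) ε, HasDerivAt K1 (K2 s) s)
    (h3 : ∀ s ∈ Set.Ioo (-ε) ε, HasDerivAt K2 (K3 s) s)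
    (hs0 : 0 < s0) (hs0ε : s0 ≤ ε / 2) (hK0 : K 0 = 0) (hK10 : K1 0 = 0)
    (hη0 : 0 < η) (hη : η ≤ K2 0) (hpos : ∀ s ∈ Set.Ioo (-ε) ε, 0 < K2 s)
    (hD0 : 0 < D) (hD : ∀ s, |s| ≤ s0 → |K3 s| ≤ D) {w : ℝ}
    (hw : |w| ≤ η / 2 * min s0 (η / (4 * D))) (n : ℕ) :
    (saddleSet K w ε).encard = 1 ∧
    ∃ s ρ : ℝ, |s| ≤ s0 ∧ |s| ≤ 2 / η * |w| ∧ K1 s = w ∧ η / 2 ≤ K2 s ∧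
      |ρ - 1| ≤ 1 / 2 ∧ |ρ - 1| ≤ 2 * D / η * |s| ∧
      lam n K w ε = s * √(n * K2 s) ∧ rstat n K w ε = ρ * (s * √(n * K2 s)) ∧
      n * (s * w - K s) = (ρ * (s * √(n * K2 s))) ^ 2 / 2 := by
  have hε : 0 < ε := by linarith
  -- The radius gives `D s1 ≤ η / 4`, which both keeps `K''` above `η / 2` and makes `|ξ| ≤ 1/2`.
  set s1 := min s0 (η / (4 * D)) with hs1
  have hs10 : 0 < s1 := lt_min hs0 (by positivity)
  have hs1s0 : s1 ≤ s0 := min_le_left _ _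
  have hDs1 : D * s1 ≤ η / 4 := by
    have : s1 ≤ η / (4 * D) := min_le_right _ _
    rw [le_div_iff₀ (by positivity)] at this
    linarith
  have hK2 : ∀ s, |s| ≤ s1 → η / 2 ≤ K2 s := by
    intro s hs
    refine half_le_second_deriv h3 hs0ε hε hη hD (hs.trans hs1s0) ?_
    have : D * |s| ≤ D * s1 := by gcongr
    linarith
  have hgrow : ∀ a b, -s1 ≤ a → a ≤ b → b ≤ s1 → η / 2 * (b - a) ≤ K1 b - K1 a := by
    intro a b ha hab hb
    exact mul_sub_le_first_deriv_sub h2 hab (by linarith) (by linarith) fun s hs =>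
      hK2 s (abs_le.2 ⟨by linarith [hs.1], by linarith [hs.2]⟩)
  have hr := hgrow 0 s1 (by linarith) hs10.le le_rfl
  have hl := hgrow (-s1) 0 le_rfl (by linarith) hs10.le
  obtain ⟨hw1, hw2⟩ := abs_le.1 hw
  have hcont : ContinuousOn K1 (Set.Icc (-s1) s1) := fun x hx =>
    (h2 x ⟨by linarith [hx.1], by linarith [hx.2]⟩).continuousAt.continuousWithinAt
  obtain ⟨s, hs, hsw⟩ := intermediate_value_Icc (by linarith) hcont
    (show w ∈ Set.Icc (K1 (-s1)) (K1 s1) from ⟨by linarith, by linarith⟩)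
  have hsabs : |s| ≤ s1 := abs_le.2 hs
  have hsIoo : s ∈ Set.Ioo (-ε) ε := ⟨by linarith [hs.1], by linarith [hs.2]⟩
  have hsw' : |s| ≤ 2 / η * |w| := by
    have : η / 2 * |s| ≤ |w| := by
      rcases le_total 0 s with h | h
      · have := hgrow 0 s (by linarith) h hs.2
        rw [abs_of_nonneg h]
        refine le_trans ?_ (le_abs_self w)
        linarith
      · have := hgrow s 0 hs.1 h hs10.le
        rw [abs_of_nonpos h]
        refine le_trans ?_ (neg_le_abs w)
        linarith
    rw [div_mul_eq_mul_div, le_div_iff₀ hη0]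
    linarith
  have hset : saddleSet K w ε = {s} := by
    have hIoo : ∀ x ∈ Set.Icc (-(ε / 2)) (ε / 2), x ∈ Set.Ioo (-ε) ε := fun x hx =>
      ⟨by linarith [hx.1], by linarith [hx.2]⟩
    ext x
    simp only [saddleSet, Set.mem_ofPred_eq, Set.mem_singleton_iff]
    constructor
    · rintro ⟨hx, hxw⟩
      rw [(h1 x (hIoo x hx)).deriv] at hxw
      exact (strictMonoOn_first_deriv h2 hpos).injOn (hIoo x hx) hsIoo (hxw.trans hsw.symm)
    · rintro rfl
      exact ⟨⟨by linarith [hs.1], by linarith [hs.2]⟩, by rw [(h1 x hsIoo).deriv, hsw]⟩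
  have hcard : (saddleSet K w ε).encard = 1 := by rw [hset, Set.encard_singleton]
  have hsp : saddlepoint K w ε = s := by
    rw [saddlepoint, dif_pos hcard]
    have := (Set.encard_eq_one.mp hcard).choose_spec
    exact (Set.singleton_injective (hset.symm.trans this)).symm
  have hder2 : iteratedDeriv 2 K s = K2 s := by
    rw [show (2 : ℕ) = 1 + 1 from rfl, iteratedDeriv_succ, iteratedDeriv_one]
    have : deriv K =ᶠ[𝓝 s] K1 := by
      filter_upwards [isOpen_Ioo.mem_nhds hsIoo] with x hx using (h1 x hx).deriv
    rw [this.deriv_eq, (h2 s hsIoo).deriv]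
  have hlam : lam n K w ε = s * √(n * K2 s) := by rw [lam, hsp, hder2]
  have hV := hK2 s hsabs
  have hV0 : 0 < K2 s := by linarith
  have hleg := abs_two_mul_legendre_sub_le h1 h2 h3 hs0ε hε hK0 hD (hsabs.trans hs1s0)
  rw [hsw] at hleg
  set g := s * w - K s with hg
  set ξ := (2 * g - s ^ 2 * K2 s) / (s ^ 2 * K2 s) with hξ
  -- At `s = 0` the quotient `ξ` is `0` by convention and both sides vanish.
  have hgξ : 2 * g = s ^ 2 * K2 s * (1 + ξ) := by
    rcases eq_or_ne s 0 with h | h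
    · rw [hg, h, hK0]; ring
    · rw [hξ]; field_simp; ring
  have hξle : |ξ| ≤ 2 * D / η * |s| := by
    rcases eq_or_ne s 0 with h | h
    · rw [hξ, h]; simp
    · have hs2 : 0 < |s| := abs_pos.2 h
      rw [hξ, abs_div, abs_of_pos (by positivity : 0 < s ^ 2 * K2 s), div_le_iff₀ (by positivity)]
      refine hleg.trans ?_
      have e : 2 * D / η * |s| * (s ^ 2 * K2 s) = D * |s| ^ 3 * (2 / η * K2 s) := by
        rw [← sq_abs s]; ring
      rw [e]
      refine le_mul_of_one_le_right (by positivity) ?_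
      rw [div_mul_eq_mul_div, le_div_iff₀ hη0]
      linarith
  have hξ2 : |ξ| ≤ 1 / 2 := by
    refine hξle.trans ?_
    have : D * |s| ≤ η / 4 := le_trans (by gcongr) hDs1
    rw [div_mul_eq_mul_div, div_le_iff₀ hη0]
    linarith
  have hξ0 : 0 ≤ 1 + ξ := by linarith [(abs_le.1 hξ2).1]
  have hg0 : 0 ≤ g := by
    have : 0 ≤ s ^ 2 * K2 s * (1 + ξ) := by positivity
    linarith
  have hsq : (√(1 + ξ) * (s * √(n * K2 s))) ^ 2 = 2 * n * g := by
    rw [mul_pow, mul_pow, Real.sq_sqrt hξ0, Real.sq_sqrt (by positivity)]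
    linear_combination (-(n : ℝ)) * hgξ
  refine ⟨hcard, s, √(1 + ξ), hsabs.trans hs1s0, hsw', hsw, hV,
    (abs_sqrt_one_add_sub_one_le hξ2).trans hξ2, (abs_sqrt_one_add_sub_one_le hξ2).trans hξle,
    hlam, ?_, by rw [hsq]; ring⟩
  rw [rstat, hsp, if_pos hg0, ← hg, ← hsq, Real.sqrt_sq_eq_abs, abs_mul,
    abs_of_nonneg (Real.sqrt_nonneg _), abs_mul, abs_of_nonneg (Real.sqrt_nonneg _)]
  have : Real.sign s * |s| = s := by
    rcases lt_trichotomy s 0 with h | h | h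
    · rw [Real.sign_of_neg h, abs_of_neg h]; ring
    · rw [h]; simp
    · rw [Real.sign_of_pos h, abs_of_pos h]; ring
  linear_combination √(1 + ξ) * √(n * K2 s) * this

end Saddle

/-! ### Cumulants of tilted laws -/

/-- The `k`-th moment of the law `P` tilted by `s`. -/
noncomputable def tiltedMoment (P : Measure ℝ) (k : ℕ) (s : ℝ) : ℝ :=
  ∫ x, x ^ k ∂(P.tilted (fun x => s * x))

section Cumulants

variable {P : Measure ℝ} {ε : ℝ}

lemma mem_interior_integrableExpSet
    (h : ∀ s ∈ Set.Ioo (-ε) ε, Integrable (fun x : ℝ => Real.exp (s * x)) P) {s : ℝ}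
    (hs : s ∈ Set.Ioo (-ε) ε) : s ∈ interior (integrableExpSet (fun x : ℝ => x) P) :=
  mem_interior.2 ⟨Set.Ioo (-ε) ε, fun t ht => h t ht, isOpen_Ioo, hs⟩

lemma tiltedMoment_eq (k : ℕ) (s : ℝ) : tiltedMoment P k s =
    (∫ x, x ^ k * Real.exp (s * x) ∂P) / ∫ x, Real.exp (s * x) ∂P := by
  rw [tiltedMoment, integral_tilted, ← integral_div]
  refine integral_congr_ae (Eventually.of_forall fun x => ?_)
  simp only [smul_eq_mul]
  ring

lemma tiltedMoment_one_eq (s : ℝ) :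
    tiltedMoment P 1 s = ∫ x, x ∂(P.tilted (fun x => s * x)) := by simp [tiltedMoment]

lemma hasDerivAt_integral_exp
    (h : ∀ s ∈ Set.Ioo (-ε) ε, Integrable (fun x : ℝ => Real.exp (s * x)) P) {s : ℝ}
    (hs : s ∈ Set.Ioo (-ε) ε) :
    HasDerivAt (fun s => ∫ x, Real.exp (s * x) ∂P) (∫ x, x * Real.exp (s * x) ∂P) s := by
  simpa using hasDerivAt_integral_pow_mul_exp_real (mem_interior_integrableExpSet h hs) 0

lemma integrable_pow_abs_tilted
    (h : ∀ s ∈ Set.Ioo (-ε) ε, Integrable (fun x : ℝ => Real.exp (s * x)) P) {s : ℝ}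
    (hs : s ∈ Set.Ioo (-ε) ε) (k : ℕ) :
    Integrable (fun x => |x| ^ k) (P.tilted (fun x => s * x)) := by
  rw [integrable_tilted_iff (h s hs)]
  refine (integrable_pow_abs_mul_exp_of_mem_interior_integrableExpSet
    (mem_interior_integrableExpSet h hs) k).congr (Eventually.of_forall fun x => ?_)
  simp [mul_comm]

variable [IsProbabilityMeasure P]

lemma hasDerivAt_tiltedMoment
    (h : ∀ s ∈ Set.Ioo (-ε) ε, Integrable (fun x : ℝ => Real.exp (s * x)) P) {s : ℝ}
    (hs : s ∈ Set.Ioo (-ε) ε) (k : ℕ) : HasDerivAt (tiltedMoment P k)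
      (tiltedMoment P (k + 1) s - tiltedMoment P k s * tiltedMoment P 1 s) s := by
  have h1 := hasDerivAt_integral_pow_mul_exp_real (mem_interior_integrableExpSet h hs) k
  have h0 := hasDerivAt_integral_exp h hs
  have hpos : 0 < ∫ x, Real.exp (s * x) ∂P := integral_exp_pos (h s hs)
  have e : tiltedMoment P k = fun s => (∫ x, x ^ k * Real.exp (s * x) ∂P) /
      ∫ x, Real.exp (s * x) ∂P := funext fun s => tiltedMoment_eq k s
  rw [e]
  refine (h1.div h0 hpos.ne').congr_deriv ?_
  simp only [tiltedMoment_eq, pow_one]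
  field_simp

lemma hasDerivAt_cgf_tiltedMoment
    (h : ∀ s ∈ Set.Ioo (-ε) ε, Integrable (fun x : ℝ => Real.exp (s * x)) P) {s : ℝ}
    (hs : s ∈ Set.Ioo (-ε) ε) :
    HasDerivAt (cgf (fun x : ℝ => x) P) (tiltedMoment P 1 s) s := by
  refine ((hasDerivAt_integral_exp h hs).log (integral_exp_pos (h s hs)).ne').congr_deriv ?_
  simp [tiltedMoment_eq]

/-- The tilted variance. -/
noncomputable def tiltedVar (P : Measure ℝ) (s : ℝ) : ℝ :=
  tiltedMoment P 2 s - tiltedMoment P 1 s ^ 2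

/-- The third central moment of the tilted law. -/
noncomputable def tiltedThird (P : Measure ℝ) (s : ℝ) : ℝ :=
  tiltedMoment P 3 s - 3 * tiltedMoment P 1 s * tiltedMoment P 2 s + 2 * tiltedMoment P 1 s ^ 3

lemma hasDerivAt_tiltedMoment_one
    (h : ∀ s ∈ Set.Ioo (-ε) ε, Integrable (fun x : ℝ => Real.exp (s * x)) P) {s : ℝ}
    (hs : s ∈ Set.Ioo (-ε) ε) : HasDerivAt (tiltedMoment P 1) (tiltedVar P s) s :=
  (hasDerivAt_tiltedMoment h hs 1).congr_deriv (by rw [tiltedVar]; ring)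

lemma hasDerivAt_tiltedVar
    (h : ∀ s ∈ Set.Ioo (-ε) ε, Integrable (fun x : ℝ => Real.exp (s * x)) P) {s : ℝ}
    (hs : s ∈ Set.Ioo (-ε) ε) : HasDerivAt (tiltedVar P) (tiltedThird P s) s :=
  ((hasDerivAt_tiltedMoment h hs 2).sub ((hasDerivAt_tiltedMoment_one h hs).pow 2)).congr_deriv
    (by rw [tiltedThird, tiltedVar]; norm_num; ring)

variable {s : ℝ}

lemma tiltedVar_eq (hi : Integrable (fun x => Real.exp (s * x)) P)
    (h3 : Integrable (fun x => |x| ^ 3) (P.tilted (fun x => s * x))) :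
    tiltedVar P s = ∫ x, (x - tiltedMoment P 1 s) ^ 2 ∂(P.tilted (fun x => s * x)) := by
  have := isProbabilityMeasure_tilted hi
  have i1 : Integrable (fun x => x) (P.tilted (fun x => s * x)) := by
    simpa using integrable_pow_of_integrable_abs_pow_three h3 (k := 1) (by norm_num)
  have i2 := integrable_pow_of_integrable_abs_pow_three h3 (k := 2) (by norm_num)
  set m := tiltedMoment P 1 s with hm
  have e : ∀ x : ℝ, (x - m) ^ 2 = x ^ 2 - 2 * m * x + m ^ 2 := fun x => by ring
  have i3 : Integrable (fun x => x ^ 2 - 2 * m * x) (P.tilted (fun x => s * x)) :=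
    i2.sub (i1.const_mul _)
  simp_rw [e]
  rw [integral_add i3 (integrable_const _), integral_sub i2 (i1.const_mul _), integral_const_mul,
    ← tiltedMoment_one_eq, tiltedVar, tiltedMoment, ← hm]
  simp
  ring

lemma tiltedThird_eq (hi : Integrable (fun x => Real.exp (s * x)) P)
    (h3 : Integrable (fun x => |x| ^ 3) (P.tilted (fun x => s * x))) :
    tiltedThird P s = ∫ x, (x - tiltedMoment P 1 s) ^ 3 ∂(P.tilted (fun x => s * x)) := by
  have := isProbabilityMeasure_tilted hi
  have i1 : Integrable (fun x => x) (P.tilted (fun x => s * x)) := by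
    simpa using integrable_pow_of_integrable_abs_pow_three h3 (k := 1) (by norm_num)
  have i2 := integrable_pow_of_integrable_abs_pow_three h3 (k := 2) (by norm_num)
  have i3 := integrable_pow_of_integrable_abs_pow_three h3 (k := 3) (by norm_num)
  set m := tiltedMoment P 1 s with hm
  have e : ∀ x : ℝ, (x - m) ^ 3 = x ^ 3 - 3 * m * x ^ 2 + 3 * m ^ 2 * x - m ^ 3 := fun x => by ring
  have i4 : Integrable (fun x => x ^ 3 - 3 * m * x ^ 2) (P.tilted (fun x => s * x)) :=
    i3.sub (i2.const_mul _)
  have i5 : Integrable (fun x => x ^ 3 - 3 * m * x ^ 2 + 3 * m ^ 2 * x)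
      (P.tilted (fun x => s * x)) := i4.add (i1.const_mul _)
  simp_rw [e]
  rw [integral_sub i5 (integrable_const _), integral_add i4 (i1.const_mul _),
    integral_sub i3 (i2.const_mul _), integral_const_mul, integral_const_mul,
    ← tiltedMoment_one_eq, tiltedThird, ← hm]
  simp [tiltedMoment]
  ring

lemma abs_tiltedThird_le (hi : Integrable (fun x => Real.exp (s * x)) P)
    (h3 : Integrable (fun x => |x| ^ 3) (P.tilted (fun x => s * x))) :
    |tiltedThird P s| ≤ 8 * ∫ x, |x| ^ 3 ∂(P.tilted (fun x => s * x)) := by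
  have := isProbabilityMeasure_tilted hi
  rw [tiltedThird_eq hi h3, tiltedMoment_one_eq]
  refine (abs_integral_le_integral_abs).trans ?_
  simp_rw [abs_pow]
  exact integral_abs_sub_mean_pow_three_le h3

lemma tiltedVar_nonneg (hi : Integrable (fun x => Real.exp (s * x)) P)
    (h3 : Integrable (fun x => |x| ^ 3) (P.tilted (fun x => s * x))) : 0 ≤ tiltedVar P s := by
  rw [tiltedVar_eq hi h3]
  exact integral_nonneg fun x => sq_nonneg _

/-- If the tilted variance vanished, the tilted law would be a point mass. The original law is
absolutely continuous with respect to it, so it would be the same point mass, located at its mean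
`0`, contradicting `hvar`. -/
lemma tiltedVar_pos (hi : Integrable (fun x => Real.exp (s * x)) P)
    (h3 : Integrable (fun x => |x| ^ 3) (P.tilted (fun x => s * x)))
    (hmean : ∫ x, x ∂P = 0) (hvar : 0 < ∫ x, x ^ 2 ∂P) : 0 < tiltedVar P s := by
  refine (tiltedVar_nonneg hi h3).lt_of_ne' fun h0 => ?_
  have := isProbabilityMeasure_tilted hi
  set m := tiltedMoment P 1 s with hm
  rw [tiltedVar_eq hi h3, integral_eq_zero_iff_of_nonneg (fun x => sq_nonneg _)] at h0
  · have h1 : ∀ᵐ x ∂P, x = m := by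
      filter_upwards [(absolutelyContinuous_tilted hi).ae_le h0] with x hx
      have : (x - m) ^ 2 = 0 := hx
      nlinarith
    have h2 : ∫ x, x ∂P = m := by
      rw [integral_congr_ae h1]; simp
    have hm0 : m = 0 := by rw [← h2, hmean]
    have h4 : ∫ x, x ^ 2 ∂P = 0 := by
      rw [integral_congr_ae (g := fun _ => (0 : ℝ)) (by
        filter_upwards [h1] with x hx
        rw [hx, hm0]; norm_num)]
      simp
    linarith
  · have e : ∀ x : ℝ, (x - m) ^ 2 = |x - m| ^ 2 := fun x => (sq_abs _).symm
    have h1 : Integrable (fun x => |x - m| ^ 3 + 1) (P.tilted (fun x => s * x)) :=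
      (integrable_abs_sub_pow_three h3 m).add (integrable_const _)
    refine h1.mono' ((continuous_id.sub continuous_const).pow 2).aestronglyMeasurable
      (Eventually.of_forall fun x => ?_)
    rw [Real.norm_of_nonneg (sq_nonneg _), e]
    rcases le_total |x - m| 1 with hx | hx
    · have := pow_le_one₀ (n := 2) (abs_nonneg (x - m)) hx
      have : 0 ≤ |x - m| ^ 3 := by positivity
      linarith
    · have := pow_le_pow_right₀ hx (show 2 ≤ 3 by norm_num)
      linarith

lemma tiltedMoment_zero_right (k : ℕ) : tiltedMoment P k 0 = ∫ x, x ^ k ∂P := by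
  simp [tiltedMoment_eq]

/-! ### Moments of standardized tilted laws -/

variable {σ : ℝ}

lemma integrable_tiltedStd_abs_pow_three (hi : Integrable (fun x => Real.exp (s * x)) P)
    (h3 : Integrable (fun x => |x| ^ 3) (P.tilted (fun x => s * x))) (m : ℝ) :
    Integrable (fun z => |z| ^ 3) (tiltedStd P s m σ) := by
  have := isProbabilityMeasure_tilted hi
  rw [tiltedStd, integrable_map_measure (by fun_prop) (by fun_prop)]
  refine ((integrable_abs_sub_pow_three h3 m).div_const (|σ| ^ 3)).congr
    (Eventually.of_forall fun x => ?_)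
  simp only [Function.comp, abs_div, div_pow]

lemma integral_tiltedStd_id (hi : Integrable (fun x => Real.exp (s * x)) P)
    (h3 : Integrable (fun x => |x| ^ 3) (P.tilted (fun x => s * x))) :
    ∫ z, z ∂(tiltedStd P s (tiltedMoment P 1 s) σ) = 0 := by
  have := isProbabilityMeasure_tilted hi
  have i1 : Integrable (fun x => x) (P.tilted (fun x => s * x)) := by
    simpa using integrable_pow_of_integrable_abs_pow_three h3 (k := 1) (by norm_num)
  rw [integral_tiltedStd (f := fun z => z) stronglyMeasurable_id, integral_div,
    integral_sub i1 (integrable_const _), ← tiltedMoment_one_eq]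
  simp

lemma integral_tiltedStd_sq (hi : Integrable (fun x => Real.exp (s * x)) P)
    (h3 : Integrable (fun x => |x| ^ 3) (P.tilted (fun x => s * x))) :
    ∫ z, z ^ 2 ∂(tiltedStd P s (tiltedMoment P 1 s) σ) = tiltedVar P s / σ ^ 2 := by
  rw [integral_tiltedStd (Continuous.stronglyMeasurable (by fun_prop)), tiltedVar_eq hi h3,
    ← integral_div]
  simp_rw [div_pow]

lemma integral_tiltedStd_abs_pow_three_le (hi : Integrable (fun x => Real.exp (s * x)) P)
    (h3 : Integrable (fun x => |x| ^ 3) (P.tilted (fun x => s * x))) (hσ : 0 < σ) :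
    ∫ z, |z| ^ 3 ∂(tiltedStd P s (tiltedMoment P 1 s) σ) ≤
      8 * (∫ x, |x| ^ 3 ∂(P.tilted (fun x => s * x))) / σ ^ 3 := by
  have := isProbabilityMeasure_tilted hi
  rw [integral_tiltedStd (Continuous.stronglyMeasurable (by fun_prop))]
  simp_rw [abs_div, div_pow, abs_of_pos hσ]
  rw [integral_div, tiltedMoment_one_eq]
  gcongr
  exact integral_abs_sub_mean_pow_three_le h3

end Cumulants

/-! ### The saddlepoint approximation for independent variables, uniformly in the laws -/

lemma prod_integral_exp_eq {n : ℕ} {P : Fin n → Measure ℝ} [∀ i, IsProbabilityMeasure (P i)]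
    {s : ℝ} (h : ∀ i, Integrable (fun x : ℝ => Real.exp (s * x)) (P i)) :
    ∏ i, ∫ x, Real.exp (s * x) ∂(P i) = Real.exp (∑ i, cgf (fun x : ℝ => x) (P i) s) := by
  rw [Real.exp_sum]
  refine Finset.prod_congr rfl fun i _ => ?_
  rw [exp_cgf (h i)]
  rfl

/-- Berry–Esseen for the standardized tilted summands, with `L` a bound for their Lyapunov ratio.
The `8` pays for centring the third moments. -/
lemma exists_abs_laplace_sub_mills_le : ∃ C : ℝ, 0 < C ∧
    ∀ (n : ℕ) (P : Fin n → Measure ℝ) [∀ i, IsProbabilityMeasure (P i)] (s σ L : ℝ),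
      0 < σ → 0 < L →
      (∀ i, Integrable (fun x : ℝ => Real.exp (s * x)) (P i)) →
      (∀ i, Integrable (fun x => |x| ^ 3) ((P i).tilted (fun x => s * x))) →
      σ ^ 2 = ∑ i, tiltedVar (P i) s →
      8 * ∑ i, ∫ x, |x| ^ 3 ∂((P i).tilted (fun x => s * x)) ≤ L * σ ^ 3 →
      (0 ≤ s → |∫ z in Set.Ici 0, Real.exp (-(s * σ * z)) ∂(tiltedStd (sumLaw P) s
          (∑ i, tiltedMoment (P i) 1 s) σ) - mills (s * σ)| ≤ C * L) ∧
      (s < 0 → |∫ z in Set.Iio 0, Real.exp (-(s * σ * z)) ∂(tiltedStd (sumLaw P) s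
          (∑ i, tiltedMoment (P i) 1 s) σ) - mills (-(s * σ))| ≤ C * L) := by
  obtain ⟨C, hC, hBE⟩ := exists_berryEsseen_const
  refine ⟨2 * C, by positivity, ?_⟩
  intro n P _ s σ L hσ hL hi h3 hσ2 hL3
  set ν := tiltedStd (sumLaw P) s (∑ i, tiltedMoment (P i) 1 s) σ with hν
  have hνp : IsProbabilityMeasure ν := isProbabilityMeasure_tiltedStd (integrable_exp_sumLaw hi)
  have hQ : ∀ i, IsProbabilityMeasure (tiltedStd (P i) s (tiltedMoment (P i) 1 s) σ) :=
    fun i => isProbabilityMeasure_tiltedStd (hi i)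
  have hbe := hBE n (fun i => tiltedStd (P i) s (tiltedMoment (P i) 1 s) σ) ν L hL
    (fun i => integrable_tiltedStd_abs_pow_three (hi i) (h3 i) _)
    (fun i => integral_tiltedStd_id (hi i) (h3 i))
    (by
      rw [Finset.sum_congr rfl fun i _ => integral_tiltedStd_sq (hi i) (h3 i), ← Finset.sum_div,
        ← hσ2, div_self (by positivity)])
    (by
      refine (Finset.sum_le_sum fun i _ =>
        integral_tiltedStd_abs_pow_three_le (hi i) (h3 i) hσ).trans ?_
      rw [← Finset.sum_div, ← Finset.mul_sum, div_le_iff₀ (by positivity)]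
      exact hL3)
    (fun t => charFun_tiltedStd_sumLaw t)
  have hCL : 0 ≤ C * L := by positivity
  refine ⟨fun hs => ?_, fun hs => ?_⟩
  · have := abs_setIntegral_exp_sub_mills_le hbe (x := s * σ) (by positivity)
    linarith
  · have := abs_setIntegral_Iio_exp_sub_mills_le hbe (x := -(s * σ)) (by nlinarith)
    simp only [neg_mul] at this
    linarith

/-- The Lugannani–Rice formula has vanishing relative error uniformly over independent summands with
controlled third moments and nondegenerate variances. -/
theorem exists_uniform_lugannaniRice {ε s0 B η τ : ℝ} (hs0 : 0 < s0) (hs0ε : s0 ≤ ε / 2)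
    (hB : 0 < B) (hη : 0 < η) (hτ : 0 < τ) (hτ1 : τ ≤ 1) :
    ∃ N : ℕ, ∃ w0 : ℝ, 0 < w0 ∧ ∀ n, N ≤ n → ∀ (P : Fin n → Measure ℝ)
      [∀ i, IsProbabilityMeasure (P i)] (b : Fin n → ℝ),
      (∀ i, ∀ s ∈ Set.Ioo (-ε) ε, Integrable (fun x : ℝ => Real.exp (s * x)) (P i)) →
      (∀ i, ∫ x, x ∂(P i) = 0) →
      (∀ i s, |s| ≤ s0 → ∫ x, |x| ^ 3 ∂((P i).tilted (fun x => s * x)) ≤ b i) →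
      (1 / (n : ℝ)) * ∑ i, b i ≤ B → η ≤ (1 / (n : ℝ)) * ∑ i, ∫ x, x ^ 2 ∂(P i) →
      ∀ w : ℝ, |w| ≤ w0 → ∀ K : ℝ → ℝ,
      (K = fun s => (1 / (n : ℝ)) * ∑ i, cgf (fun x : ℝ => x) (P i) s) →
      (saddleSet K w ε).encard = 1 ∧
      |(Measure.pi P).real {x | w ≤ (1 / (n : ℝ)) * ∑ i, x i} - lugannaniRice n K w ε| ≤
        τ * |lugannaniRice n K w ε| := by
  obtain ⟨C, hC, hlap⟩ := exists_abs_laplace_sub_mills_le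
  -- `D` bounds the third derivative of `K`. `C5 / σ` is the Berry–Esseen error, and `C6` adds the
  -- contributions `4 D / η` and `64 D / η` of `ρ - 1`. `R` is chosen so that `C6 * (2 / R) = τ /
  -- 36`; it then remains to ensure `σ ≥ R`, by taking `n` large, and `|s| ≤ 1 / R`, by taking `w`
  -- small.
  set D : ℝ := 8 * B with hD
  have hD0 : 0 < D := by positivity
  set C5 := C * (2 * D / η) with hC5
  set C6 := C5 + 68 * D / η with hC6
  have hC50 : 0 < C5 := by positivity
  have hC60 : 0 < C6 := by positivity
  set R := 72 * C6 / τ with hR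
  have hR0 : 0 < R := by positivity
  refine ⟨max 1 ⌈2 * R ^ 2 / η⌉₊, min (η / 2 * min s0 (η / (4 * D))) (η / (2 * R)),
    lt_min (mul_pos (by positivity) (lt_min hs0 (by positivity))) (by positivity), ?_⟩
  intro n hn P _ b hint hmean hb hbB hvar w hw K hK
  have hε : 0 < ε := by linarith
  have hn1 : 1 ≤ n := (le_max_left _ _).trans hn
  have hn0 : (0 : ℝ) < n := by exact_mod_cast hn1
  have hnR : R ^ 2 ≤ n * (η / 2) := by
    have h1 : (⌈2 * R ^ 2 / η⌉₊ : ℝ) ≤ n := by exact_mod_cast (le_max_right _ _).trans hn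
    have h2 := (Nat.le_ceil _).trans h1
    rw [div_le_iff₀ hη] at h2
    linarith
  have h3int : ∀ i, ∀ s ∈ Set.Ioo (-ε) ε,
      Integrable (fun x => |x| ^ 3) ((P i).tilted (fun x => s * x)) := fun i s hs =>
    integrable_pow_abs_tilted (hint i) hs 3
  have hmem : ∀ s, |s| ≤ s0 → s ∈ Set.Ioo (-ε) ε := fun s hs =>
    ⟨by linarith [(abs_le.1 hs).1], by linarith [(abs_le.1 hs).2]⟩
  have h0mem : (0 : ℝ) ∈ Set.Ioo (-ε) ε := ⟨by linarith, hε⟩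
  have hbsum : ∀ s, |s| ≤ s0 →
      ∑ i, ∫ x, |x| ^ 3 ∂((P i).tilted (fun x => s * x)) ≤ n * B := by
    intro s hs
    refine (Finset.sum_le_sum fun i _ => hb i s hs).trans ?_
    rw [one_div, inv_mul_le_iff₀ hn0] at hbB
    exact hbB
  -- One nondegenerate summand makes `K'' > 0` on the whole of `(-ε, ε)`, also where the third
  -- moments are not controlled.
  have hvarpos : ∃ i, 0 < ∫ x, x ^ 2 ∂(P i) := by
    by_contra! hcon
    have : ∑ i, ∫ x, x ^ 2 ∂(P i) ≤ 0 := Finset.sum_nonpos fun i _ => hcon i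
    have : (1 / (n : ℝ)) * ∑ i, ∫ x, x ^ 2 ∂(P i) ≤ 0 :=
      mul_nonpos_of_nonneg_of_nonpos (by positivity) this
    linarith
  obtain ⟨hcard, s, ρ, hss0, hsw, hK1, hK2, hρ, hρs, hlam, hr, hexp⟩ :=
    saddlepoint_spec (K := K) (K1 := fun s => (1 / (n : ℝ)) * ∑ i, tiltedMoment (P i) 1 s)
      (K2 := fun s => (1 / (n : ℝ)) * ∑ i, tiltedVar (P i) s)
      (K3 := fun s => (1 / (n : ℝ)) * ∑ i, tiltedThird (P i) s) (ε := ε) (s0 := s0) (η := η)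
      (D := D)
      (fun s hs => by
        rw [hK]
        exact (HasDerivAt.fun_sum fun i _ => hasDerivAt_cgf_tiltedMoment (hint i) hs).const_mul _)
      (fun s hs => (HasDerivAt.fun_sum fun i _ =>
        hasDerivAt_tiltedMoment_one (hint i) hs).const_mul _)
      (fun s hs => (HasDerivAt.fun_sum fun i _ =>
        hasDerivAt_tiltedVar (hint i) hs).const_mul _)
      hs0 hs0ε (by rw [hK]; simp) (by simp [tiltedMoment_zero_right, hmean]) hη
      (by
        simp only [tiltedVar, tiltedMoment_zero_right, pow_one, hmean]
        simpa using hvar)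
      (fun s hs => by
        refine mul_pos (by positivity) (Finset.sum_pos' (fun i _ =>
          tiltedVar_nonneg (hint i s hs) (h3int i s hs)) ?_)
        obtain ⟨i, hi⟩ := hvarpos
        exact ⟨i, Finset.mem_univ i, tiltedVar_pos (hint i s hs) (h3int i s hs) (hmean i) hi⟩)
      hD0
      (fun s hs => by
        rw [abs_mul, abs_of_pos (by positivity : 0 < 1 / (n : ℝ)), one_div, inv_mul_le_iff₀ hn0]
        refine (Finset.abs_sum_le_sum_abs _ _).trans ?_
        refine (Finset.sum_le_sum fun i _ => abs_tiltedThird_le (hint i s (hmem s hs))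
          (h3int i s (hmem s hs))).trans ?_
        rw [← Finset.mul_sum]
        linarith [hbsum s hs])
      (hw.trans (min_le_left _ _)) n
  refine ⟨hcard, ?_⟩
  have hs := hmem s hss0
  set V := (1 / (n : ℝ)) * ∑ i, tiltedVar (P i) s with hV
  have hV0 : 0 < V := by linarith
  set σ := √(n * V) with hσ
  have hσ0 : 0 < σ := Real.sqrt_pos.2 (by positivity)
  have hσ2 : σ ^ 2 = n * V := Real.sq_sqrt (by positivity)
  have hσR : R ≤ σ := by
    refine Real.le_sqrt_of_sq_le (hnR.trans ?_)
    gcongr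
  have hm : ∑ i, tiltedMoment (P i) 1 s = n * w := by
    rw [← hK1]; field_simp
  obtain ⟨hlap1, hlap2⟩ := hlap n P s σ (2 * D / η / σ) hσ0 (by positivity) (fun i => hint i s hs)
    (fun i => h3int i s hs) (by rw [hσ2, hV]; field_simp) (by
      have e : 2 * D / η / σ * σ ^ 3 = 2 * D / η * σ ^ 2 := by field_simp
      rw [e, hσ2]
      have h1 : D * n ≤ 2 * D / η * (n * V) := by
        rw [div_mul_eq_mul_div, le_div_iff₀ hη]
        have : D * n * η ≤ D * n * (2 * V) := by gcongr; linarith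
        linarith
      linarith [hbsum s hss0])
  rw [hm] at hlap1 hlap2
  have hCσ : C * (2 * D / η / σ) = C5 / σ := by rw [hC5]; ring
  rw [hCσ] at hlap1 hlap2
  have hsR : |s| ≤ 1 / R := by
    refine hsw.trans ?_
    calc 2 / η * |w| ≤ 2 / η * (η / (2 * R)) := by
          gcongr
          exact hw.trans (min_le_right _ _)
      _ = 1 / R := by field_simp
  have hτC : C6 * (1 / R + 1 / R) = τ / 36 := by rw [hR]; field_simp; norm_num
  have hκ : (C5 / σ + 32 * |ρ - 1| / (1 + |s * σ|) + 2 * |ρ - 1| / |s * σ|) * (1 + |s * σ|) ≤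
      τ / 36 := by
    have hsσ : |s * σ| = |s| * σ := by rw [abs_mul, abs_of_pos hσ0]
    have h1 : 2 * |ρ - 1| / |s * σ| ≤ 4 * D / η / σ := by
      rw [hsσ]
      rcases eq_or_ne s 0 with h0 | h0
      · rw [h0]; simp; positivity
      · have hsp : 0 < |s| := abs_pos.2 h0
        rw [div_le_div_iff₀ (by positivity) hσ0]
        calc 2 * |ρ - 1| * σ ≤ 2 * (2 * D / η * |s|) * σ := by gcongr
          _ = _ := by ring
    -- The relative size of the Berry–Esseen error: `(1 + |λ|) / σ = 1 / σ + |s|`.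
    have h2 : (1 + |s * σ|) / σ ≤ 1 / R + 1 / R := by
      rw [hsσ, add_div, mul_div_assoc, div_self hσ0.ne', mul_one]
      refine add_le_add ?_ hsR
      exact one_div_le_one_div_of_le hR0 hσR
    have h3 : 32 * |ρ - 1| ≤ 64 * D / η * (1 / R) := by
      calc 32 * |ρ - 1| ≤ 32 * (2 * D / η * (1 / R)) := by
            gcongr
            exact hρs.trans (by gcongr)
        _ = _ := by ring
    have hpos1 : 0 < 1 + |s * σ| := by positivity
    calc (C5 / σ + 32 * |ρ - 1| / (1 + |s * σ|) + 2 * |ρ - 1| / |s * σ|) * (1 + |s * σ|)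
        ≤ (C5 / σ + 32 * |ρ - 1| / (1 + |s * σ|) + 4 * D / η / σ) * (1 + |s * σ|) := by gcongr
      _ = (C5 + 4 * D / η) * ((1 + |s * σ|) / σ) + 32 * |ρ - 1| := by field_simp; ring
      _ ≤ (C5 + 4 * D / η) * (1 / R + 1 / R) + 64 * D / η * (1 / R + 1 / R) := by
          refine add_le_add (by gcongr) (h3.trans ?_)
          gcongr
          have : 0 < 1 / R := by positivity
          linarith
      _ = C6 * (1 / R + 1 / R) := by rw [hC6]; ring
      _ = τ / 36 := hτC
  -- The prefactor of the change of measure is `exp(n (K(s) - s w))`, that is `exp(-r² / 2)`.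
  have hfac : (∫ x, Real.exp (s * x) ∂(sumLaw P)) * Real.exp (-(s * (n * w))) =
      Real.exp (-((ρ * (s * σ)) ^ 2 / 2)) := by
    rw [integral_exp_sumLaw, prod_integral_exp_eq fun i => hint i s hs, ← Real.exp_add, ← hexp]
    congr 1
    have : ∑ i, cgf (fun x : ℝ => x) (P i) s = n * K s := by rw [hK]; field_simp
    rw [this]
    ring
  have hexpi := integrable_exp_sumLaw fun i => hint i s hs
  have hLR : lugannaniRice n K w ε = 1 - cdf (gaussianReal 0 1) (ρ * (s * σ)) +
      gaussianPDFReal 0 1 (ρ * (s * σ)) * (1 / (s * σ) - 1 / (ρ * (s * σ))) := by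
    rw [lugannaniRice, hlam, hr]
  rw [pi_real_mean_ge P hn1, hLR]
  rcases le_or_gt 0 s with hs' | hs'
  · have hsσ : 0 ≤ s * σ := by positivity
    rw [abs_of_nonneg hsσ] at hκ
    refine lugannaniRice_rel_error_of_nonneg hsσ hρ ?_ (hlap1 hs') hτ1 hκ
    rw [← hfac, ← measureReal_eq_setIntegral_tiltedStd hexpi hσ0 measurableSet_Ici]
    congr 1
    ext x
    simp only [Set.mem_Ici, Set.mem_ofPred_eq]
    rw [le_div_iff₀ hσ0, zero_mul, sub_nonneg]
  · have hsσ : s * σ < 0 := mul_neg_of_neg_of_pos hs' hσ0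
    rw [abs_of_neg hsσ] at hκ
    refine lugannaniRice_rel_error_of_neg hsσ hρ ?_ (hlap2 hs') hτ1 ?_
    · rw [← hfac, ← measureReal_eq_setIntegral_tiltedStd hexpi hσ0 measurableSet_Iio,
        ← probReal_compl_eq_one_sub measurableSet_Ici, Set.compl_Ici]
      congr 1
      ext x
      simp only [Set.mem_Iio, Set.mem_ofPred_eq]
      rw [div_lt_iff₀ hσ0, zero_mul, sub_neg]
    · refine le_trans (le_mul_of_one_le_right ?_ ?_) hκ
      · have h1 : 0 < -(s * σ) := by linarith
        have h2 : 0 < 1 + -(s * σ) := by linarith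
        positivity
      · linarith

/-! ### Regular conditional distributions -/

section CondDistrib

variable {Ω β E : Type*} [MeasurableSpace Ω] [MeasurableSpace β] [MeasurableSpace E]
  [StandardBorelSpace E] [Nonempty E] {μ : Measure Ω} [IsFiniteMeasure μ] {X : Ω → β}

lemma ae_ae_condDistrib_of_ae {Y : Ω → E} (hX : Measurable X) (hY : Measurable Y)
    {S : Set (β × E)} (hS : MeasurableSet S) (h : ∀ᵐ ω ∂μ, (X ω, Y ω) ∈ S) :
    ∀ᵐ ω ∂μ, ∀ᵐ y ∂(condDistrib Y X μ (X ω)), (X ω, y) ∈ S := by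
  have h1 : ∀ᵐ p ∂(μ.map fun ω => (X ω, Y ω)), p ∈ S :=
    (ae_map_iff (hX.prodMk hY).aemeasurable hS).2 h
  rw [← compProd_map_condDistrib hY.aemeasurable] at h1
  exact ae_of_ae_map hX.aemeasurable (Measure.ae_ae_of_ae_compProd h1)

lemma condExp_indicator_prodMk_ae_eq {Y : Ω → E} (hX : Measurable X) (hY : Measurable Y)
    {S : Set (β × E)} (hS : MeasurableSet S) :
    μ⟦{ω | (X ω, Y ω) ∈ S} | MeasurableSpace.comap X inferInstance⟧ =ᵐ[μ]
      fun ω => (condDistrib Y X μ (X ω)).real {y | (X ω, y) ∈ S} := by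
  have h := condExp_prod_ae_eq_integral_condDistrib (μ := μ) hX hY.aemeasurable
    (f := S.indicator fun _ => (1 : ℝ)) (stronglyMeasurable_const.indicator hS)
    ((integrable_const (1 : ℝ)).indicator (hS.preimage (hX.prodMk hY)))
  refine EventuallyEq.trans (EventuallyEq.of_eq rfl) (h.trans (Eventually.of_forall fun ω => ?_))
  have hm : MeasurableSet {y | (X ω, y) ∈ S} := hS.preimage measurable_prodMk_left
  simp only
  rw [← integral_indicator_one hm]
  rfl

/-- The product formula holds off a null set that depends on the box. Countably many boxes with
rational corners suffice, since the rational half-lines form a generating π-system. -/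
lemma condDistrib_pi_ae_eq {n : ℕ} {Y : Fin n → Ω → ℝ} (hX : Measurable X)
    (hY : ∀ i, Measurable (Y i))
    (hind : ∀ B : Fin n → Set ℝ, (∀ i, MeasurableSet (B i)) →
      μ⟦⋂ i, Y i ⁻¹' B i | MeasurableSpace.comap X inferInstance⟧ =ᵐ[μ]
        fun ω => ∏ i, (μ⟦Y i ⁻¹' B i | MeasurableSpace.comap X inferInstance⟧) ω) :
    ∀ᵐ ω ∂μ, condDistrib (fun ω i => Y i ω) X μ (X ω) =
      Measure.pi fun i => condDistrib (Y i) X μ (X ω) := by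
  have hV : Measurable fun ω i => Y i ω := measurable_pi_lambda _ hY
  have h1 : ∀ q : Fin n → ℚ, ∀ᵐ ω ∂μ, (condDistrib (fun ω i => Y i ω) X μ (X ω)).real
      (Set.pi Set.univ fun i => Set.Iic (q i : ℝ)) =
      ∏ i, (condDistrib (Y i) X μ (X ω)).real (Set.Iic (q i : ℝ)) := by
    intro q
    have hB : MeasurableSet (Set.pi Set.univ fun i => Set.Iic (q i : ℝ)) :=
      MeasurableSet.univ_pi fun i => measurableSet_Iic
    have e : (fun ω i => Y i ω) ⁻¹' (Set.pi Set.univ fun i => Set.Iic (q i : ℝ)) =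
        ⋂ i, Y i ⁻¹' Set.Iic (q i : ℝ) := by
      ext ω; simp [Pi.le_def]
    have a1 := condDistrib_ae_eq_condExp (μ := μ) hX hV hB
    rw [e] at a1
    have a2 : ∀ᵐ ω ∂μ, ∀ i, (condDistrib (Y i) X μ (X ω)).real (Set.Iic (q i : ℝ)) =
        (μ⟦Y i ⁻¹' Set.Iic (q i : ℝ) | MeasurableSpace.comap X inferInstance⟧) ω :=
      ae_all_iff.2 fun i => condDistrib_ae_eq_condExp hX (hY i) measurableSet_Iic
    filter_upwards [a1, a2, hind (fun i => Set.Iic (q i : ℝ)) fun i => measurableSet_Iic]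
      with ω b1 b2 b3
    rw [b1, b3]
    exact Finset.prod_congr rfl fun i _ => (b2 i).symm
  filter_upwards [ae_all_iff.2 h1] with ω hω
  symm
  refine Measure.pi_eq_generateFrom (C := fun _ => ⋃ a : ℚ, {Set.Iic (a : ℝ)})
    (fun _ => by rw [← Real.borel_eq_generateFrom_Iic_rat, ← BorelSpace.measurable_eq])
    (fun _ => Real.isPiSystem_Iic_rat)
    (fun i => ⟨fun k => Set.Iic (k : ℝ), fun k => Set.mem_iUnion.2 ⟨k, by simp⟩,
      fun k => measure_lt_top _ _, ?_⟩) ?_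
  · refine Set.eq_univ_of_forall fun x => ?_
    obtain ⟨k, hk⟩ := exists_nat_ge x
    exact Set.mem_iUnion.2 ⟨k, hk⟩
  · intro s hs
    simp only [Set.mem_iUnion, Set.mem_singleton_iff] at hs
    choose q hq using hs
    have hs' : s = fun i => Set.Iic (q i : ℝ) := funext hq
    have := hω q
    rw [hs']
    simp only [measureReal_def, ← ENNReal.toReal_prod] at this
    rwa [ENNReal.toReal_eq_toReal_iff' (measure_ne_top _ _)
      (ENNReal.prod_ne_top fun i _ => measure_ne_top _ _)] at this

end CondDistrib

lemma measurableSet_le_mean {β : Type*} [MeasurableSpace β] {w : β → ℝ} (hw : Measurable w)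
    (n : ℕ) : MeasurableSet {p : β × (Fin n → ℝ) | w p.1 ≤ (1 / (n : ℝ)) * ∑ i, p.2 i} :=
  measurableSet_le (by fun_prop) (by fun_prop)

lemma measurableSet_mem_Icc_neg {β : Type*} [MeasurableSpace β] {v : β → ℝ} (hv : Measurable v) :
    MeasurableSet {p : β × ℝ | p.2 ∈ Set.Icc (-v p.1) (v p.1)} :=
  (measurableSet_le (f := fun p : β × ℝ => -v p.1) (g := fun p => p.2) (by fun_prop)
    (by fun_prop)).inter (measurableSet_le (f := fun p : β × ℝ => p.2) (g := fun p => v p.1)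
    (by fun_prop) (by fun_prop))

section CondLaw

variable {Ω : Type*} {m : MeasurableSpace Ω} [mΩ : MeasurableSpace Ω] {μ : Measure Ω}
  [IsFiniteMeasure μ]

instance isProbabilityMeasure_condLaw (Y : Ω → ℝ) (ω : Ω) :
    IsProbabilityMeasure (condLaw m μ Y ω) := by
  unfold condLaw; infer_instance

lemma ae_ae_condLaw_of_ae (hm : m ≤ mΩ) {Y : Ω → ℝ} (hY : Measurable Y) {S : Set (Ω × ℝ)}
    (hS : MeasurableSet[m.prod inferInstance] S) (h : ∀ᵐ ω ∂μ, (ω, Y ω) ∈ S) :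
    ∀ᵐ ω ∂μ, ∀ᵐ y ∂(condLaw m μ Y ω), (ω, y) ∈ S :=
  @ae_ae_condDistrib_of_ae Ω Ω ℝ mΩ m _ _ _ μ _ id Y (measurable_id'' hm) hY S hS h

/-- Disintegration along the identity map into `(Ω, m)` freezes the `m`-measurable threshold at `w
ω`; conditional independence then makes the joint conditional law a product. -/
lemma condProb_mean_ge_ae_eq (hm : m ≤ mΩ) {n : ℕ} {Y : Fin n → Ω → ℝ}
    (hY : ∀ i, Measurable (Y i)) (hind : CondIndependent m μ Y) {w : Ω → ℝ}
    (hw : Measurable[m] w) :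
    μ⟦{ω | w ω ≤ (1 / (n : ℝ)) * ∑ i, Y i ω} | m⟧ =ᵐ[μ] fun ω =>
      (Measure.pi fun i => condLaw m μ (Y i) ω).real
        {x | w ω ≤ (1 / (n : ℝ)) * ∑ i, x i} := by
  have hV : Measurable fun ω i => Y i ω := measurable_pi_lambda _ hY
  have hcomap : MeasurableSpace.comap (id : Ω → Ω) m = m := MeasurableSpace.comap_id
  have h1 := @condDistrib_pi_ae_eq Ω Ω mΩ m μ _ id n Y (measurable_id'' hm) hY
    (by rw [hcomap]; exact hind)
  have hS : MeasurableSet[m.prod inferInstance]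
      {p : Ω × (Fin n → ℝ) | w p.1 ≤ (1 / (n : ℝ)) * ∑ i, p.2 i} := @measurableSet_le_mean Ω m w hw n
  have h2 := @condExp_indicator_prodMk_ae_eq Ω Ω (Fin n → ℝ) mΩ m _ _ _ μ _ id
    (fun ω i => Y i ω) (measurable_id'' hm) hV _ hS
  rw [hcomap] at h2
  filter_upwards [h1, h2] with ω b1 b2
  refine b2.trans ?_
  rw [b1]
  rfl

end CondLaw

/-! ### Tail conditions and tilted third moments -/

section Tails

variable {P : Measure ℝ} [IsProbabilityMeasure P]

/-- Layer-cake formula for `exp(c |x|) - 1 = ∫₀^|x| c exp(c t) dt`, with the tail bound inserted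
under the integral. -/
lemma lintegral_exp_mul_abs_sub_one_le {θ β c : ℝ} (hc : 0 < c) (hcβ : c < β)
    (h : ∀ t, 0 < t → P.real {x | t ≤ |x|} ≤ θ * Real.exp (-β * t)) :
    ∫⁻ x, ENNReal.ofReal (Real.exp (c * |x|) - 1) ∂P ≤ ENNReal.ofReal (θ * c / (β - c)) := by
  have hder : ∀ a : ℝ, ∫ t in (0)..a, c * Real.exp (c * t) = Real.exp (c * a) - 1 := by
    intro a
    have : ∀ t ∈ Set.uIcc 0 a, HasDerivAt (fun t => Real.exp (c * t)) (c * Real.exp (c * t)) t := by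
      intro t _
      have := ((hasDerivAt_id t).const_mul c).exp
      simpa [mul_comm] using this
    rw [intervalIntegral.integral_eq_sub_of_hasDerivAt this
      (Continuous.intervalIntegrable (by fun_prop) _ _)]
    simp
  have hlc := lintegral_comp_eq_lintegral_meas_le_mul P (f := fun x => |x|)
    (g := fun t => c * Real.exp (c * t)) (Eventually.of_forall fun x => abs_nonneg x)
    (by fun_prop) (fun t _ => Continuous.intervalIntegrable (by fun_prop) _ _)
    (Eventually.of_forall fun t => by positivity)
  simp_rw [hder] at hlc
  rw [hlc]
  have hθ : 0 ≤ θ := by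
    have h1 := measureReal_nonneg.trans (h 1 one_pos)
    exact nonneg_of_mul_nonneg_left h1 (Real.exp_pos _)
  have hint : IntegrableOn (fun t => θ * c * Real.exp (-(β - c) * t)) (Set.Ioi 0) :=
    (exp_neg_integrableOn_Ioi 0 (by linarith)).const_mul _
  have hval : ∫ t in Set.Ioi 0, θ * c * Real.exp (-(β - c) * t) = θ * c / (β - c) := by
    rw [integral_const_mul, integral_exp_mul_Ioi (by linarith)]
    have : β - c ≠ 0 := by linarith
    simp only [mul_zero, Real.exp_zero, neg_div_neg_eq]
    ring
  rw [← hval, ofReal_integral_eq_lintegral_ofReal hint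
    (Eventually.of_forall fun t => by positivity)]
  refine setLIntegral_mono' measurableSet_Ioi fun t ht => ?_
  rw [← ofReal_measureReal, ← ENNReal.ofReal_mul measureReal_nonneg]
  refine ENNReal.ofReal_le_ofReal ?_
  calc P.real {x | t ≤ |x|} * (c * Real.exp (c * t))
      ≤ (θ * Real.exp (-β * t)) * (c * Real.exp (c * t)) := by
        gcongr
        exact h t ht
    _ = θ * c * (Real.exp (-β * t) * Real.exp (c * t)) := by ring
    _ = _ := by rw [← Real.exp_add]; ring_nf

lemma integrable_exp_mul_abs_of_tail {θ β c : ℝ} (hc : 0 < c) (hcβ : c < β)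
    (h : ∀ t, 0 < t → P.real {x | t ≤ |x|} ≤ θ * Real.exp (-β * t)) :
    Integrable (fun x => Real.exp (c * |x|)) P ∧
      ∫ x, Real.exp (c * |x|) ∂P ≤ 1 + θ * c / (β - c) := by
  have h1 := lintegral_exp_mul_abs_sub_one_le hc hcβ h
  have h0 : ∀ x : ℝ, 0 ≤ Real.exp (c * |x|) - 1 := fun x =>
    sub_nonneg.2 (Real.one_le_exp (by positivity))
  have hi : Integrable (fun x => Real.exp (c * |x|) - 1) P := by
    refine ⟨Continuous.aestronglyMeasurable (by fun_prop), ?_⟩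
    rw [hasFiniteIntegral_iff_ofReal (Eventually.of_forall h0)]
    exact h1.trans_lt ENNReal.ofReal_lt_top
  have hi' : Integrable (fun x => Real.exp (c * |x|)) P := by
    refine (hi.add (integrable_const (1 : ℝ))).congr (Eventually.of_forall fun x => ?_)
    simp
  refine ⟨hi', ?_⟩
  have hθ : 0 ≤ θ := by
    have h1 := measureReal_nonneg.trans (h 1 one_pos)
    exact nonneg_of_mul_nonneg_left h1 (Real.exp_pos _)
  rw [← ofReal_integral_eq_lintegral_ofReal hi (Eventually.of_forall h0),
    ENNReal.ofReal_le_ofReal_iff (div_nonneg (by positivity) (by linarith)),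
    integral_sub hi' (integrable_const _)] at h1
  simp at h1
  linarith

lemma integrable_exp_of_tail {θ β s : ℝ} (hs : |s| < β)
    (h : ∀ t, 0 < t → P.real {x | t ≤ |x|} ≤ θ * Real.exp (-β * t)) :
    Integrable (fun x : ℝ => Real.exp (s * x)) P := by
  have hs' : |s| < (|s| + β) / 2 := by linarith
  refine (integrable_exp_mul_abs_of_tail (c := (|s| + β) / 2) (by linarith [abs_nonneg s])
    (by linarith) h).1.mono' (Continuous.aestronglyMeasurable (by fun_prop))
    (Eventually.of_forall fun x => ?_)
  rw [Real.norm_of_nonneg (Real.exp_pos _).le, Real.exp_le_exp]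
  calc s * x ≤ |s| * |x| := by rw [← abs_mul]; exact le_abs_self _
    _ ≤ _ := by gcongr

/-- Jensen for a centred law. It allows the normalizing constant of a tilt to be dropped from upper
bounds. -/
lemma one_le_integral_exp {s : ℝ} (hi : Integrable (fun x : ℝ => Real.exp (s * x)) P)
    (h1 : Integrable (fun x : ℝ => x) P) (hmean : ∫ x, x ∂P = 0) :
    1 ≤ ∫ x, Real.exp (s * x) ∂P := by
  have h : ∫ x, (s * x + 1) ∂P ≤ ∫ x, Real.exp (s * x) ∂P :=
    integral_mono ((h1.const_mul s).add (integrable_const _)) hi fun x => Real.add_one_le_exp _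
  rw [integral_add (h1.const_mul s) (integrable_const _), integral_const_mul, hmean] at h
  simpa using h

/-- The tilt costs `exp(β |x| / 4)`, and `|x|³` costs another such factor with constant `3! · 4³ /
β³ = 384 / β³`. The product `exp(β |x| / 2)` has integral at most `1 + θ`. -/
lemma integral_tilted_abs_pow_three_le_of_tail {θ β s : ℝ} (hβ : 0 < β) (hs : |s| ≤ β / 4)
    (h : ∀ t, 0 < t → P.real {x | t ≤ |x|} ≤ θ * Real.exp (-β * t))
    (h1 : Integrable (fun x : ℝ => x) P) (hmean : ∫ x, x ∂P = 0) :
    ∫ x, |x| ^ 3 ∂(P.tilted (fun x => s * x)) ≤ 384 / β ^ 3 * (1 + θ) := by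
  have hi := integrable_exp_of_tail (s := s) (by linarith) h
  obtain ⟨he, hle⟩ := integrable_exp_mul_abs_of_tail (c := β / 2) (by linarith) (by linarith) h
  have hle' : ∫ x, Real.exp (β / 2 * |x|) ∂P ≤ 1 + θ := by
    refine hle.trans_eq ?_
    have : β - β / 2 = β / 2 := by ring
    rw [this, mul_div_assoc, div_self (by positivity), mul_one]
  have hone := one_le_integral_exp hi h1 hmean
  rw [integral_tilted]
  have hb : ∀ x : ℝ, (Real.exp (s * x) / ∫ x, Real.exp (s * x) ∂P) • |x| ^ 3 ≤
      384 / β ^ 3 * Real.exp (β / 2 * |x|) := by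
    intro x
    have e1 : Real.exp (s * x) / ∫ x, Real.exp (s * x) ∂P ≤ Real.exp (β / 4 * |x|) := by
      refine (div_le_self (Real.exp_pos _).le hone).trans (Real.exp_le_exp.2 ?_)
      calc s * x ≤ |s| * |x| := by rw [← abs_mul]; exact le_abs_self _
        _ ≤ _ := by gcongr
    have e2 : |x| ^ 3 ≤ 384 / β ^ 3 * Real.exp (β / 4 * |x|) := by
      have := Real.pow_div_factorial_le_exp (β / 4 * |x|) (by positivity) 3
      rw [div_mul_eq_mul_div, le_div_iff₀ (by positivity)]
      have e : |x| ^ 3 * β ^ 3 = 384 * ((β / 4 * |x|) ^ 3 / (Nat.factorial 3 : ℕ)) := by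
        norm_num [Nat.factorial]; ring
      rw [e]
      gcongr
    calc (Real.exp (s * x) / ∫ x, Real.exp (s * x) ∂P) • |x| ^ 3
        ≤ Real.exp (β / 4 * |x|) * (384 / β ^ 3 * Real.exp (β / 4 * |x|)) := by
          rw [smul_eq_mul]; gcongr
      _ = 384 / β ^ 3 * (Real.exp (β / 4 * |x|) * Real.exp (β / 4 * |x|)) := by ring
      _ = _ := by rw [← Real.exp_add]; ring_nf
  refine (integral_mono_of_nonneg (Eventually.of_forall fun x => ?_) (he.const_mul _)
    (Eventually.of_forall hb)).trans ?_
  · have : 0 < ∫ x, Real.exp (s * x) ∂P := by linarith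
    simp only [Pi.zero_apply, smul_eq_mul]
    positivity
  · rw [integral_const_mul]
    gcongr

lemma integrable_exp_of_ae_mem_Icc {v s : ℝ} (h : ∀ᵐ x ∂P, x ∈ Set.Icc (-v) v) :
    Integrable (fun x : ℝ => Real.exp (s * x)) P := by
  refine (integrable_const (Real.exp (|s| * v))).mono'
    (Continuous.aestronglyMeasurable (by fun_prop)) ?_
  filter_upwards [h] with x hx
  rw [Real.norm_of_nonneg (Real.exp_pos _).le, Real.exp_le_exp]
  calc s * x ≤ |s| * |x| := by rw [← abs_mul]; exact le_abs_self _
    _ ≤ _ := by gcongr; exact abs_le.2 hx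

lemma integral_tilted_abs_pow_three_le_of_ae_mem_Icc {v s : ℝ}
    (h : ∀ᵐ x ∂P, x ∈ Set.Icc (-v) v) :
    ∫ x, |x| ^ 3 ∂(P.tilted (fun x => s * x)) ≤ v ^ 3 := by
  have := isProbabilityMeasure_tilted (integrable_exp_of_ae_mem_Icc (s := s) h)
  have h' := (tilted_absolutelyContinuous P (fun x => s * x)).ae_le h
  calc ∫ x, |x| ^ 3 ∂(P.tilted (fun x => s * x)) ≤ ∫ _, v ^ 3 ∂(P.tilted (fun x => s * x)) := by
        refine integral_mono_of_nonneg (Eventually.of_forall fun x => by positivity)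
          (integrable_const _) ?_
        filter_upwards [h'] with x hx
        have : |x| ≤ v := abs_le.2 hx
        gcongr
    _ = v ^ 3 := by simp

end Tails

/-! ### Conditional tail conditions -/

section Array

variable {Ω : Type*} [mΩ : MeasurableSpace Ω] {μ : Measure Ω} [IsProbabilityMeasure μ]
  {F : ℕ → MeasurableSpace Ω} {W : (n : ℕ) → Fin n → Ω → ℝ}

lemma ae_condLaw_mem_Icc (hF : ∀ n, F n ≤ mΩ) (hW : ∀ n i, Measurable (W n i))
    {v : (n : ℕ) → Fin n → Ω → ℝ} (hv : ∀ n i, Measurable[F n] (v n i))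
    (h : ∀ n i, IsCCS μ (W n i) (v n i)) :
    ∀ᵐ ω ∂μ, ∀ n i, ∀ᵐ x ∂(condLaw (F n) μ (W n i) ω), x ∈ Set.Icc (-v n i ω) (v n i ω) :=
  ae_all_iff.2 fun n => ae_all_iff.2 fun i =>
    ae_ae_condLaw_of_ae (hF n) (hW n i) (@measurableSet_mem_Icc_neg Ω (F n) _ (hv n i)) (h n i)

lemma exists_finiteCGFOn (hF : ∀ n, F n ≤ mΩ) (hW : ∀ n i, Measurable (W n i))
    (htail : CSECondition μ F W ∨ CCSCondition μ F W) : ∃ ε : ℝ, FiniteCGFOn μ F W ε := by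
  rcases htail with ⟨θ, β, hβ, -, -, hcse, -⟩ | ⟨v, hv, -, hccs, -⟩
  · refine ⟨β, hβ, ?_⟩
    have : ∀ᵐ ω ∂μ, ∀ n i, ∀ t : ℝ, 0 < t →
        (condLaw (F n) μ (W n i) ω).real {x | t ≤ |x|} ≤ θ n ω * Real.exp (-β * t) :=
      ae_all_iff.2 fun n => ae_all_iff.2 fun i => hcse n i
    filter_upwards [this] with ω hω n i s hs
    exact integrable_exp_of_tail (abs_lt.2 hs) (hω n i)
  · refine ⟨1, one_pos, ?_⟩
    filter_upwards [ae_condLaw_mem_Icc hF hW hv hccs] with ω hω n i s _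
    exact integrable_exp_of_ae_mem_Icc (hω n i)

/-- Under either tail condition, the third absolute moments of the conditional laws, tilted by a
small amount, are bounded on average in probability. -/
lemma exists_tilted_third_moment_bound (hF : ∀ n, F n ≤ mΩ) (hW : ∀ n i, Measurable (W n i))
    (hmean : ∀ n i, CondMeanZero (F n) μ (W n i))
    (htail : CSECondition μ F W ∨ CCSCondition μ F W) {ε : ℝ} (hε : 0 < ε) :
    ∃ (s0 : ℝ) (b : (n : ℕ) → Fin n → Ω → ℝ), 0 < s0 ∧ s0 ≤ ε / 2 ∧
      (∀ᵐ ω ∂μ, ∀ n i s, |s| ≤ s0 →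
        ∫ x, |x| ^ 3 ∂((condLaw (F n) μ (W n i) ω).tilted (fun x => s * x)) ≤ b n i ω) ∧
      ∀ δ : ℝ, 0 < δ → ∃ B : ℝ, 0 < B ∧ ∀ᶠ n : ℕ in atTop,
        μ {ω | B < (1 / (n : ℝ)) * ∑ i, b n i ω} ≤ ENNReal.ofReal δ := by
  rcases htail with ⟨θ, β, hβ, -, -, hcse, hθ⟩ | ⟨v, hv, hv0, hccs, hO⟩
  · refine ⟨min (β / 4) (ε / 2), fun n i ω => 384 / β ^ 3 * (1 + θ n ω),
      lt_min (by positivity) (by positivity), min_le_right _ _, ?_, ?_⟩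
    · have h1 : ∀ᵐ ω ∂μ, ∀ n i, ∀ t : ℝ, 0 < t →
          (condLaw (F n) μ (W n i) ω).real {x | t ≤ |x|} ≤ θ n ω * Real.exp (-β * t) :=
        ae_all_iff.2 fun n => ae_all_iff.2 fun i => hcse n i
      have h2 : ∀ᵐ ω ∂μ, ∀ n i, Integrable (fun x : ℝ => x) (condLaw (F n) μ (W n i) ω) ∧
          ∫ x, x ∂(condLaw (F n) μ (W n i) ω) = 0 :=
        ae_all_iff.2 fun n => ae_all_iff.2 fun i => hmean n i
      filter_upwards [h1, h2] with ω hω1 hω2 n i s hs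
      exact integral_tilted_abs_pow_three_le_of_tail hβ (hs.trans (min_le_left _ _)) (hω1 n i)
        (hω2 n i).1 (hω2 n i).2
    · intro δ hδ
      obtain ⟨M, hM, hlim⟩ := hθ δ hδ
      refine ⟨384 / β ^ 3 * (1 + M), by positivity, ?_⟩
      filter_upwards [eventually_lt_of_limsup_lt hlim, eventually_ge_atTop 1] with n hn hn1
      refine (measure_mono fun ω hω => ?_).trans hn.le
      have hn0 : (n : ℝ) ≠ 0 := by positivity
      simp only [Set.mem_ofPred_eq, Finset.sum_const, Finset.card_univ, Fintype.card_fin,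
        nsmul_eq_mul] at hω ⊢
      rw [← mul_assoc, one_div, inv_mul_cancel₀ hn0, one_mul] at hω
      have := lt_of_mul_lt_mul_left hω (by positivity)
      exact lt_of_lt_of_le (by linarith) (le_abs_self _)
  · refine ⟨ε / 2, fun n i ω => v n i ω ^ 3, by positivity, le_rfl, ?_, ?_⟩
    · filter_upwards [ae_condLaw_mem_Icc hF hW hv hccs] with ω hω n i s _
      exact integral_tilted_abs_pow_three_le_of_ae_mem_Icc (hω n i)
    · intro δ hδ
      obtain ⟨M, hM, hlim⟩ := hO δ hδ
      refine ⟨1 + M, by positivity, ?_⟩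
      filter_upwards [eventually_lt_of_limsup_lt hlim, eventually_ge_atTop 1] with n hn hn1
      refine (measure_mono fun ω (hω : 1 + M < _) => ?_).trans hn.le
      have hn0 : (0 : ℝ) < n := by positivity
      -- Tilting preserves the support, so only third powers of the bounds are needed; fourth powers
      -- dominate them.
      have h1 : ∀ i, v n i ω ^ 3 ≤ 1 + v n i ω ^ 4 := fun i => by
        nlinarith [sq_nonneg (v n i ω ^ 2 - 1), sq_nonneg (v n i ω ^ 2 - v n i ω),
          sq_nonneg (v n i ω - 1), sq_nonneg (v n i ω), sq_nonneg (v n i ω ^ 2)]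
      have h2 : (1 / (n : ℝ)) * ∑ i, v n i ω ^ 3 ≤ 1 + (1 / (n : ℝ)) * ∑ i, v n i ω ^ 4 := by
        calc (1 / (n : ℝ)) * ∑ i, v n i ω ^ 3 ≤ (1 / (n : ℝ)) * ∑ i, (1 + v n i ω ^ 4) := by
              gcongr with i
              exact h1 i
          _ = _ := by
              rw [Finset.sum_add_distrib, mul_add]
              simp [hn0.ne']
      exact lt_of_lt_of_le (lt_of_add_lt_add_left (hω.trans_le h2)) (le_abs_self _)

/-- The saddlepoint equation is uniquely solvable and the relative error is at most `τ` outside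
events of small probability. -/
lemma eventually_exists_small_exceptional_set (hF : ∀ n, F n ≤ mΩ)
    (hW : ∀ n i, Measurable (W n i)) (hmean : ∀ n i, CondMeanZero (F n) μ (W n i))
    (hindep : ∀ n, CondIndependent (F n) μ (W n))
    (htail : CSECondition μ F W ∨ CCSCondition μ F W)
    (hvar : IsBigOmegaP μ (fun n => avgCondVar (F n) μ (W n)))
    {w : ℕ → Ω → ℝ} (hw : ∀ n, Measurable[F n] (w n)) (hw0 : IsLittleOP μ w)
    {ε : ℝ} (hε : FiniteCGFOn μ F W ε) {τ δ : ℝ} (hτ : 0 < τ) (hτ1 : τ ≤ 1) (hδ : 0 < δ) :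
    ∀ᶠ n in atTop, ∃ U : Set Ω, μ U ≤ ENNReal.ofReal (3 * δ) ∧ ∀ ω, ω ∉ U →
      (saddleSet (avgCGF (F n) μ (W n) ω) (w n ω) ε).encard = 1 ∧
      |(μ⟦{ω | w n ω ≤ (1 / (n : ℝ)) * ∑ i, W n i ω} | F n⟧) ω -
          lugannaniRice n (avgCGF (F n) μ (W n) ω) (w n ω) ε| ≤
        τ * |lugannaniRice n (avgCGF (F n) μ (W n) ω) (w n ω) ε| := by
  obtain ⟨s0, b, hs0, hs0ε, hb, hbO⟩ :=
    exists_tilted_third_moment_bound hF hW hmean htail hε.1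
  obtain ⟨B, hB, hBev⟩ := hbO δ hδ
  obtain ⟨η, hη, hηlim⟩ := hvar δ hδ
  obtain ⟨N, w0, hw00, hcore⟩ := exists_uniform_lugannaniRice hs0 hs0ε hB hη hτ hτ1
  have hwev : ∀ᶠ n in atTop, μ {ω | w0 < |w n ω|} ≤ ENNReal.ofReal δ :=
    (hw0 w0 hw00).eventually (Iic_mem_nhds (ENNReal.ofReal_pos.2 hδ))
  filter_upwards [hBev, eventually_lt_of_limsup_lt hηlim, hwev, eventually_ge_atTop N]
    with n hn1 hn2 hn3 hnN
  have hm : ∀ᵐ ω ∂μ, ∀ i, Integrable (fun x : ℝ => x) (condLaw (F n) μ (W n i) ω) ∧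
      ∫ x, x ∂(condLaw (F n) μ (W n i) ω) = 0 := ae_all_iff.2 fun i => hmean n i
  have hgood := (condProb_mean_ge_ae_eq (hF n) (hW n) (hindep n) (hw n)).and
    (hm.and (hb.and hε.2))
  obtain ⟨G, hG, hGspec⟩ := hgood.exists_mem
  -- Three events of probability at most `δ` each (large third moments, small variance, large
  -- threshold) and a null set; elsewhere the uniform deterministic bound applies.
  refine ⟨({ω | B < (1 / (n : ℝ)) * ∑ i, b n i ω} ∪ {ω | |avgCondVar (F n) μ (W n) ω| < η}) ∪
    {ω | w0 < |w n ω|} ∪ Gᶜ, ?_, fun ω hω => ?_⟩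
  rotate_left
  · simp only [Set.mem_union, not_or, Set.mem_ofPred_eq, not_lt, Set.notMem_compl_iff] at hω
    obtain ⟨⟨⟨h1, h2⟩, h3⟩, h4⟩ := hω
    obtain ⟨hp, hm', hb', hε'⟩ : _ ∧ _ := hGspec ω h4
    have havg : 0 ≤ avgCondVar (F n) μ (W n) ω :=
      mul_nonneg (by positivity) (Finset.sum_nonneg fun i _ => integral_nonneg fun x => sq_nonneg x)
    rw [abs_of_nonneg havg] at h2
    have := hcore n hnN (fun i => condLaw (F n) μ (W n i) ω) (fun i => b n i ω)
      (fun i => hε' n i) (fun i => (hm' i).2) (fun i => hb' n i) h1 h2 (w n ω) h3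
      (avgCGF (F n) μ (W n) ω) rfl
    rw [hp]
    exact this
  · refine (measure_union_le _ _).trans ?_
    rw [mem_ae_iff.1 hG, add_zero]
    refine (measure_union_le _ _).trans ((add_le_add (measure_union_le _ _) le_rfl).trans ?_)
    refine (add_le_add (add_le_add hn1 hn2.le) hn3).trans_eq ?_
    rw [← ENNReal.ofReal_add hδ.le hδ.le, ← ENNReal.ofReal_add (by positivity) hδ.le]
    ring_nf

lemma tendsto_measure_zero_of_eventually_le {μ : Measure Ω} {A : ℕ → Set Ω}
    (h : ∀ δ : ℝ, 0 < δ → ∀ᶠ n in atTop, μ (A n) ≤ ENNReal.ofReal (3 * δ)) :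
    Tendsto (fun n => μ (A n)) atTop (𝓝 0) := by
  rw [ENNReal.tendsto_nhds_zero]
  intro e he
  rcases eq_or_ne e ⊤ with rfl | htop
  · exact Eventually.of_forall fun _ => le_top
  · have hpos := ENNReal.toReal_pos he.ne' htop
    filter_upwards [h (e.toReal / 3) (by positivity)] with n hn
    rwa [mul_div_cancel₀ _ (by norm_num : (3 : ℝ) ≠ 0), ENNReal.ofReal_toReal htop] at hn

/-- Subadditivity of the outer measure gives `1 ≤ μ (A n) + μ (A n)ᶜ`, so the sets need not be
measurable. -/
lemma tendsToProbOne_of_compl {A : ℕ → Set Ω} (h : Tendsto (fun n => μ (A n)ᶜ) atTop (𝓝 0)) :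
    TendsToProbOne μ A := by
  refine ⟨?_, h⟩
  have hlow : Tendsto (fun n => 1 - μ (A n)ᶜ) atTop (𝓝 1) := by
    simpa using ENNReal.Tendsto.sub (tendsto_const_nhds (x := (1 : ENNReal))) h
      (Or.inl ENNReal.one_ne_top)
  refine tendsto_of_tendsto_of_tendsto_of_le_of_le hlow tendsto_const_nhds (fun n => ?_)
    fun n => prob_le_one
  rw [tsub_le_iff_right, ← measure_univ (μ := μ), ← Set.union_compl_self (A n)]
  exact measure_union_le _ _

end Array

end CondSPA

theorem theorem1 {Ω : Type*} [mΩ : MeasurableSpace Ω] (μ : Measure Ω) [IsProbabilityMeasure μ]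
    (F : ℕ → MeasurableSpace Ω) (hF : ∀ n, F n ≤ mΩ)
    (W : (n : ℕ) → Fin n → Ω → ℝ) (hW : ∀ n i, Measurable (W n i))
    (hmean : ∀ n i, CondSPA.CondMeanZero (F n) μ (W n i))
    (hindep : ∀ n, CondSPA.CondIndependent (F n) μ (W n))
    (htail : CondSPA.CSECondition μ F W ∨ CondSPA.CCSCondition μ F W)
    (hvar : CondSPA.IsBigOmegaP μ (fun n => CondSPA.avgCondVar (F n) μ (W n)))
    (w : ℕ → Ω → ℝ) (hw : ∀ n, Measurable[F n] (w n)) (hw0 : CondSPA.IsLittleOP μ w) :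
    (∃ ε : ℝ, CondSPA.FiniteCGFOn μ F W ε) ∧
    ∀ ε : ℝ, CondSPA.FiniteCGFOn μ F W ε →
      CondSPA.TendsToProbOne μ (fun n =>
        {ω | (CondSPA.saddleSet (CondSPA.avgCGF (F n) μ (W n) ω) (w n ω) ε).encard = 1}) ∧
      CondSPA.VanishingRelError μ
        (fun n => μ⟦{ω | w n ω ≤ (1 / (n : ℝ)) * ∑ i, W n i ω} | F n⟧)
        (fun n ω => CondSPA.lugannaniRice n (CondSPA.avgCGF (F n) μ (W n) ω) (w n ω) ε) := by
  refine ⟨CondSPA.exists_finiteCGFOn hF hW htail, fun ε hε => ⟨?_, fun η hη => ?_⟩⟩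
  · refine CondSPA.tendsToProbOne_of_compl (CondSPA.tendsto_measure_zero_of_eventually_le
      fun δ hδ => ?_)
    filter_upwards [CondSPA.eventually_exists_small_exceptional_set hF hW hmean hindep htail hvar hw
      hw0 hε one_pos le_rfl hδ] with n ⟨U, hU, h⟩
    refine (measure_mono fun ω hω => ?_).trans hU
    by_contra hωU
    exact hω (h ω hωU).1
  · refine CondSPA.tendsto_measure_zero_of_eventually_le fun δ hδ => ?_
    -- The uniform bound is stated for `τ ≤ 1`, hence the choice `τ = min η 1`.
    filter_upwards [CondSPA.eventually_exists_small_exceptional_set hF hW hmean hindep htail hvar hw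
      hw0 hε (lt_min hη one_pos) (min_le_right _ _) hδ] with n ⟨U, hU, h⟩
    refine (measure_mono fun ω (hω : (_ : ℝ) < _) => ?_).trans hU
    by_contra hωU
    exact absurd ((h ω hωU).2.trans (mul_le_mul_of_nonneg_right (min_le_left _ _)
      (abs_nonneg _))) (not_le.2 hω)
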